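/- Let $0<q<1$, let $p$ be a real polynomial of degree $m$, and let $P$ be a positive densely defined operator with compact inverse on a Hilbert space, whose spectrum is $\{q^{-n} : n=0,1,2,\dots\}$, the eigenvalue $\lambda_n=q^{-n}$ having multiplicity $M_n=p(n)$. Write $\log_q t=\log t/\log q$. **The zeta function.** Let $\tilde p$ be the polynomial of degree at most $m$ given by $\tilde p(z)=(1-z)^{m+1}\sum_{n\ge 0}p(n)z^n$. It satisfies $\tilde p(1)=m!\,p_m\neq 0$, where $p_m$ is the leading coefficient of $p$, and $\deg\tilde p=m$ if and only if $p(-1)\ne 0$. The spectral zeta function $\zeta_P(s)=\operatorname{Tr}P^{-s}$ has abscissa of convergence $L=0$, equals $\tilde p(q^s)/(1-q^s)^{m+1}$ for $\operatorname{Re}s>0$, and so extends meromorphically to $\mathbb C$. Put $\mathcal Z(s)=\Gamma(s)\zeta_P(s)$, and for $t>0$ let $r_s(t)$ be the residue of $s'\mapsto \mathcal Z(s')t^{-s'}$ at $s'=s$. **Residue expansions.** An admissible choice of strips consists of reals $R_0<R_1<\dots\to\infty$ with $-R_0>L$ and $-R_n<L$ for $n\ge1$, such that $\mathcal Z$ is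 regular and integrable on every line $\operatorname{Re}s=-R_n$, together with, for each $n\ge 1$, a strictly increasing family $(y^{(n)}_k)_{k\in\mathbb Z}$ with $y^{(n)}_0=0$ and $y^{(n)}_k\to\pm\infty$ as $k\to\pm\infty$, such that $\sup_{x\in[-R_n,-R_{n-1}]}|\mathcal Z(x+iy^{(n)}_k)|$ is finite for $k\ne0$ and tends to $0$ as $k\to\pm\infty$. For $k\ge1$ let $D^n_k$ be the rectangle $-R_n\le\operatorname{Re}s\le-R_{n-1}$, $y^{(n)}_{-k}\le\operatorname{Im}s\le y^{(n)}_k$, let $D^n_0=\emptyset$, and set $\phi_n(t)=\sum_{k\ge1}\sum_{s}r_s(t)$, the inner sum being over the finitely many poles $s$ of $\mathcal Z$ in $D^n_k\setminus D^n_{k-1}$. Then the heat trace $h_P(t)=\operatorname{Tr}e^{-tP}$ is well defined for every $t>0$, and its expansion is absolutely exact for all $t>0$: 1. For every admissible choice of strips, the series defining each $\phi_n(t)$ converges, $h_P(t)=\sum_{n\ge1}\phi_n(t)$ for all $t>0$, and $\sum_{n\ge1}|\phi_n(t)|$ converges locally uniformly on $(0,\infty)$. 2. There is an admissible choice for which,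 moreover, $(\phi_n)$ is an asymptotic scale, i.e. $\phi_{n+1}=o(\phi_n)$ as $t\downarrow0$, and $\sum_n\phi_n$ is an asymptotic expansion of $h_P$, i.e. $h_P-\sum_{n=1}^N\phi_n=O(\phi_{N+1})$ as $t\downarrow 0$ for all $N\ge 1$. 3. For all $t>0$, $$h_P(t)=\frac{\tilde p(1)}{(m+1)!}\,(\log_q t)^{m+1}+\sum_{j=0}^m\bigl(r_j+G_j(\log_q t)\bigr)(\log_q t)^j+\sum_{n=1}^\infty\frac{\tilde p(q^{-n})}{(1-q^{-n})^{m+1}}\,\frac{(-t)^n}{n!},$$ the last series being absolutely convergent. Here $G_j(x)=\sum_{k\in\mathbb Z\setminus\{0\}}g_{j,k}e^{2\pi ikx}$ are absolutely convergent Fourier series, and the constants $r_j=g_{j,0}$ and $g_{j,k}$ are determined by $q$ and $p$ through $$g_{j,k}=\frac{(-\log q)^j}{j!}\operatorname*{Res}_{s=s_k}\left((s-s_k)^j\,\Gamma(s)\,\frac{\tilde p(q^s)}{(1-q^s)^{m+1}}\right),\qquad s_k=-\frac{2\pi ik}{\log q}.$$ The choice $R_n=n-\tfrac12$ is admissible with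 suitable $y^{(n)}_k$, and for it $\phi_1(t)$ is the part of the right-hand side involving $\log_q t$, while $\phi_{n+1}(t)$, for $n\ge 1$, is the $n$-th term of the last series. -/

import Mathlib

open Filter Topology Set MeasureTheory
open scoped InnerProductSpace ComplexOrder Polynomial

/-! ### Positive operators with compact inverse, functional calculus, traces -/

/-- `P` is a positive densely defined operator on `H` with compact inverse `K`. (Such a `P` is
automatically self-adjoint and closed, and `K` is uniquely determined by `P`. The inequality in `ℂ`
says that `⟪x, P x⟫` is real and nonnegative.) -/
structure IsPositiveWithCompactInverse {H : Type*} [NormedAddCommGroup H] [InnerProductSpace ℂ H]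
    (P : H →ₗ.[ℂ] H) (K : H →L[ℂ] H) : Prop where
  dense_domain : Dense (P.domain : Set H)
  nonneg : ∀ x : P.domain, 0 ≤ ⟪(x : H), P x⟫_ℂ
  compact : IsCompactOperator K
  left_inv : ∀ x : P.domain, K (P x) = x
  right_inv : ∀ y : H, ∃ h : K y ∈ P.domain, P ⟨K y, h⟩ = y

/-- The spectrum of an operator with compact inverse (such an operator is closed, so that a bijection
`P - z : dom P → H` automatically has a bounded inverse). -/
def operatorSpectrum {H : Type*} [NormedAddCommGroup H] [InnerProductSpace ℂ H]
    (P : H →ₗ.[ℂ] H) : Set ℂ :=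
  {z | ¬ Function.Bijective fun x : P.domain => P x - z • (x : H)}

/-- The eigenspace `ker (P - z)`. -/
def operatorEigenspace {H : Type*} [NormedAddCommGroup H] [InnerProductSpace ℂ H]
    (P : H →ₗ.[ℂ] H) (z : ℂ) : Submodule ℂ H :=
  (LinearMap.ker (P.toFun - z • P.domain.subtype)).map P.domain.subtype

/-- The operator `exp (-t P)` for `t > 0`, written through the continuous functional calculus of the
bounded operator `K = P⁻¹`: it is `f(K)` with `f(x) = exp (-t / x)` for `x ≠ 0` and `f(0) = 0`; this
`f` is continuous on `[0, ∞)`, which contains the spectrum of `K`. -/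
noncomputable def heatOperator {H : Type*} [NormedAddCommGroup H] [InnerProductSpace ℂ H]
    [CompleteSpace H] (K : H →L[ℂ] H) (t : ℝ) : H →L[ℂ] H :=
  cfc (fun z : ℂ => if z = 0 then 0 else Complex.exp (-t / z)) K

/-- The operator `P⁻ˢ = Kˢ`, `K = P⁻¹`, for `Re s > 0`. -/
noncomputable def complexPowerOperator {H : Type*} [NormedAddCommGroup H] [InnerProductSpace ℂ H]
    [CompleteSpace H] (K : H →L[ℂ] H) (s : ℂ) : H →L[ℂ] H :=
  cfc (fun z : ℂ => z ^ s) K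

/-- `T` is trace class: `|T| = (T* T)^(1/2)` has finite trace. Every orthonormal basis of
`H : Type u` can be indexed by a type in the universe `u`. -/
def IsTraceClass.{u} {H : Type u} [NormedAddCommGroup H] [InnerProductSpace ℂ H] [CompleteSpace H]
    (T : H →L[ℂ] H) : Prop :=
  ∀ (ι : Type u) (b : HilbertBasis ι ℂ H),
    Summable fun i => (⟪b i, CFC.abs T (b i)⟫_ℂ).re

/-- `T` is trace class and its trace is `a`. -/
def HasTrace.{u} {H : Type u} [NormedAddCommGroup H] [InnerProductSpace ℂ H] [CompleteSpace H]
    (T : H →L[ℂ] H) (a : ℂ) : Prop :=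
  IsTraceClass T ∧ ∀ (ι : Type u) (b : HilbertBasis ι ℂ H),
    HasSum (fun i => ⟪b i, T (b i)⟫_ℂ) a

/-- `L ≥ 0` is the abscissa of convergence of the spectral zeta function `s ↦ Tr P⁻ˢ`. -/
def IsZetaAbscissa {H : Type*} [NormedAddCommGroup H] [InnerProductSpace ℂ H] [CompleteSpace H]
    (K : H →L[ℂ] H) (L : ℝ) : Prop :=
  0 ≤ L ∧ ∀ σ : ℝ, 0 < σ →
    (L < σ → IsTraceClass (complexPowerOperator K σ)) ∧
    (σ < L → ¬ IsTraceClass (complexPowerOperator K σ))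

/-! ### Residue expansions -/

/-- The residue of `f` at an isolated singularity `c`. -/
noncomputable def residue (f : ℂ → ℂ) (c : ℂ) : ℂ :=
  limUnder (𝓝[>] (0 : ℝ)) fun r : ℝ =>
    (2 * Real.pi * Complex.I)⁻¹ * ∮ z in C(c, r), f z

/-- The poles of the meromorphic function `f` in `D`. -/
def polesIn (f : ℂ → ℂ) (D : Set ℂ) : Set ℂ :=
  {s ∈ D | meromorphicOrderAt f s < 0}

/-- `r_s(t)`, the residue of `s' ↦ Z(s') t^(-s')` at `s`. -/
noncomputable def residueTerm (Z : ℂ → ℂ) (t : ℝ) (s : ℂ) : ℂ :=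
  residue (fun s' => Z s' * (t : ℂ) ^ (-s')) s

/-- The supremum of `|Z|` over the horizontal segment `[a, b] + i v`, in `[0, ∞]`. -/
noncomputable def horizontalSup (Z : ℂ → ℂ) (a b v : ℝ) : ENNReal :=
  ⨆ x ∈ Icc a b, ‖Z (x + v * Complex.I)‖ₑ

/-- The admissible choices of abscissae `R` and ordinates `y` for cutting the plane into strips
`-R (n+1) ≤ Re s ≤ -R n` and rectangles. Here `Z` is the meromorphic continuation of `Γ ζ_P`
and `L` is the abscissa of convergence of `ζ_P`. -/
structure IsAdmissibleCut (Z : ℂ → ℂ) (L : ℝ) (R : ℕ → ℝ) (y : ℕ → ℤ → ℝ) : Prop where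
  strictMono_R : StrictMono R
  tendsto_R : Tendsto R atTop atTop
  lt_neg_R_zero : L < -R 0
  neg_R_lt : ∀ n, 1 ≤ n → -R n < L
  regular : ∀ n, ∀ s : ℂ, s.re = -R n → 0 ≤ meromorphicOrderAt Z s
  integrable : ∀ n, Integrable fun v : ℝ => Z ((-R n : ℝ) + v * Complex.I)
  strictMono_y : ∀ n, StrictMono (y n)
  y_zero : ∀ n, y n 0 = 0
  tendsto_y_top : ∀ n, Tendsto (y n) atTop atTop
  tendsto_y_bot : ∀ n, Tendsto (y n) atBot atBot
  sup_lt_top : ∀ n k, k ≠ 0 → horizontalSup Z (-R (n + 1)) (-R n) (y n k) < ⊤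
  sup_tendsto_top :
    ∀ n, Tendsto (fun k => horizontalSup Z (-R (n + 1)) (-R n) (y n k)) atTop (𝓝 0)
  sup_tendsto_bot :
    ∀ n, Tendsto (fun k => horizontalSup Z (-R (n + 1)) (-R n) (y n k)) atBot (𝓝 0)

/-- The rectangles `D_k` in the `n`-th strip, with `D_0 = ∅`. -/
def cutRectangle (R : ℕ → ℝ) (y : ℕ → ℤ → ℝ) (n : ℕ) : ℕ → Set ℂ
  | 0 => ∅
  | k + 1 => {s | s.re ∈ Icc (-R (n + 1)) (-R n) ∧
      s.im ∈ Icc (y n (-((k : ℤ) + 1))) (y n ((k : ℤ) + 1))}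

/-- `φ n t` is the sum of the residues `r_s(t)` over the poles `s` of `Z` in the `n`-th strip,
`n = 0, 1, …`, `t > 0`: the (finite) sums over the poles in `D_(k+1) \ D_k` are added in the order
`k = 0, 1, …`, and the series over `k` converges. -/
def IsResidueScale (Z : ℂ → ℂ) (R : ℕ → ℝ) (y : ℕ → ℤ → ℝ) (φ : ℕ → ℝ → ℂ) : Prop :=
  ∀ n, ∀ t : ℝ, 0 < t →
    Tendsto (fun N : ℕ => ∑ k ∈ Finset.range N,
      ∑ᶠ s ∈ polesIn Z (cutRectangle R y n (k + 1) \ cutRectangle R y n k), residueTerm Z t s)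
      atTop (𝓝 (φ n t))

/-- `φ` is an asymptotic scale at `0` and `f ∼ ∑ φ n` as `t ↓ 0`. -/
def IsAsymptoticExpansionAtZero (f : ℝ → ℂ) (φ : ℕ → ℝ → ℂ) : Prop :=
  (∀ n, φ (n + 1) =o[𝓝[>] (0 : ℝ)] φ n) ∧
  ∀ N : ℕ, (fun t => f t - ∑ n ∈ Finset.range (N + 1), φ n t) =O[𝓝[>] (0 : ℝ)] φ (N + 1)

/-- The expansion `f = ∑ φ n` is absolutely exact on `(0, ∞)`: it holds for every `t > 0`, and
`∑ |φ n|` converges locally uniformly on `(0, ∞)`. -/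
def IsAbsolutelyExact (f : ℝ → ℂ) (φ : ℕ → ℝ → ℂ) : Prop :=
  (∀ t, 0 < t → HasSum (fun n => φ n t) (f t)) ∧
  TendstoLocallyUniformlyOn (fun (N : ℕ) (t : ℝ) => ∑ n ∈ Finset.range N, ‖φ n t‖)
    (fun t => ∑' n, ‖φ n t‖) atTop (Ioi 0)

/-! ### The data of an exponential spectrum -/

/-- The polynomial `p̃`: with `m = deg p`, the power series `(1 - X)^(m+1) ∑ p(n) Xⁿ` is a polynomial
of degree at most `m`. -/
noncomputable def numeratorPoly (p : ℝ[X]) : ℝ[X] :=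
  PowerSeries.trunc (p.natDegree + 1)
    ((1 - PowerSeries.X) ^ (p.natDegree + 1) * PowerSeries.mk fun n : ℕ => p.eval (n : ℝ))

/-- `p̃(z)` at a complex number `z`. -/
noncomputable def numeratorEval (p : ℝ[X]) (z : ℂ) : ℂ := Polynomial.aeval z (numeratorPoly p)

/-- `p̃(q^s) / (1 - q^s)^(m+1)`. -/
noncomputable def expZeta (q : ℝ) (p : ℝ[X]) (s : ℂ) : ℂ :=
  numeratorEval p ((q : ℂ) ^ s) / (1 - (q : ℂ) ^ s) ^ (p.natDegree + 1)

/-- `Γ(s) p̃(q^s) / (1 - q^s)^(m+1)`. -/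
noncomputable def expZ (q : ℝ) (p : ℝ[X]) (s : ℂ) : ℂ := Complex.Gamma s * expZeta q p s

/-- The point `s_k = -2πik / log q`. -/
noncomputable def latticePole (q : ℝ) (k : ℤ) : ℂ :=
  -(2 * Real.pi * Complex.I * k) / (Real.log q : ℂ)

/-- `((-log q)^j / j!) · Res_{s = s_k} (s - s_k)^j Γ(s) p̃(q^s) / (1 - q^s)^(m+1)`. -/
noncomputable def oscCoeff (q : ℝ) (p : ℝ[X]) (j : ℕ) (k : ℤ) : ℂ :=
  (-(Real.log q : ℂ)) ^ j / (j.factorial : ℂ) *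
    residue (fun s => (s - latticePole q k) ^ j * expZ q p s) (latticePole q k)

/-- The constants `r_j`. -/
noncomputable def constCoeff (q : ℝ) (p : ℝ[X]) (j : ℕ) : ℂ := oscCoeff q p j 0

/-- The Fourier series `G_j(x) = ∑_{k ≠ 0} g_{j,k} e^{2πikx}`. -/
noncomputable def oscSeries (q : ℝ) (p : ℝ[X]) (j : ℕ) (x : ℝ) : ℂ :=
  ∑' k : ℤ, if k = 0 then 0 else oscCoeff q p j k * Complex.exp (2 * Real.pi * Complex.I * k * x)

/-- The terms of the expansion: for `n = 0` the polynomial in `log_q t` with oscillating coefficients,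
for `n ≥ 1` the term `p̃(q^(-n)) / (1 - q^(-n))^(m+1) · (-t)^n / n!`. -/
noncomputable def expTerm (q : ℝ) (p : ℝ[X]) : ℕ → ℝ → ℂ
  | 0, t =>
      numeratorEval p 1 / ((p.natDegree + 1).factorial : ℂ) *
          (Real.logb q t : ℂ) ^ (p.natDegree + 1) +
        ∑ j ∈ Finset.range (p.natDegree + 1),
          (constCoeff q p j + oscSeries q p j (Real.logb q t)) * (Real.logb q t : ℂ) ^ j
  | n + 1, t =>
      numeratorEval p ((q : ℂ)⁻¹ ^ (n + 1)) /
          (1 - (q : ℂ)⁻¹ ^ (n + 1)) ^ (p.natDegree + 1) *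
        ((-(t : ℂ)) ^ (n + 1) / ((n + 1).factorial : ℂ))

/-! ### The numerator polynomial -/

/-! The inverse `K` is compact and positive, and `H` has an orthonormal basis of eigenvectors of `K`
in which `q ^ n` occurs `p(n)` times. The functional calculus acts diagonally on it and the trace
does not depend on the basis, so `Tr f(K) = ∑ p(n) f(q ^ n)` whenever this converges absolutely
(`IsPositiveWithCompactInverse.hasTrace_cfc`). The operators thus reduce to the scalar series `∑
p(n) q^(ns)` and `∑ p(n) exp(-t q^(-n))`.

The rational function `p̃(z) / (1 - z)^(m+1)` has two expansions: `∑ p(n) z^n` for `|z| < 1` and `-∑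
p(-n-1) z^(-n-1)` for `|z| > 1`. The first, with Mellin inversion of `exp(-x)`, writes `2π` times
the heat trace as the integral of `Γ(s) ζ(s) t^(-s)` over `Re s = 1/2` (`hasSum_right`). This line
is shifted once, to `Re s = -1/2`, across the poles `s_k` on the imaginary axis. There `|q^s| > 1`,
the second expansion applies, and each of its terms integrates to `2π (exp(-x) - 1)` with `x = t
q^(n+1)` (`hasSum_left`). Expanding these exponentials and exchanging the two sums gives exactly the
power series in `t` (`hasSum_expTerm_succ`), so the left integral is known in closed form. No limit
of lines going to `-∞` has to be controlled, and the expansion is exact (`hasSum_heat`).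

The residues at the `s_k` are computed by expanding `t^(-s)` about `s_k`. They are polynomials in
`log_q t` times `exp(2πik log_q t)`; the pole of `Γ` at `0` supplies the extra power `m + 1`
(`residueTerm_latticePole`, `oscCoeff_top`).

All residues together form an absolutely summable family, with a summable majorant uniform in `t` on
compact sets (`exists_residueTerm_bound`). An admissible choice of strips merely groups this family,
whence absolute exactness for every choice (`isAbsolutelyExact_residueBlock`,
`isResidueScale_residueBlock`). For an asymptotic scale no term may vanish identically. Since
`p̃(q^(-n)) = 0` for at most finitely many `n`, the strips are widened to skip these `n`
(`exists_strictMono_numeratorEval_ne_zero`). -/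

theorem taylor_neg_one_coeff (p : ℝ[X]) {m n : ℕ} (hp : p.natDegree ≤ m + 1) (hn : m ≤ n) :
    (Polynomial.taylor (-1) p).coeff n = p.coeff n - (n + 1) * p.coeff (n + 1) := by
  -- For `n ≥ m` the `n`-th Hasse derivative has degree at most `1`, so two terms represent it.
  rw [Polynomial.taylor_coeff, Polynomial.eval_eq_sum_range' (n := 2)]
  · simp only [Finset.sum_range_succ, Finset.sum_range_zero, Polynomial.hasseDeriv_coeff]
    rw [show 1 + n = n + 1 by ring, Nat.choose_succ_self_right]
    simp
    ring
  · have := Polynomial.natDegree_hasseDeriv_le p n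
    omega

/-- The backward difference `p(x) - p(x - 1)`. -/
noncomputable def backwardDiff (p : ℝ[X]) : ℝ[X] := p - Polynomial.taylor (-1) p

theorem backwardDiff_eval (p : ℝ[X]) (x : ℝ) :
    (backwardDiff p).eval x = p.eval x - p.eval (x - 1) := by
  simp [backwardDiff, Polynomial.taylor_eval, sub_eq_add_neg]

theorem backwardDiff_coeff (p : ℝ[X]) {m n : ℕ} (hp : p.natDegree ≤ m + 1) (hn : m ≤ n) :
    (backwardDiff p).coeff n = (n + 1) * p.coeff (n + 1) := by
  rw [backwardDiff, Polynomial.coeff_sub, taylor_neg_one_coeff p hp hn]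
  ring

theorem backwardDiff_natDegree_le (p : ℝ[X]) {m : ℕ} (hp : p.natDegree ≤ m + 1) :
    (backwardDiff p).natDegree ≤ m := by
  rw [Polynomial.natDegree_le_iff_coeff_eq_zero]
  intro n hn
  rw [backwardDiff_coeff p hp hn.le, Polynomial.coeff_eq_zero_of_natDegree_lt (by omega), mul_zero]

theorem summable_eval_mul_pow (p : ℝ[X]) {z : ℂ} (hz : ‖z‖ < 1) :
    Summable fun n : ℕ => ((p.eval (n : ℝ) : ℝ) : ℂ) * z ^ n := by
  induction p using Polynomial.induction_on' with
  | add p r hp hr => simpa [add_mul] using hp.add hr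
  | monomial k a =>
    have h := (summable_norm_pow_mul_geometric_of_norm_lt_one (R := ℂ) k hz).of_norm.mul_left (a : ℂ)
    simpa [mul_assoc] using h

theorem summable_eval_neg_mul_pow (p : ℝ[X]) {z : ℂ} (hz : ‖z‖ < 1) :
    Summable fun n : ℕ => ((p.eval (-(n : ℝ) - 1) : ℝ) : ℂ) * z ^ n := by
  refine (summable_eval_mul_pow (p.comp (-Polynomial.X - 1)) hz).congr fun n => ?_
  simp [Polynomial.eval_comp]

/-- Multiplication by `1 - z` telescopes, lowering the degree of the coefficient polynomial by one.
The constant `p(-1)` arises because the backward difference at `0` reaches the index `-1`. -/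
theorem one_sub_mul_tsum_eval (p : ℝ[X]) {z : ℂ} (hz : ‖z‖ < 1) :
    (1 - z) * ∑' n : ℕ, ((p.eval (n : ℝ) : ℝ) : ℂ) * z ^ n =
      ∑' n : ℕ, (((backwardDiff p).eval (n : ℝ) : ℝ) : ℂ) * z ^ n + p.eval (-1) := by
  have h1 := summable_eval_mul_pow p hz
  have h2 := summable_eval_mul_pow (backwardDiff p) hz
  have h3 := (summable_nat_add_iff 1).2 h1
  have h4 := h1.mul_left z
  rw [sub_mul, one_mul, ← tsum_mul_left, h1.tsum_eq_zero_add, h2.tsum_eq_zero_add,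
    add_sub_assoc, ← h3.tsum_sub h4]
  have : ∀ n : ℕ, ((p.eval ((n + 1 : ℕ) : ℝ) : ℝ) : ℂ) * z ^ (n + 1) - z * (((p.eval (n : ℝ) : ℝ) : ℂ) * z ^ n) =
      (((backwardDiff p).eval ((n + 1 : ℕ) : ℝ) : ℝ) : ℂ) * z ^ (n + 1) := by
    intro n
    rw [backwardDiff_eval]
    push_cast
    rw [add_sub_cancel_right]
    ring
  simp_rw [this]
  simp [backwardDiff_eval]
  ring

/-- The expansion at infinity obeys the same recursion with the same constant as the one at `0`.
Hence both are expansions of one rational function, with no appeal to analytic continuation. -/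
theorem one_sub_mul_tsum_eval_neg (p : ℝ[X]) {z : ℂ} (hz : 1 < ‖z‖) :
    (1 - z) * ∑' n : ℕ, -((p.eval (-(n : ℝ) - 1) : ℝ) : ℂ) * z⁻¹ ^ (n + 1) =
      ∑' n : ℕ, -(((backwardDiff p).eval (-(n : ℝ) - 1) : ℝ) : ℂ) * z⁻¹ ^ (n + 1) + p.eval (-1) := by
  have hz0 : z ≠ 0 := by rintro rfl; simp at hz; linarith
  have hz' : ‖z⁻¹‖ < 1 := by rw [norm_inv]; exact inv_lt_one_of_one_lt₀ hz
  have key (r : ℝ[X]) : Summable fun n : ℕ => -((r.eval (-(n : ℝ) - 1) : ℝ) : ℂ) * z⁻¹ ^ (n + 1) := by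
    refine ((summable_eval_neg_mul_pow r hz').mul_left (-z⁻¹)).congr fun n => ?_
    ring
  have h0 := (summable_eval_neg_mul_pow p hz')
  have h1 := (summable_nat_add_iff 1).2 h0
  have h4 : z * ∑' n : ℕ, -((p.eval (-(n : ℝ) - 1) : ℝ) : ℂ) * z⁻¹ ^ (n + 1) =
      -∑' n : ℕ, ((p.eval (-(n : ℝ) - 1) : ℝ) : ℂ) * z⁻¹ ^ n := by
    rw [← tsum_mul_left, ← tsum_neg]
    congr 1 with n
    rw [pow_succ]
    linear_combination (-(((p.eval (-(n : ℝ) - 1) : ℝ) : ℂ)) * z⁻¹ ^ n) * mul_inv_cancel₀ hz0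
  rw [sub_mul, one_mul, h4, h0.tsum_eq_zero_add, sub_neg_eq_add, add_comm, add_assoc,
    ← h1.tsum_add (key p)]
  have : ∀ n : ℕ, ((p.eval (-((n + 1 : ℕ) : ℝ) - 1) : ℝ) : ℂ) * z⁻¹ ^ (n + 1) +
      -((p.eval (-(n : ℝ) - 1) : ℝ) : ℂ) * z⁻¹ ^ (n + 1) =
      -(((backwardDiff p).eval (-(n : ℝ) - 1) : ℝ) : ℂ) * z⁻¹ ^ (n + 1) := by
    intro n
    rw [backwardDiff_eval]
    push_cast
    rw [show (-(n : ℝ) - 1 - 1) = (-((n : ℝ) + 1) - 1) by ring]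
    ring
  simp_rw [this]
  simp
  ring

theorem one_sub_mul_mk_eval (p : ℝ[X]) :
    (1 - PowerSeries.X) * PowerSeries.mk (fun n : ℕ => p.eval (n : ℝ)) =
      PowerSeries.mk (fun n : ℕ => (backwardDiff p).eval (n : ℝ)) + PowerSeries.C (p.eval (-1)) := by
  ext n
  rw [sub_mul, one_mul]
  cases n with
  | zero => simp [backwardDiff_eval]
  | succ n =>
    simp [backwardDiff_eval, PowerSeries.coeff_succ_X_mul]

/-- The polynomial `(1 - X)^(m+1) ∑ p(n) Xⁿ`, for `deg p ≤ m`. -/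
theorem exists_numerator (m : ℕ) : ∀ p : ℝ[X], p.natDegree ≤ m → ∃ N : ℝ[X],
    N.natDegree ≤ m ∧ N.coeff m = (-1) ^ m * p.eval (-1) ∧
    N.eval 1 = m.factorial * p.coeff m ∧
    (1 - PowerSeries.X) ^ (m + 1) * PowerSeries.mk (fun n : ℕ => p.eval (n : ℝ)) = (N : PowerSeries ℝ) ∧
    (∀ z : ℂ, ‖z‖ < 1 → (1 - z) ^ (m + 1) * ∑' n : ℕ, ((p.eval (n : ℝ) : ℝ) : ℂ) * z ^ n =
      Polynomial.aeval z N) ∧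
    (∀ z : ℂ, 1 < ‖z‖ →
      (1 - z) ^ (m + 1) * ∑' n : ℕ, -((p.eval (-(n : ℝ) - 1) : ℝ) : ℂ) * z⁻¹ ^ (n + 1) =
        Polynomial.aeval z N) := by
  induction m with
  | zero =>
    intro p hp
    obtain ⟨a, rfl⟩ := Polynomial.natDegree_eq_zero.1 (Nat.le_zero.1 hp)
    have hd : backwardDiff (Polynomial.C a) = 0 := by simp [backwardDiff]
    refine ⟨Polynomial.C a, by simp, by simp, by simp, ?_, fun z hz => ?_, fun z hz => ?_⟩
    · rw [zero_add, pow_one, one_sub_mul_mk_eval, hd]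
      ext n
      simp
    · rw [zero_add, pow_one, one_sub_mul_tsum_eval _ hz, hd]
      simp
    · rw [zero_add, pow_one, one_sub_mul_tsum_eval_neg _ hz, hd]
      simp
  | succ m ih =>
    intro p hp
    obtain ⟨N, h1, h2, h3, h4, h5, h6⟩ := ih _ (backwardDiff_natDegree_le p hp)
    have hdeg : ((1 - Polynomial.X : ℝ[X]) ^ (m + 1)).natDegree ≤ m + 1 := by
      refine (Polynomial.natDegree_pow_le_of_le (m := 1) _ ?_).trans (by simp)
      refine (Polynomial.natDegree_sub_le _ _).trans (by simp)
    -- One factor `1 - X` replaces `p` by its backward difference plus `p(-1)`; the remaining power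
    -- `m + 1` turns these into `N` and the second summand. The degree of `N` is too small to affect
    -- the top coefficient.
    refine ⟨N + Polynomial.C (p.eval (-1)) * (1 - Polynomial.X) ^ (m + 1), ?_, ?_, ?_, ?_, ?_, ?_⟩
    · refine Polynomial.natDegree_add_le_of_degree_le (by omega) ?_
      exact (Polynomial.natDegree_C_mul_le _ _).trans hdeg
    · rw [Polynomial.coeff_add, Polynomial.coeff_eq_zero_of_natDegree_lt (by omega),
        Polynomial.coeff_C_mul]
      have : ((1 - Polynomial.X : ℝ[X]) ^ (m + 1)).coeff (m + 1) = (-1) ^ (m + 1) := by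
        have := Polynomial.coeff_pow_of_natDegree_le (p := (1 - Polynomial.X : ℝ[X])) (n := 1)
          (m := m + 1) ((Polynomial.natDegree_sub_le _ _).trans (by simp))
        rw [mul_one] at this
        rw [this]
        simp [Polynomial.coeff_one]
      rw [this]
      ring
    · rw [Polynomial.eval_add, h3, backwardDiff_coeff p hp le_rfl, Nat.factorial_succ]
      simp
      ring
    · rw [pow_succ, mul_assoc, one_sub_mul_mk_eval, mul_add, h4]
      simp
      ring
    · intro z hz
      rw [pow_succ, mul_assoc, one_sub_mul_tsum_eval _ hz, mul_add, h5 z hz]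
      simp
      ring
    · intro z hz
      rw [pow_succ, mul_assoc, one_sub_mul_tsum_eval_neg _ hz, mul_add, h6 z hz]
      simp
      ring

theorem numeratorPoly_spec (p : ℝ[X]) :
    (numeratorPoly p).natDegree ≤ p.natDegree ∧
    (numeratorPoly p).coeff p.natDegree = (-1) ^ p.natDegree * p.eval (-1) ∧
    (numeratorPoly p).eval 1 = p.natDegree.factorial * p.leadingCoeff ∧
    (∀ z : ℂ, ‖z‖ < 1 → (1 - z) ^ (p.natDegree + 1) * ∑' n : ℕ, ((p.eval (n : ℝ) : ℝ) : ℂ) * z ^ n =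
      numeratorEval p z) ∧
    (∀ z : ℂ, 1 < ‖z‖ → (1 - z) ^ (p.natDegree + 1) *
      ∑' n : ℕ, -((p.eval (-(n : ℝ) - 1) : ℝ) : ℂ) * z⁻¹ ^ (n + 1) = numeratorEval p z) := by
  obtain ⟨N, h1, h2, h3, h4, h5, h6⟩ := exists_numerator p.natDegree p le_rfl
  have : numeratorPoly p = N := by
    rw [numeratorPoly, h4, PowerSeries.trunc_coe_eq_self (by omega)]
  unfold numeratorEval
  rw [this]
  exact ⟨h1, h2, h3, h5, h6⟩

theorem numeratorPoly_natDegree_eq_iff {p : ℝ[X]} (hp : p ≠ 0) :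
    (numeratorPoly p).natDegree = p.natDegree ↔ p.eval (-1) ≠ 0 := by
  obtain ⟨h1, h2, h3, -, -⟩ := numeratorPoly_spec p
  have h4 : (numeratorPoly p).coeff p.natDegree ≠ 0 ↔ p.eval (-1) ≠ 0 := by
    rw [h2]; simp
  rw [← h4]
  constructor
  · intro h
    -- As `natDegree 0 = 0`, equality of degrees alone would allow a zero numerator when `p` is
    -- constant. The value at `1` excludes it.
    rw [← h, Polynomial.coeff_natDegree, Polynomial.leadingCoeff_ne_zero]
    intro h0
    rw [h0] at h3
    simp [Nat.factorial_ne_zero, hp] at h3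
  · intro h
    exact le_antisymm h1 (Polynomial.le_natDegree_of_ne_zero h)

theorem numeratorPoly_eval_one_ne_zero {p : ℝ[X]} (hp : p ≠ 0) : (numeratorPoly p).eval 1 ≠ 0 := by
  rw [(numeratorPoly_spec p).2.2.1]
  simp [Nat.factorial_ne_zero, hp]

theorem numeratorEval_one_ne_zero {p : ℝ[X]} (hp : p ≠ 0) : numeratorEval p 1 ≠ 0 := by
  have h : numeratorEval p 1 = ((numeratorPoly p).eval 1 : ℝ) := by
    rw [numeratorEval, ← Complex.ofReal_one, ← Complex.coe_algebraMap,
      Polynomial.aeval_algebraMap_apply]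
    simp
  rw [h, Complex.ofReal_ne_zero]
  exact numeratorPoly_eval_one_ne_zero hp

theorem numeratorEval_div {p : ℝ[X]} {z : ℂ} (hz : ‖z‖ < 1) :
    HasSum (fun n : ℕ => ((p.eval (n : ℝ) : ℝ) : ℂ) * z ^ n)
      (numeratorEval p z / (1 - z) ^ (p.natDegree + 1)) := by
  have hz1 : (1 - z) ≠ 0 := by
    intro h
    rw [sub_eq_zero] at h
    simp [← h] at hz
  rw [← (numeratorPoly_spec p).2.2.2.1 z hz, mul_div_cancel_left₀ _ (pow_ne_zero _ hz1)]
  exact (summable_eval_mul_pow p hz).hasSum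

theorem numeratorEval_div_of_one_lt {p : ℝ[X]} {z : ℂ} (hz : 1 < ‖z‖) :
    HasSum (fun n : ℕ => -((p.eval (-(n : ℝ) - 1) : ℝ) : ℂ) * z⁻¹ ^ (n + 1))
      (numeratorEval p z / (1 - z) ^ (p.natDegree + 1)) := by
  have hz1 : (1 - z) ≠ 0 := by
    intro h
    rw [sub_eq_zero] at h
    simp [← h] at hz
  have hz' : ‖z⁻¹‖ < 1 := by rw [norm_inv]; exact inv_lt_one_of_one_lt₀ hz
  rw [← (numeratorPoly_spec p).2.2.2.2 z hz, mul_div_cancel_left₀ _ (pow_ne_zero _ hz1)]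
  refine Summable.hasSum (((summable_eval_neg_mul_pow p hz').mul_left (-z⁻¹)).congr fun n => ?_)
  ring

/-! ### Residues -/

/-- `residue` is a limit over shrinking circles. In all uses the circle integrals are constant for
small radii, so no genuine limit has to be taken. -/
theorem residue_eq_of_eventually {f : ℂ → ℂ} {c a : ℂ}
    (h : ∀ᶠ r in 𝓝[>] (0 : ℝ), (2 * Real.pi * Complex.I)⁻¹ * (∮ z in C(c, r), f z) = a) :
    residue f c = a :=
  (tendsto_const_nhds.congr' (h.mono fun _ hr => hr.symm)).limUnder_eq

theorem eventually_sphere_of_eventually_nhdsNE {P : ℂ → Prop} {c : ℂ} (h : ∀ᶠ z in 𝓝[≠] c, P z) :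
    ∀ᶠ r in 𝓝[>] (0 : ℝ), 0 < r ∧ ∀ z ∈ Metric.closedBall c r, z ≠ c → P z := by
  rw [eventually_nhdsWithin_iff, Metric.eventually_nhds_iff_ball] at h
  obtain ⟨ε, hε, h⟩ := h
  filter_upwards [Ioo_mem_nhdsGT hε] with r hr
  exact ⟨hr.1, fun z hz hzc => h z (Metric.closedBall_subset_ball hr.2 hz) hzc⟩

theorem ne_center_of_mem_sphere {c z : ℂ} {r : ℝ} (hr : 0 < r) (hz : z ∈ Metric.sphere c r) :
    z ≠ c := Metric.ne_of_mem_sphere hz hr.ne'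

theorem residue_congr {f g : ℂ → ℂ} {c : ℂ} (h : f =ᶠ[𝓝[≠] c] g) : residue f c = residue g c := by
  unfold residue limUnder
  congr 1
  refine Filter.map_congr ?_
  filter_upwards [eventually_sphere_of_eventually_nhdsNE h] with r hr
  rw [circleIntegral.integral_congr hr.1.le fun z hz =>
    hr.2 z (Metric.sphere_subset_closedBall hz) (ne_center_of_mem_sphere hr.1 hz)]

theorem circleIntegral_eq_of_punctured {f : ℂ → ℂ} {c : ℂ} {r ρ : ℝ} (hr : 0 < r) (hrρ : r ≤ ρ)
    (hd : ∀ z ∈ Metric.closedBall c ρ, z ≠ c → DifferentiableAt ℂ f z) :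
    (∮ z in C(c, r), f z) = ∮ z in C(c, ρ), f z := by
  refine (Complex.circleIntegral_eq_of_differentiable_on_annulus_off_countable hr hrρ
    countable_empty (fun z hz => ?_) fun z hz => ?_).symm
  · refine (hd z hz.1 ?_).continuousAt.continuousWithinAt
    rintro rfl
    exact hz.2 (Metric.mem_ball_self hr)
  · refine hd z (Metric.ball_subset_closedBall hz.1.1) ?_
    rintro rfl
    exact hz.1.2 (Metric.mem_closedBall_self hr.le)

theorem residue_eq_circleIntegral {f : ℂ → ℂ} {c : ℂ} {ρ : ℝ} (hρ : 0 < ρ)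
    (hd : ∀ z ∈ Metric.closedBall c ρ, z ≠ c → DifferentiableAt ℂ f z) :
    residue f c = (2 * Real.pi * Complex.I)⁻¹ * ∮ z in C(c, ρ), f z := by
  refine residue_eq_of_eventually ?_
  filter_upwards [Ioo_mem_nhdsGT hρ] with r hr
  rw [circleIntegral_eq_of_punctured hr.1 hr.2.le hd]

theorem circleIntegrable_of_punctured {f : ℂ → ℂ} {c : ℂ} {r : ℝ} (hr : 0 < r)
    (hd : ∀ z ∈ Metric.closedBall c r, z ≠ c → DifferentiableAt ℂ f z) : CircleIntegrable f c r :=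
  ContinuousOn.circleIntegrable hr.le fun z hz => (hd z (Metric.sphere_subset_closedBall hz)
    (ne_center_of_mem_sphere hr hz)).continuousAt.continuousWithinAt

theorem eventually_differentiableAt {f : ℂ → ℂ} {c : ℂ} (hf : MeromorphicAt f c) :
    ∀ᶠ z in 𝓝[≠] c, DifferentiableAt ℂ f z :=
  hf.eventually_analyticAt.mono fun _ h => h.differentiableAt

theorem residue_add {f g : ℂ → ℂ} {c : ℂ} (hf : MeromorphicAt f c) (hg : MeromorphicAt g c) :
    residue (fun z => f z + g z) c = residue f c + residue g c := by
  obtain ⟨r, ⟨hr, hf⟩, -, hg⟩ :=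
    ((eventually_sphere_of_eventually_nhdsNE (eventually_differentiableAt hf)).and
    (eventually_sphere_of_eventually_nhdsNE (eventually_differentiableAt hg))).exists
  rw [residue_eq_circleIntegral hr hf, residue_eq_circleIntegral hr hg,
    residue_eq_circleIntegral (f := fun z => f z + g z) hr
      fun z hz hzc => (hf z hz hzc).add (hg z hz hzc),
    circleIntegral.integral_add (circleIntegrable_of_punctured hr hf)
      (circleIntegrable_of_punctured hr hg), mul_add]

theorem residue_const_mul {f : ℂ → ℂ} {c : ℂ} (hf : MeromorphicAt f c) (a : ℂ) :
    residue (fun z => a * f z) c = a * residue f c := by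
  obtain ⟨r, hr, hf⟩ :=
    (eventually_sphere_of_eventually_nhdsNE (eventually_differentiableAt hf)).exists
  rw [residue_eq_circleIntegral hr hf,
    residue_eq_circleIntegral hr fun z hz hzc => (hf z hz hzc).const_mul a,
    circleIntegral.integral_const_mul, mul_left_comm]

theorem residue_sum {ι : Type*} (s : Finset ι) {f : ι → ℂ → ℂ} {c : ℂ}
    (hf : ∀ i, MeromorphicAt (f i) c) :
    residue (fun z => ∑ i ∈ s, f i z) c = ∑ i ∈ s, residue (f i) c := by
  classical
  induction s using Finset.induction_on with
  | empty =>
    exact residue_eq_of_eventually (.of_forall fun r => by simp [circleIntegral])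
  | insert i s hi ih =>
    simp_rw [Finset.sum_insert hi]
    rw [residue_add (hf i) (MeromorphicAt.fun_sum fun i _ => hf i), ih]

theorem residue_eq_zero_of_analyticAt {f : ℂ → ℂ} {c : ℂ} (hf : AnalyticAt ℂ f c) :
    residue f c = 0 := by
  refine residue_eq_of_eventually ?_
  have h := hf.eventually_analyticAt
  rw [Metric.eventually_nhds_iff_ball] at h
  obtain ⟨ε, hε, h⟩ := h
  filter_upwards [Ioo_mem_nhdsGT hε] with r hr
  have hd : ∀ z ∈ Metric.closedBall c r, DifferentiableAt ℂ f z := fun z hz =>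
    (h z (Metric.closedBall_subset_ball hr.2 hz)).differentiableAt
  rw [Complex.circleIntegral_eq_zero_of_differentiable_on_off_countable hr.1.le countable_empty
    (fun z hz => (hd z hz).continuousAt.continuousWithinAt)
    fun z hz => hd z (Metric.ball_subset_closedBall hz.1), mul_zero]

theorem residue_eq_zero_of_order_nonneg {f : ℂ → ℂ} {c : ℂ} (hf : MeromorphicAt f c)
    (h : 0 ≤ meromorphicOrderAt f c) : residue f c = 0 := by
  obtain ⟨g, hg, hfg⟩ := hf.meromorphicOrderAt_nonneg_iff.1 h
  rw [residue_congr hfg, residue_eq_zero_of_analyticAt hg]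

theorem residue_zpow {c : ℂ} {n : ℤ} (hn : n ≠ -1) : residue (fun z => (z - c) ^ n) c = 0 :=
  residue_eq_of_eventually (.of_forall fun r => by
    rw [circleIntegral.integral_sub_zpow_of_ne hn, mul_zero])

theorem residue_inv (c : ℂ) : residue (fun z => (z - c)⁻¹) c = 1 := by
  refine residue_eq_of_eventually ?_
  filter_upwards [self_mem_nhdsWithin] with r hr
  rw [circleIntegral.integral_sub_center_inv c (ne_of_gt hr)]
  exact inv_mul_cancel₀ Complex.two_pi_I_ne_zero

/-- This splits off one polar term at a time, both for residues at simple poles and in the rectangle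
theorem. -/
theorem AnalyticAt.exists_eq_add_sub_mul {g : ℂ → ℂ} {c : ℂ} (hg : AnalyticAt ℂ g c) :
    ∃ g₁ : ℂ → ℂ, AnalyticAt ℂ g₁ c ∧ ∀ z, g z = g c + (z - c) * g₁ z := by
  obtain ⟨p, hp⟩ := hg
  refine ⟨dslope g c, ⟨_, hp.has_fpower_series_dslope_fslope⟩, fun z => ?_⟩
  have := sub_smul_dslope g c z
  rw [smul_eq_mul] at this
  rw [this]
  ring

/-- The residue at a simple pole. -/
theorem residue_of_tendsto {f : ℂ → ℂ} {c a : ℂ} (hf : MeromorphicAt f c)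
    (h : Tendsto (fun z => (z - c) * f z) (𝓝[≠] c) (𝓝 a)) : residue f c = a := by
  have hm : MeromorphicAt (fun z => (z - c) * f z) c := by fun_prop
  obtain ⟨g, hg, hfg⟩ := hm.meromorphicOrderAt_nonneg_iff.1
    ((tendsto_nhds_iff_meromorphicOrderAt_nonneg hm).1 ⟨a, h⟩)
  have hga : g c = a := tendsto_nhds_unique
    (hg.continuousAt.tendsto.mono_left nhdsWithin_le_nhds) (h.congr' hfg)
  obtain ⟨g₁, hg₁, hgg⟩ := hg.exists_eq_add_sub_mul
  have : f =ᶠ[𝓝[≠] c] fun z => a * (z - c)⁻¹ + g₁ z := by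
    filter_upwards [hfg, self_mem_nhdsWithin] with z hz hzc
    have hzc' : z - c ≠ 0 := sub_ne_zero.2 hzc
    rw [hgg, hga] at hz
    field_simp
    linear_combination hz
  rw [residue_congr this, residue_add (by fun_prop) hg₁.meromorphicAt,
    residue_const_mul (by fun_prop), residue_inv, residue_eq_zero_of_analyticAt hg₁]
  ring

/-! ### The residue theorem for a rectangle around its centre -/

/-- The integral of `f` over the boundary of the rectangle with lower left corner `z` and upper
right corner `w`. -/
noncomputable def rectIntegral (f : ℂ → ℂ) (z w : ℂ) : ℂ :=
  (∫ x : ℝ in z.re..w.re, f (x + z.im * Complex.I)) -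
    (∫ x : ℝ in z.re..w.re, f (x + w.im * Complex.I)) +
    Complex.I * (∫ y : ℝ in z.im..w.im, f (w.re + y * Complex.I)) -
    Complex.I * (∫ y : ℝ in z.im..w.im, f (z.re + y * Complex.I))

/-- The closed rectangle with corners `-w` and `w`, punctured at `0`. -/
def puncturedRect (w : ℂ) : Set ℂ := (uIcc (-w.re) w.re ×ℂ uIcc (-w.im) w.im) \ {0}

theorem puncturedRect_edges {w : ℂ} (hre : 0 < w.re) (him : 0 < w.im) :
    (∀ x ∈ uIcc (-w).re w.re, ((x : ℂ) + (-w).im * Complex.I ∈ puncturedRect w ∧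
      (x : ℂ) + w.im * Complex.I ∈ puncturedRect w)) ∧
    (∀ y ∈ uIcc (-w).im w.im, ((w.re : ℂ) + y * Complex.I ∈ puncturedRect w ∧
      ((-w).re : ℂ) + y * Complex.I ∈ puncturedRect w)) := by
  refine ⟨fun x hx => ⟨⟨?_, ?_⟩, ⟨?_, ?_⟩⟩, fun y hy => ⟨⟨?_, ?_⟩, ⟨?_, ?_⟩⟩⟩
  all_goals first
    | (simp [Complex.mem_reProdIm]; simpa using ‹_ ∈ uIcc _ _›)
    | (simp [Complex.ext_iff]; intros; linarith)

theorem rectIntegral_congr {f g : ℂ → ℂ} {w : ℂ} (hre : 0 < w.re) (him : 0 < w.im)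
    (h : EqOn f g (puncturedRect w)) : rectIntegral f (-w) w = rectIntegral g (-w) w := by
  obtain ⟨h1, h2⟩ := puncturedRect_edges hre him
  unfold rectIntegral
  rw [intervalIntegral.integral_congr fun x hx => h (h1 x hx).1,
    intervalIntegral.integral_congr fun x hx => h (h1 x hx).2,
    intervalIntegral.integral_congr fun x hx => h (h2 x hx).1,
    intervalIntegral.integral_congr fun x hx => h (h2 x hx).2]

theorem intervalIntegrable_edges {f : ℂ → ℂ} {w : ℂ} (hre : 0 < w.re) (him : 0 < w.im)
    (hf : ContinuousOn f (puncturedRect w)) :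
    IntervalIntegrable (fun x : ℝ => f (x + (-w).im * Complex.I)) volume (-w).re w.re ∧
    IntervalIntegrable (fun x : ℝ => f (x + w.im * Complex.I)) volume (-w).re w.re ∧
    IntervalIntegrable (fun y : ℝ => f (w.re + y * Complex.I)) volume (-w).im w.im ∧
    IntervalIntegrable (fun y : ℝ => f ((-w).re + y * Complex.I)) volume (-w).im w.im := by
  obtain ⟨h1, h2⟩ := puncturedRect_edges hre him
  refine ⟨?_, ?_, ?_, ?_⟩ <;> refine ContinuousOn.intervalIntegrable ?_
  · exact hf.comp (by fun_prop) fun x hx => (h1 x hx).1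
  · exact hf.comp (by fun_prop) fun x hx => (h1 x hx).2
  · exact hf.comp (by fun_prop) fun x hx => (h2 x hx).1
  · exact hf.comp (by fun_prop) fun x hx => (h2 x hx).2

theorem rectIntegral_add {f g : ℂ → ℂ} {w : ℂ} (hre : 0 < w.re) (him : 0 < w.im)
    (hf : ContinuousOn f (puncturedRect w)) (hg : ContinuousOn g (puncturedRect w)) :
    rectIntegral (fun z => f z + g z) (-w) w = rectIntegral f (-w) w + rectIntegral g (-w) w := by
  obtain ⟨f1, f2, f3, f4⟩ := intervalIntegrable_edges hre him hf
  obtain ⟨g1, g2, g3, g4⟩ := intervalIntegrable_edges hre him hg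
  unfold rectIntegral
  rw [intervalIntegral.integral_add f1 g1, intervalIntegral.integral_add f2 g2,
    intervalIntegral.integral_add f3 g3, intervalIntegral.integral_add f4 g4]
  ring

theorem rectIntegral_const_mul (f : ℂ → ℂ) (a z w : ℂ) :
    rectIntegral (fun z => a * f z) z w = a * rectIntegral f z w := by
  unfold rectIntegral
  simp_rw [intervalIntegral.integral_const_mul]
  ring

theorem rectIntegral_eq_zero_of_hasDerivAt {f F : ℂ → ℂ} {w : ℂ} (hre : 0 < w.re) (him : 0 < w.im)
    (hf : ContinuousOn f (puncturedRect w)) (hF : ∀ z ∈ puncturedRect w, HasDerivAt F (f z) z) :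
    rectIntegral f (-w) w = 0 := by
  obtain ⟨h1, h2⟩ := puncturedRect_edges hre him
  obtain ⟨f1, f2, f3, f4⟩ := intervalIntegrable_edges hre him hf
  have hx (b x : ℝ) : HasDerivAt (fun x : ℝ => (x : ℂ) + b * Complex.I) 1 x :=
    Complex.ofRealCLM.hasDerivAt.add_const _
  have hy (a y : ℝ) : HasDerivAt (fun y : ℝ => (a : ℂ) + y * Complex.I) Complex.I y := by
    simpa using (Complex.ofRealCLM.hasDerivAt.mul_const Complex.I).const_add (a : ℂ)
  unfold rectIntegral
  rw [intervalIntegral.integral_eq_sub_of_hasDerivAt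
      (f := fun x : ℝ => F (x + (-w).im * Complex.I)) (fun x hx' =>
      ((hF _ (h1 x hx').1).comp x (hx _ x)).congr_deriv (mul_one _)) f1,
    intervalIntegral.integral_eq_sub_of_hasDerivAt
      (f := fun x : ℝ => F (x + w.im * Complex.I)) (fun x hx' =>
      ((hF _ (h1 x hx').2).comp x (hx _ x)).congr_deriv (mul_one _)) f2,
    ← intervalIntegral.integral_const_mul, ← intervalIntegral.integral_const_mul,
    intervalIntegral.integral_eq_sub_of_hasDerivAt
      (f := fun y : ℝ => F (w.re + y * Complex.I)) (fun y hy' =>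
      ((hF _ (h2 y hy').1).comp y (hy _ y)).congr_deriv (mul_comm _ _)) (f3.const_mul _),
    intervalIntegral.integral_eq_sub_of_hasDerivAt
      (f := fun y : ℝ => F ((-w).re + y * Complex.I)) (fun y hy' =>
      ((hF _ (h2 y hy').2).comp y (hy _ y)).congr_deriv (mul_comm _ _)) (f4.const_mul _)]
  ring

theorem integral_two_mul_div_sq_add_sq {a : ℝ} (ha : 0 < a) (h : ℝ) :
    ∫ y in -h..h, 2 * a / (a ^ 2 + y ^ 2) = 4 * Real.arctan (h / a) := by
  have hd (y : ℝ) : HasDerivAt (fun y => 2 * Real.arctan (y / a)) (2 * a / (a ^ 2 + y ^ 2)) y := by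
    have := (((hasDerivAt_id y).div_const a).arctan).const_mul 2
    refine this.congr_deriv ?_
    simp only [id]
    field_simp
  have hc : Continuous fun y : ℝ => 2 * a / (a ^ 2 + y ^ 2) :=
    continuous_const.div (by fun_prop) fun y => by positivity
  rw [intervalIntegral.integral_eq_sub_of_hasDerivAt (fun y _ => hd y) (hc.intervalIntegrable _ _),
    neg_div, Real.arctan_neg]
  ring

/-- Opposite sides combine into integrals of `2a / (a² + y²)`, which are arctangents. The two ratios
are reciprocal, so `arctan x + arctan (1/x) = π/2` gives `2πi`. -/
theorem rectIntegral_inv {w : ℂ} (hre : 0 < w.re) (him : 0 < w.im) :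
    rectIntegral (fun z => z⁻¹) (-w) w = 2 * Real.pi * Complex.I := by
  have hne : ∀ z ∈ puncturedRect w, z ≠ 0 := fun z hz => hz.2
  obtain ⟨f1, f2, f3, f4⟩ := intervalIntegrable_edges hre him
    (continuousOn_inv₀.mono fun z hz => hz.2 : ContinuousOn (fun z : ℂ => z⁻¹) (puncturedRect w))
  have e1 : (∫ y : ℝ in (-w).im..w.im, ((w.re : ℂ) + y * Complex.I)⁻¹) -
      ∫ y : ℝ in (-w).im..w.im, (((-w).re : ℂ) + y * Complex.I)⁻¹ =
      ((4 * Real.arctan (w.im / w.re) : ℝ) : ℂ) := by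
    rw [← intervalIntegral.integral_sub f3 f4, ← integral_two_mul_div_sq_add_sq hre,
      ← intervalIntegral.integral_ofReal, Complex.neg_im]
    refine intervalIntegral.integral_congr fun y hy => ?_
    have h0 : (w.re : ℂ) ^ 2 + y ^ 2 ≠ 0 := by norm_cast; positivity
    have h1 : (w.re : ℂ) + y * Complex.I ≠ 0 := by
      intro h; have := congrArg Complex.re h; simp at this; linarith
    have h2 : ((-w).re : ℂ) + y * Complex.I ≠ 0 := by
      intro h; have := congrArg Complex.re h; simp at this; linarith
    simp only [Complex.neg_re, Complex.ofReal_neg] at h2 ⊢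
    push_cast
    rw [inv_sub_inv h1 h2, div_eq_div_iff (mul_ne_zero h1 h2) h0]
    linear_combination (-2 * (w.re : ℂ) * y ^ 2) * Complex.I_sq
  have e2 : (∫ x : ℝ in (-w).re..w.re, ((x : ℂ) + (-w).im * Complex.I)⁻¹) -
      ∫ x : ℝ in (-w).re..w.re, ((x : ℂ) + w.im * Complex.I)⁻¹ =
      ((4 * Real.arctan (w.re / w.im) : ℝ) : ℂ) * Complex.I := by
    rw [← intervalIntegral.integral_sub f1 f2, ← integral_two_mul_div_sq_add_sq him,
      ← intervalIntegral.integral_ofReal, Complex.neg_re, ← intervalIntegral.integral_mul_const]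
    refine intervalIntegral.integral_congr fun y hy => ?_
    have h0 : (w.im : ℂ) ^ 2 + y ^ 2 ≠ 0 := by norm_cast; positivity
    have h1 : (y : ℂ) + w.im * Complex.I ≠ 0 := by
      intro h; have := congrArg Complex.im h; simp at this; linarith
    have h2 : (y : ℂ) + (-w).im * Complex.I ≠ 0 := by
      intro h; have := congrArg Complex.im h; simp at this; linarith
    simp only [Complex.neg_im, Complex.ofReal_neg] at h2 ⊢
    push_cast
    rw [inv_sub_inv h2 h1, div_mul_eq_mul_div, div_eq_div_iff (mul_ne_zero h2 h1) h0]
    linear_combination (2 * (w.im : ℂ) ^ 3 * Complex.I) * Complex.I_sq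
  have e3 : Real.arctan (w.re / w.im) = Real.pi / 2 - Real.arctan (w.im / w.re) := by
    rw [← Real.arctan_inv_of_pos (by positivity), inv_div]
  unfold rectIntegral
  rw [e2, add_sub_assoc, ← mul_sub, e1, e3]
  push_cast
  ring

theorem rectIntegral_zpow {w : ℂ} (hre : 0 < w.re) (him : 0 < w.im) {n : ℤ} (hn : n ≠ -1) :
    rectIntegral (fun z => z ^ n) (-w) w = 0 := by
  have hn' : (n : ℂ) + 1 ≠ 0 := by
    intro h; apply hn; have : ((n + 1 : ℤ) : ℂ) = 0 := by push_cast; exact h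
    have := Int.cast_eq_zero.1 this; omega
  refine rectIntegral_eq_zero_of_hasDerivAt (F := fun z => z ^ (n + 1) / (n + 1)) hre him
    (fun z hz => ?_) fun z hz => ?_
  · exact (continuousAt_zpow₀ z n (.inl hz.2)).continuousWithinAt
  · have := (hasDerivAt_zpow (n + 1) z (.inl hz.2)).div_const ((n : ℂ) + 1)
    rw [add_sub_cancel_right] at this
    push_cast at this
    rwa [mul_div_cancel_left₀ _ hn'] at this

/-- Induction on a bound for the order of the pole. Subtracting `g(0) z^(-(n+1))` lowers the bound
by one. This power has a primitive, hence neither integral nor residue, unless its exponent is `-1`.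
At order zero the singularity is removable and Cauchy's theorem for rectangles applies. -/
theorem rectIntegral_eq_residue_aux {w : ℂ} (hre : 0 < w.re) (him : 0 < w.im) (n : ℕ) :
    ∀ f : ℂ → ℂ, (∀ z ∈ puncturedRect w, DifferentiableAt ℂ f z) →
    (∃ g, AnalyticAt ℂ g 0 ∧ ∀ᶠ z in 𝓝[≠] (0 : ℂ), z ^ n * f z = g z) →
    rectIntegral f (-w) w = 2 * Real.pi * Complex.I * residue f 0 := by
  induction n with
  | zero =>
    rintro f hf ⟨g, hg, hfg⟩
    simp only [pow_zero, one_mul] at hfg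
    rw [residue_congr hfg, residue_eq_zero_of_analyticAt hg, mul_zero]
    classical
    rw [rectIntegral_congr (g := Function.update f 0 (g 0)) hre him fun z hz =>
      (Function.update_of_ne hz.2 _ _).symm]
    refine Complex.integral_boundary_rect_eq_zero_of_differentiableOn _ _ _ fun z hz => ?_
    refine DifferentiableAt.differentiableWithinAt ?_
    by_cases h0 : z = 0
    · subst h0
      refine hg.differentiableAt.congr_of_eventuallyEq ?_
      rw [eventually_nhdsWithin_iff] at hfg
      filter_upwards [hfg] with z hz
      by_cases h0 : z = 0
      · subst h0; simp
      · rw [Function.update_of_ne h0, hz h0]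
    · refine (hf z ⟨by simpa using hz, h0⟩).congr_of_eventuallyEq ?_
      filter_upwards [isOpen_ne.mem_nhds h0] with y hy
      rw [Function.update_of_ne hy]
  | succ n ih =>
    rintro f hf ⟨g, hg, hfg⟩
    obtain ⟨g₁, hg₁, hgg⟩ := hg.exists_eq_add_sub_mul
    set e : ℤ := -(n + 1 : ℕ) with he
    have hz1 : ∀ z : ℂ, z ≠ 0 → DifferentiableAt ℂ (fun z : ℂ => z ^ e) z := fun z hz =>
      differentiableAt_zpow.2 (.inl hz)
    have key : rectIntegral (fun z => z ^ e) (-w) w =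
        2 * Real.pi * Complex.I * residue (fun z => z ^ e) 0 := by
      by_cases hn : n = 0
      · have : e = -1 := by simp [he, hn]
        have h1 := residue_inv 0
        simp only [sub_zero] at h1
        simp only [this, zpow_neg_one]
        rw [h1, rectIntegral_inv hre him, mul_one]
      · have : e ≠ -1 := by omega
        have h1 := residue_zpow (c := 0) this
        simp only [sub_zero] at h1
        rw [h1, rectIntegral_zpow hre him this, mul_zero]
    have hd : ∀ z ∈ puncturedRect w, DifferentiableAt ℂ (fun z => f z - g 0 * z ^ e) z :=
      fun z hz => (hf z hz).sub ((hz1 z hz.2).const_mul _)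
    have hev : ∀ᶠ z in 𝓝[≠] (0 : ℂ), z ^ n * (f z - g 0 * z ^ e) = g₁ z := by
      filter_upwards [hfg, self_mem_nhdsWithin] with z hz hz0
      have hz0' : z ≠ 0 := hz0
      rw [hgg, sub_zero] at hz
      have hz' : z ^ (n + 1) * z ^ e = 1 := by
        rw [he, zpow_neg, zpow_natCast, mul_inv_cancel₀ (pow_ne_zero _ hz0')]
      apply mul_left_cancel₀ hz0'
      linear_combination hz - g 0 * hz'
    have h1 := ih _ hd ⟨g₁, hg₁, hev⟩
    have hfe : f = fun z => (f z - g 0 * z ^ e) + g 0 * z ^ e := by ext z; ring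
    have hm : MeromorphicAt f 0 := by
      refine MeromorphicAt.congr (f := fun z => (z ^ (n + 1))⁻¹ * g z) (by fun_prop) ?_
      filter_upwards [hfg, self_mem_nhdsWithin] with z hz hz0
      rw [← hz, inv_mul_cancel_left₀ (pow_ne_zero _ hz0)]
    have hm' : MeromorphicAt (fun z => f z - g 0 * z ^ e) 0 := by fun_prop
    rw [hfe, rectIntegral_add hre him (fun z hz => (hd z hz).continuousAt.continuousWithinAt)
      (fun z hz => ((hz1 z hz.2).const_mul _).continuousAt.continuousWithinAt), h1,
      rectIntegral_const_mul, key, residue_add hm' (by fun_prop), residue_const_mul (by fun_prop)]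
    ring

theorem rectIntegral_eq_residue {w : ℂ} (hre : 0 < w.re) (him : 0 < w.im) {f : ℂ → ℂ}
    (hf : ∀ z ∈ puncturedRect w, DifferentiableAt ℂ f z) (hm : MeromorphicAt f 0) :
    rectIntegral f (-w) w = 2 * Real.pi * Complex.I * residue f 0 := by
  obtain ⟨n, hn⟩ := hm
  simp only [sub_zero, smul_eq_mul] at hn
  exact rectIntegral_eq_residue_aux hre him n f hf ⟨_, hn, .of_forall fun z => rfl⟩

theorem residue_comp_add (f : ℂ → ℂ) (c : ℂ) : residue (fun z => f (z + c)) 0 = residue f c := by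
  unfold residue
  congr 1
  ext r
  simp [circleIntegral, circleMap, add_comm]

/-! ### Decay of the Gamma function in vertical strips -/

theorem norm_Gamma_le_Gamma_re {s : ℂ} (hs : 0 < s.re) : ‖Complex.Gamma s‖ ≤ Real.Gamma s.re := by
  rw [Complex.Gamma_eq_integral hs, Complex.GammaIntegral, Real.Gamma_eq_integral hs]
  refine (norm_integral_le_integral_norm _).trans_eq (setIntegral_congr_fun measurableSet_Ioi ?_)
  intro x hx
  have hx' : (0 : ℝ) < x := hx
  simp only [norm_mul, Complex.norm_real, Real.norm_eq_abs, Real.abs_exp]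
  rw [Complex.norm_cpow_eq_rpow_re_of_pos hx']
  simp

/-- Each use of `Γ(s + 1) = s Γ(s)` contributes a factor of modulus at least `|Im s|`. -/
theorem norm_Gamma_mul_pow_le (N : ℕ) : ∀ s : ℂ, s.im ≠ 0 →
    ‖Complex.Gamma s‖ * |s.im| ^ N ≤ ‖Complex.Gamma (s + N)‖ := by
  induction N with
  | zero => intro s _; simp
  | succ N ih =>
    intro s hs
    have hs0 : s ≠ 0 := by rintro rfl; simp at hs
    have h1 := ih (s + 1) (by simpa using hs)
    rw [Complex.Gamma_add_one s hs0, norm_mul] at h1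
    have h2 : s + 1 + N = s + (N + 1 : ℕ) := by push_cast; ring
    rw [h2] at h1
    refine le_trans ?_ h1
    have h3 := Complex.abs_im_le_norm s
    have h4 : 0 ≤ ‖Complex.Gamma s‖ * |s.im| ^ N := by positivity
    simp only [Complex.add_im, Complex.one_im, add_zero]
    rw [pow_succ]
    nlinarith

/-- Quadratic decay already makes the vertical integrals and the residue sums converge absolutely,
so Stirling's formula is not needed. -/
theorem exists_norm_Gamma_le (a b : ℝ) : ∃ C : ℝ, 0 < C ∧ ∀ s : ℂ, a ≤ s.re → s.re ≤ b →
    1 ≤ |s.im| → ‖Complex.Gamma s‖ ≤ C / s.im ^ 2 := by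
  -- `N ≥ 2` yields the decay; `N ≥ 1 - a` moves the strip into `Re s ≥ 1`, where `Γ` is bounded by
  -- its values on the real axis.
  obtain ⟨N, hN⟩ := exists_nat_ge (max 2 (1 - a))
  have hN2 : 2 ≤ N := by exact_mod_cast (le_max_left _ _).trans hN
  have hNa : 1 - a ≤ N := (le_max_right _ _).trans hN
  have hcont : ContinuousOn Real.Gamma (Icc (a + N) (b + N)) := fun x hx =>
    (Real.differentiableAt_Gamma fun m hm => by
      have := hx.1; have : (0 : ℝ) ≤ m := m.cast_nonneg; linarith).continuousAt.continuousWithinAt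
  obtain ⟨C, hC⟩ := isCompact_Icc.exists_bound_of_continuousOn hcont
  refine ⟨max C 1, by positivity, fun s ha hb him => ?_⟩
  have him0 : 0 < |s.im| := by linarith
  have hre : 0 < (s + N).re := by simp; linarith
  have h1 := norm_Gamma_mul_pow_le N s (abs_pos.1 him0)
  have h2 := norm_Gamma_le_Gamma_re hre
  have h3 : Real.Gamma (s + N).re ≤ C :=
    (le_abs_self _).trans (hC _ ⟨by simpa using ha, by simpa using hb⟩)
  have h4 : |s.im| ^ 2 ≤ |s.im| ^ N := pow_le_pow_right₀ him hN2
  rw [le_div_iff₀ (by rw [← sq_abs]; positivity), ← sq_abs]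
  calc _ ≤ ‖Complex.Gamma s‖ * |s.im| ^ N := by gcongr
    _ ≤ max C 1 := (h1.trans (h2.trans h3)).trans (le_max_left _ _)

theorem Gamma_differentiableAt_of_im_ne_zero {s : ℂ} (hs : s.im ≠ 0) :
    DifferentiableAt ℂ Complex.Gamma s :=
  Complex.differentiableAt_Gamma s fun m hm => hs (by rw [hm]; simp)

theorem exists_norm_Gamma_le_strip {r : ℝ} (hr : 0 < r) : ∃ C : ℝ, 0 < C ∧ ∀ s : ℂ,
    |s.re| ≤ 1 / 2 → r ≤ ‖s‖ → ‖Complex.Gamma s‖ ≤ C / (1 + s.im ^ 2) := by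
  obtain ⟨C, hC, h⟩ := exists_norm_Gamma_le (-(1 / 2)) (1 / 2)
  have hK : IsCompact ((Icc (-(1 / 2)) (1 / 2) ×ℂ Icc (-1) 1) \ Metric.ball (0 : ℂ) r) :=
    (isCompact_Icc.reProdIm isCompact_Icc).diff Metric.isOpen_ball
  obtain ⟨B, hB⟩ := hK.exists_bound_of_continuousOn (f := Complex.Gamma) fun s hs => by
    refine (Complex.differentiableAt_Gamma s fun m hm => ?_).continuousAt.continuousWithinAt
    rcases m with _ | m
    · refine hs.2 ?_
      simp [hm, hr]
    · have := hs.1.1.1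
      simp [hm] at this
      have : (0 : ℝ) ≤ m := m.cast_nonneg
      linarith
  -- The factor `2` covers `1 + v² ≤ 2v²` for `|v| ≥ 1` and `1 + v² ≤ 2` for `|v| ≤ 1`.
  refine ⟨2 * max C B, by positivity, fun s hre hs => ?_⟩
  rw [le_div_iff₀ (by positivity)]
  rw [abs_le] at hre
  by_cases him : 1 ≤ |s.im|
  · have him2 : 1 ≤ s.im ^ 2 := by rw [← sq_abs]; nlinarith
    have h1 := h s hre.1 hre.2 him
    rw [le_div_iff₀ (by linarith)] at h1
    have h2 : 0 ≤ ‖Complex.Gamma s‖ := norm_nonneg _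
    have := le_max_left C B
    nlinarith
  · have him1 : |s.im| ≤ 1 := (not_le.1 him).le
    have h1 := hB s ⟨⟨⟨hre.1, hre.2⟩, abs_le.1 him1⟩, by simpa using hs⟩
    have h3 : s.im ^ 2 ≤ 1 := by rw [← sq_abs]; nlinarith [abs_nonneg s.im]
    have h2 : 0 ≤ ‖Complex.Gamma s‖ := norm_nonneg _
    have := le_max_right C B
    nlinarith

theorem integrable_of_continuous_of_norm_le {F : ℝ → ℂ} (hF : Continuous F) {C : ℝ}
    (h : ∀ v : ℝ, 1 ≤ |v| → ‖F v‖ ≤ C / v ^ 2) : Integrable F := by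
  obtain ⟨B, hB⟩ := (isCompact_Icc (a := (-1 : ℝ)) (b := 1)).exists_bound_of_continuousOn
    hF.continuousOn
  refine (integrable_inv_one_add_sq.const_mul (2 * max C B)).mono' hF.aestronglyMeasurable
    (.of_forall fun v => ?_)
  rw [← div_eq_mul_inv, le_div_iff₀ (by positivity)]
  have h2 : 0 ≤ ‖F v‖ := norm_nonneg _
  by_cases him : 1 ≤ |v|
  · have him2 : 1 ≤ v ^ 2 := by rw [← sq_abs]; nlinarith
    have h1 := h v him
    rw [le_div_iff₀ (by linarith)] at h1
    have := le_max_left C B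
    nlinarith
  · have him1 : |v| ≤ 1 := (not_le.1 him).le
    have h1 := hB v (abs_le.1 him1)
    have h3 : v ^ 2 ≤ 1 := by rw [← sq_abs]; nlinarith [abs_nonneg v]
    have := le_max_right C B
    nlinarith

theorem summable_const_div_one_add_sq (C : ℝ) : Summable fun k : ℤ => C / (1 + (k : ℝ) ^ 2) := by
  have h := (Real.summable_one_div_int_pow.2 (by norm_num : 1 < 2)).mul_left C
  have h0 : Summable fun k : ℤ => |C| * (1 / (k : ℝ) ^ 2) :=
    (Real.summable_one_div_int_pow.2 (by norm_num : 1 < 2)).mul_left |C|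
  have h1 : Summable fun k : ℤ => |C| * (1 / (k : ℝ) ^ 2) + if k = 0 then |C| else 0 :=
    h0.add (summable_of_ne_finset_zero (s := {0}) fun k hk => by simp at hk; simp [hk])
  refine Summable.of_norm_bounded h1 fun k => ?_
  rw [norm_div, Real.norm_eq_abs, Real.norm_of_nonneg (by positivity : (0 : ℝ) ≤ 1 + (k : ℝ) ^ 2)]
  by_cases hk : k = 0
  · simp [hk]
  · have : (0 : ℝ) < (k : ℝ) ^ 2 := by positivity
    rw [if_neg hk, add_zero, mul_one_div]
    gcongr
    linarith

/-! ### Shifting a vertical line across a lattice of poles -/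

/-- The lattice point `iωk`. -/
noncomputable def latticePoint (ω : ℝ) (k : ℤ) : ℂ := (ω * k : ℝ) * Complex.I

@[simp] theorem latticePoint_re (ω : ℝ) (k : ℤ) : (latticePoint ω k).re = 0 := by
  simp [latticePoint]

@[simp] theorem latticePoint_im (ω : ℝ) (k : ℤ) : (latticePoint ω k).im = ω * k := by
  simp [latticePoint]

theorem hasSum_integral_translates {F : ℝ → ℂ} (hF : Integrable F) {ω : ℝ} (hω : 0 < ω) :
    HasSum (fun k : ℤ => ∫ y in -(ω / 2)..ω / 2, F (y + ω * k)) (∫ v, F v) := by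
  have h := ((hF.comp_mul_left' hω.ne').hasSum_intervalIntegral (-(1 / 2))).mul_left (ω : ℂ)
  have e : (ω : ℂ) * ∫ x, F (ω * x) = ∫ v, F v := by
    rw [Measure.integral_comp_mul_left F ω, abs_of_pos (inv_pos.2 hω), Complex.real_smul]
    push_cast
    rw [mul_inv_cancel_left₀ (by exact_mod_cast hω.ne')]
  rw [e] at h
  refine h.congr_fun fun k => ?_
  have h1 := intervalIntegral.integral_comp_mul_left (a := (-(1 / 2) + (k : ℝ) : ℝ))
    (b := (-(1 / 2) + (k : ℝ) + 1 : ℝ)) F hω.ne'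
  rw [h1, intervalIntegral.integral_comp_add_right F, Complex.real_smul]
  push_cast
  rw [mul_inv_cancel_left₀ (by exact_mod_cast hω.ne')]
  congr 1 <;> ring

/-- The strip is tiled by rectangles of width `1` and height `ω`, each with a lattice point as
centre and no other singularity. Summed over all cells, the vertical sides fill the two lines and
the horizontal sides cancel between neighbours. -/
theorem integral_vertical_sub_eq_tsum_residue {f : ℂ → ℂ} {ω : ℝ} (hω : 0 < ω)
    (hm : ∀ k, MeromorphicAt f (latticePoint ω k))
    (hd : ∀ s : ℂ, |s.re| ≤ 1 / 2 → (∀ k, s ≠ latticePoint ω k) → DifferentiableAt ℂ f s)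
    (hright : Integrable fun v : ℝ => f ((1 / 2 : ℝ) + v * Complex.I))
    (hleft : Integrable fun v : ℝ => f ((-(1 / 2) : ℝ) + v * Complex.I))
    (hhor : Summable fun k : ℤ =>
      ∫ x in -(1 / 2 : ℝ)..1 / 2, f (x + (ω / 2 + ω * k : ℝ) * Complex.I))
    (hres : Summable fun k => residue f (latticePoint ω k)) :
    (∫ v : ℝ, f ((1 / 2 : ℝ) + v * Complex.I)) - ∫ v : ℝ, f ((-(1 / 2) : ℝ) + v * Complex.I) =
      2 * Real.pi * ∑' k, residue f (latticePoint ω k) := by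
  -- `h k` is the integral over the segment midway between the lattice points `k` and `k + 1`: the
  -- top side of cell `k` and the bottom side of cell `k + 1`.
  set h : ℤ → ℂ := fun k => ∫ x in -(1 / 2 : ℝ)..1 / 2, f (x + (ω / 2 + ω * k : ℝ) * Complex.I)
    with hh
  have hw : (0 : ℝ) < ω / 2 := by positivity
  have key (k : ℤ) : h (k - 1) - h k +
      Complex.I * (∫ y in -(ω / 2)..ω / 2, f ((1 / 2 : ℝ) + (y + ω * k : ℝ) * Complex.I)) -
      Complex.I * (∫ y in -(ω / 2)..ω / 2, f ((-(1 / 2) : ℝ) + (y + ω * k : ℝ) * Complex.I)) =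
      2 * Real.pi * Complex.I * residue f (latticePoint ω k) := by
    rw [← residue_comp_add, ← rectIntegral_eq_residue (w := ⟨1 / 2, ω / 2⟩) (by norm_num) hw]
    · unfold rectIntegral
      simp only [hh, Complex.neg_re, Complex.neg_im]
      congr 1
      · congr 1
        · congr 1
          · refine intervalIntegral.integral_congr fun x _ => ?_
            simp only [latticePoint]
            congr 1
            push_cast
            ring
          · refine intervalIntegral.integral_congr fun x _ => ?_
            simp only [latticePoint]
            congr 1
            push_cast
            ring
        · congr 1
          refine intervalIntegral.integral_congr fun x _ => ?_
          simp only [latticePoint]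
          congr 1
          push_cast
          ring
      · congr 1
        refine intervalIntegral.integral_congr fun x _ => ?_
        simp only [latticePoint]
        congr 1
        push_cast
        ring
    · intro z hz
      refine DifferentiableAt.comp z (hd _ ?_ fun j hj => ?_) (by fun_prop)
      · have := hz.1.1
        rw [mem_preimage, uIcc_of_le (by norm_num)] at this
        rw [abs_le]
        simpa using this
      · have h1 := hz.1.2
        rw [mem_preimage, uIcc_of_le (by simp; linarith)] at h1
        have h2 : z.im = ω * (j - k) := by
          have := congrArg Complex.im hj
          simp at this
          linarith
        have h3 : z.re = 0 := by simpa using congrArg Complex.re hj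
        have h4 : j = k := by
          rw [h2] at h1
          have l1 : (-1 : ℝ) < j - k := by
            by_contra hc
            push Not at hc
            have := h1.1
            nlinarith
          have l2 : (j - k : ℝ) < 1 := by
            by_contra hc
            push Not at hc
            have := h1.2
            nlinarith
          have l1' : (-1 : ℤ) < j - k := by exact_mod_cast l1
          have l2' : (j - k : ℤ) < 1 := by exact_mod_cast l2
          omega
        apply hz.2
        rw [mem_singleton_iff, Complex.ext_iff, h2, h3, h4]
        simp
    · have := hm k
      refine MeromorphicAt.comp_analyticAt (f := f) (g := fun z => z + latticePoint ω k) ?_ (by fun_prop)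
      simpa using this
  have s1 := (hasSum_integral_translates hright hω).mul_left Complex.I
  have s2 := (hasSum_integral_translates hleft hω).mul_left Complex.I
  have s3 := hhor.hasSum
  -- A shift of the index does not change the sum over `ℤ`, so the horizontal contributions `h (k -
  -- 1) - h k` sum to zero.
  have s4 : HasSum (fun k : ℤ => h (k - 1)) (∑' k, h k) := (Equiv.subRight (1 : ℤ)).hasSum_iff.2 s3
  have s5 := ((s4.sub s3).add s1).sub s2
  have s6 := (hres.hasSum.mul_left (2 * Real.pi * Complex.I)).unique
    (s5.congr_fun fun k => (key k).symm)
  apply mul_left_cancel₀ Complex.I_ne_zero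
  linear_combination -s6

/-! ### Vertical integrals of `Γ(s) B(s)` with bounded `B` -/

/-- A radius for which the discs around the lattice points `iωk` are disjoint and stay in the strip
`|Re s| ≤ 1/2`. -/
noncomputable def cellRadius (ω : ℝ) : ℝ := min (1 / 2) (ω / 2)

theorem cellRadius_pos {ω : ℝ} (hω : 0 < ω) : 0 < cellRadius ω := by
  unfold cellRadius; positivity

theorem cellRadius_le_half (ω : ℝ) : cellRadius ω ≤ 1 / 2 := min_le_left _ _

theorem cellRadius_le (ω : ℝ) : cellRadius ω ≤ ω / 2 := min_le_right _ _

theorem latticePoint_sub (ω : ℝ) (j k : ℤ) :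
    latticePoint ω j - latticePoint ω k = latticePoint ω (j - k) := by
  simp [latticePoint]; ring

theorem norm_latticePoint {ω : ℝ} (hω : 0 < ω) (k : ℤ) : ‖latticePoint ω k‖ = ω * |(k : ℝ)| := by
  rw [latticePoint, norm_mul, Complex.norm_I, mul_one, Complex.norm_real, Real.norm_eq_abs, abs_mul,
    abs_of_pos hω]

theorem cellRadius_le_norm_sub {ω : ℝ} (hω : 0 < ω) {s : ℂ} {k : ℤ}
    (hs : ‖s - latticePoint ω k‖ = cellRadius ω) (j : ℤ) :
    cellRadius ω ≤ ‖s - latticePoint ω j‖ := by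
  by_cases hjk : k = j
  · subst hjk; exact hs.ge
  · have h1 : ω ≤ ‖latticePoint ω k - latticePoint ω j‖ := by
      rw [latticePoint_sub, norm_latticePoint hω]
      have : (1 : ℝ) ≤ |((k - j : ℤ) : ℝ)| := by
        exact_mod_cast Int.one_le_abs (sub_ne_zero.2 hjk)
      nlinarith
    have h2 := norm_sub_le (s - latticePoint ω j) (s - latticePoint ω k)
    rw [sub_sub_sub_cancel_left, hs] at h2
    have := cellRadius_le ω
    linarith

theorem abs_re_le_of_norm_sub_latticePoint_le {ω : ℝ} {s : ℂ} {k : ℤ}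
    (hs : ‖s - latticePoint ω k‖ ≤ cellRadius ω) : |s.re| ≤ 1 / 2 := by
  have := (Complex.abs_re_le_norm _).trans (hs.trans (cellRadius_le_half ω))
  simpa using this

theorem ne_latticePoint_of_norm_sub_le {ω : ℝ} (hω : 0 < ω) {s : ℂ} {k : ℤ}
    (hs : ‖s - latticePoint ω k‖ ≤ cellRadius ω) (hne : s ≠ latticePoint ω k) (j : ℤ) :
    s ≠ latticePoint ω j := by
  rintro rfl
  have hjk : j ≠ k := fun h => hne (by rw [h])
  rw [latticePoint_sub, norm_latticePoint hω] at hs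
  have h1 : (1 : ℝ) ≤ |((j - k : ℤ) : ℝ)| := by
    exact_mod_cast Int.one_le_abs (sub_ne_zero.2 hjk)
  have := cellRadius_le ω
  nlinarith

theorem exists_norm_Gamma_le_cell {ω : ℝ} (hω : 0 < ω) : ∃ C : ℝ, 0 < C ∧ ∀ (k : ℤ) (s : ℂ),
    |s.re| ≤ 1 / 2 → cellRadius ω ≤ ‖s‖ → |s.im - ω * k| ≤ ω →
      ‖Complex.Gamma s‖ ≤ C / (1 + (k : ℝ) ^ 2) := by
  obtain ⟨C, hC, h⟩ := exists_norm_Gamma_le_strip (cellRadius_pos hω)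
  -- Since `|s.im - ωk| ≤ ω`, one has `k² ≤ 2 (s.im)² / ω² + 2`, which yields `1 + k² ≤ (3 + 2/ω²)(1
  -- + (s.im)²)`.
  refine ⟨C * (3 + 2 / ω ^ 2), by positivity, fun k s h1 h2 h3 => (h s h1 h2).trans ?_⟩
  rw [div_le_div_iff₀ (by positivity) (by positivity), mul_assoc]
  gcongr
  have h4 : (ω * k) ^ 2 ≤ 2 * s.im ^ 2 + 2 * ω ^ 2 := by
    have := sq_le_sq' (abs_le.1 h3).1 (abs_le.1 h3).2
    nlinarith [sq_nonneg (s.im + (s.im - ω * k))]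
  have h5 : (k : ℝ) ^ 2 ≤ 2 / ω ^ 2 * s.im ^ 2 + 2 := by
    rw [mul_pow] at h4
    rw [div_mul_eq_mul_div, ← sub_le_iff_le_add, le_div_iff₀ (by positivity)]
    linarith
  have : 0 ≤ 2 / ω ^ 2 := by positivity
  nlinarith [sq_nonneg s.im]

/-- Estimate on a circle of radius at most `1/2`. The constant depends on `ω` alone, so the bound
serves both the residues of the Mellin integrand and the Fourier coefficients, and is summable over
`k`. -/
theorem exists_norm_residue_le {ω : ℝ} (hω : 0 < ω) : ∃ C : ℝ, 0 < C ∧ ∀ (f : ℂ → ℂ) (M : ℝ) (k : ℤ),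
    (∀ s, ‖s - latticePoint ω k‖ ≤ cellRadius ω → s ≠ latticePoint ω k → DifferentiableAt ℂ f s) →
    (∀ s, ‖s - latticePoint ω k‖ = cellRadius ω → ‖f s‖ ≤ M * ‖Complex.Gamma s‖) → 0 ≤ M →
    ‖residue f (latticePoint ω k)‖ ≤ M * (C / (1 + (k : ℝ) ^ 2)) := by
  obtain ⟨C, hC, h⟩ := exists_norm_Gamma_le_cell hω
  refine ⟨C, hC, fun f M k hd hf hM => ?_⟩
  have hr := cellRadius_pos hω
  rw [residue_eq_circleIntegral hr fun s hs => hd s (by simpa [dist_eq_norm] using hs), ← smul_eq_mul]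
  have h1 := circleIntegral.norm_two_pi_i_inv_smul_integral_le_of_norm_le_const hr.le
    (f := f) (c := latticePoint ω k) (C := M * (C / (1 + (k : ℝ) ^ 2))) fun s hs => by
      have hs' : ‖s - latticePoint ω k‖ = cellRadius ω := by simpa [dist_eq_norm] using hs
      refine (hf s hs').trans ?_
      gcongr
      refine h k s (abs_re_le_of_norm_sub_latticePoint_le hs'.le) ?_ ?_
      · simpa [latticePoint] using cellRadius_le_norm_sub hω hs' 0
      · have := (Complex.abs_im_le_norm _).trans (hs'.le.trans (cellRadius_le ω))
        simp only [Complex.sub_im, latticePoint_im] at this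
        linarith
  refine h1.trans (mul_le_of_le_one_left (by positivity) ?_)
  have := cellRadius_le_half ω
  linarith

theorem Gamma_vertical_ne {σ : ℝ} (hσ : ∀ m : ℕ, σ ≠ -m) (v : ℝ) (m : ℕ) :
    (σ : ℂ) + v * Complex.I ≠ -m := by
  intro h
  apply hσ m
  simpa using congrArg Complex.re h

theorem integrable_Gamma_mul_vertical {B : ℂ → ℂ} {M σ : ℝ} (hσ : ∀ m : ℕ, σ ≠ -m)
    (hd : ∀ v : ℝ, DifferentiableAt ℂ B (σ + v * Complex.I))
    (hM : ∀ v : ℝ, ‖B (σ + v * Complex.I)‖ ≤ M) :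
    Integrable fun v : ℝ => Complex.Gamma (σ + v * Complex.I) * B (σ + v * Complex.I) := by
  obtain ⟨C, hC, h⟩ := exists_norm_Gamma_le σ σ
  refine integrable_of_continuous_of_norm_le (C := C * M) ?_ fun v hv => ?_
  · refine continuous_iff_continuousAt.2 fun v => ?_
    exact ContinuousAt.comp (f := fun v : ℝ => (σ : ℂ) + v * Complex.I)
      (g := fun s => Complex.Gamma s * B s)
      ((Complex.differentiableAt_Gamma _ (Gamma_vertical_ne hσ v)).mul (hd v)).continuousAt
      (by fun_prop)
  · rw [norm_mul, mul_div_right_comm]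
    have := h (σ + v * Complex.I) (by simp) (by simp) (by simpa using hv)
    gcongr
    · simpa using this
    · exact hM v

/-- `B` is bounded away from the lattice and `Γ` decays quadratically. This makes the line
integrals, the horizontal segments and the residues absolutely convergent, as the line shift
requires. -/
theorem integral_Gamma_mul_sub_eq_tsum_residue {B : ℂ → ℂ} {ω M : ℝ} (hω : 0 < ω)
    (hm : ∀ k, MeromorphicAt B (latticePoint ω k))
    (hd : ∀ s : ℂ, |s.re| ≤ 1 / 2 → (∀ k, s ≠ latticePoint ω k) → DifferentiableAt ℂ B s)
    (hM : ∀ s : ℂ, |s.re| ≤ 1 / 2 → (∀ k, cellRadius ω ≤ ‖s - latticePoint ω k‖) → ‖B s‖ ≤ M) :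
    (Summable fun k => ‖residue (fun s => Complex.Gamma s * B s) (latticePoint ω k)‖) ∧
    (∫ v : ℝ, Complex.Gamma ((1 / 2 : ℝ) + v * Complex.I) * B ((1 / 2 : ℝ) + v * Complex.I)) -
      ∫ v : ℝ, Complex.Gamma ((-(1 / 2) : ℝ) + v * Complex.I) *
        B ((-(1 / 2) : ℝ) + v * Complex.I) =
      2 * Real.pi * ∑' k, residue (fun s => Complex.Gamma s * B s) (latticePoint ω k) := by
  have hr := cellRadius_pos hω
  have hM0 : 0 ≤ M := by
    refine (norm_nonneg (B ((1 / 2 : ℝ) : ℂ))).trans (hM _ (by simp) fun k => ?_)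
    refine le_trans (cellRadius_le_half ω) (le_trans ?_ (Complex.abs_re_le_norm _))
    simp
  have hdf : ∀ s : ℂ, |s.re| ≤ 1 / 2 → (∀ k, s ≠ latticePoint ω k) →
      DifferentiableAt ℂ (fun s => Complex.Gamma s * B s) s := by
    intro s hs hk
    refine (Complex.differentiableAt_Gamma s fun m hm => ?_).mul (hd s hs hk)
    rcases m with _ | m
    · apply hk 0
      simp [hm, latticePoint]
    · rw [hm, abs_le] at hs
      have h1 := hs.1
      have : (0 : ℝ) ≤ m := m.cast_nonneg
      simp at h1
      linarith
  have hline (σ : ℝ) (hσ : |σ| = 1 / 2) :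
      Integrable fun v : ℝ => Complex.Gamma (σ + v * Complex.I) * B (σ + v * Complex.I) := by
    refine integrable_Gamma_mul_vertical (M := M) (fun m hm => ?_) (fun v => hd _ ?_ fun k hk => ?_)
      fun v => hM _ ?_ fun k => ?_
    · rw [hm, abs_neg, Nat.abs_cast] at hσ
      have h2 : ((2 * m : ℕ) : ℝ) = (1 : ℕ) := by push_cast; linarith
      have := Nat.cast_injective h2
      omega
    · simp [hσ]
    · have := congrArg Complex.re hk
      simp at this
      rw [this] at hσ
      norm_num at hσ
    · simp [hσ]
    · refine le_trans (cellRadius_le_half ω) (le_trans ?_ (Complex.abs_re_le_norm _))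
      simp [hσ]
  obtain ⟨C, hC, hres⟩ := exists_norm_residue_le hω
  have hsum : Summable fun k => ‖residue (fun s => Complex.Gamma s * B s) (latticePoint ω k)‖ := by
    refine Summable.of_nonneg_of_le (fun _ => norm_nonneg _) (fun k => hres _ M k
      (fun s hs hne => ?_) (fun s hs => ?_) hM0) ((summable_const_div_one_add_sq C).mul_left M)
    · exact hdf s (abs_re_le_of_norm_sub_latticePoint_le hs) (ne_latticePoint_of_norm_sub_le hω hs hne)
    · rw [norm_mul, mul_comm]
      gcongr
      exact hM s (abs_re_le_of_norm_sub_latticePoint_le hs.le) (cellRadius_le_norm_sub hω hs)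
  refine ⟨hsum, integral_vertical_sub_eq_tsum_residue hω (fun k => ?_) hdf
    (hline _ (by norm_num)) (hline _ (by norm_num)) ?_ hsum.of_norm⟩
  · exact (Meromorphic.Gamma _).mul (hm k)
  · obtain ⟨C, hC, hcell⟩ := exists_norm_Gamma_le_cell hω
    refine Summable.of_norm_bounded ((summable_const_div_one_add_sq (C * M))) fun k => ?_
    have h1 := intervalIntegral.norm_integral_le_of_norm_le_const (a := -(1 / 2 : ℝ)) (b := 1 / 2)
      (f := fun x : ℝ => Complex.Gamma (x + (ω / 2 + ω * k : ℝ) * Complex.I) *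
        B (x + (ω / 2 + ω * k : ℝ) * Complex.I)) (C := C * M / (1 + (k : ℝ) ^ 2)) fun x hx => by
        have hx' : |x| ≤ 1 / 2 := by
          rw [uIoc_of_le (by norm_num)] at hx
          exact abs_le.2 ⟨hx.1.le, hx.2⟩
        have hdist (j : ℤ) :
            cellRadius ω ≤ ‖(x : ℂ) + (ω / 2 + ω * k : ℝ) * Complex.I - latticePoint ω j‖ := by
          refine le_trans (cellRadius_le ω) (le_trans ?_ (Complex.abs_im_le_norm _))
          -- The height of a cell edge differs from that of a lattice point by an odd multiple of `ω
          -- / 2`, so it is at least `ω / 2` away.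
          have e : ((x : ℂ) + (ω / 2 + ω * k : ℝ) * Complex.I - latticePoint ω j).im =
              ω / 2 * (2 * (k - j) + 1 : ℤ) := by
            simp; ring
          rw [e, abs_mul, abs_of_pos (by positivity : 0 < ω / 2)]
          have : (1 : ℝ) ≤ |((2 * (k - j) + 1 : ℤ) : ℝ)| := by
            have : (2 * (k - j) + 1 : ℤ) ≠ 0 := by omega
            exact_mod_cast Int.one_le_abs this
          nlinarith
        rw [norm_mul, mul_div_right_comm]
        gcongr
        · refine hcell k _ (by simpa using hx') (by simpa [latticePoint] using hdist 0) ?_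
          simp only [Complex.add_im, Complex.ofReal_im, Complex.mul_im, Complex.ofReal_re,
            Complex.I_im, Complex.I_re, mul_zero, mul_one, zero_add, add_zero, add_sub_cancel_right]
          rw [abs_of_pos (by positivity)]
          linarith
        · exact hM _ (by simpa using hx') hdist
    refine h1.trans_eq ?_
    norm_num

/-! ### Mellin inversion for the exponential -/

theorem norm_ofReal_cpow_neg_le {x : ℝ} (hx : 0 < x) {s : ℂ} (hs : |s.re| ≤ 1 / 2) :
    ‖(x : ℂ) ^ (-s)‖ ≤ x ^ (1 / 2 : ℝ) + x ^ (-(1 / 2) : ℝ) := by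
  rw [Complex.norm_cpow_eq_rpow_re_of_pos hx, Complex.neg_re]
  rw [abs_le] at hs
  have h1 : 0 < x ^ (1 / 2 : ℝ) := by positivity
  have h2 : 0 < x ^ (-(1 / 2) : ℝ) := by positivity
  rcases le_total 1 x with h | h
  · have := Real.rpow_le_rpow_of_exponent_le h (show -s.re ≤ 1 / 2 by linarith)
    linarith
  · have := Real.rpow_le_rpow_of_exponent_ge hx h (show -(1 / 2) ≤ -s.re by linarith)
    linarith

theorem differentiable_ofReal_cpow_neg {x : ℝ} (hx : 0 < x) :
    Differentiable ℂ fun s : ℂ => (x : ℂ) ^ (-s) := by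
  have : (x : ℂ) ≠ 0 := by exact_mod_cast hx.ne'
  intro s
  exact (differentiableAt_id.neg).const_cpow (.inl this)

theorem integral_Gamma_right {x : ℝ} (hx : 0 < x) :
    ∫ v : ℝ, Complex.Gamma ((1 / 2 : ℝ) + v * Complex.I) *
      (x : ℂ) ^ (-((1 / 2 : ℝ) + v * Complex.I) : ℂ) = 2 * Real.pi * Real.exp (-x) := by
  have hmel : ∀ s : ℂ, 0 < s.re → mellin (fun x => (Real.exp (-x) : ℂ)) s = Complex.Gamma s := by
    intro s hs
    rw [← Complex.GammaIntegral_eq_mellin, Complex.Gamma_eq_integral hs]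
  have hre (v : ℝ) : 0 < (((1 / 2 : ℝ) : ℂ) + v * Complex.I).re := by simp
  have hconv : MellinConvergent (fun x => (Real.exp (-x) : ℂ)) ((1 / 2 : ℝ) : ℂ) := by
    have := Complex.GammaIntegral_convergent (s := ((1 / 2 : ℝ) : ℂ)) (by simp)
    refine this.congr_fun (fun x _ => ?_) measurableSet_Ioi
    simp [mul_comm]
  have hint : Complex.VerticalIntegrable (mellin fun x => (Real.exp (-x) : ℂ)) (1 / 2 : ℝ) := by
    have := integrable_Gamma_mul_vertical (B := fun _ => 1) (σ := 1 / 2) (M := 1) (fun m hm => by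
      have : (0 : ℝ) ≤ m := m.cast_nonneg
      linarith) (fun v => by fun_prop) (by simp)
    refine this.congr (.of_forall fun v => ?_)
    simp only [mul_one]
    rw [hmel _ (hre v)]
  have key := mellinInv_mellin_eq (1 / 2) (fun x => (Real.exp (-x) : ℂ)) hx hconv hint (by fun_prop)
  rw [mellinInv] at key
  have hpi : (2 * Real.pi : ℂ) ≠ 0 := by simp [Real.pi_ne_zero]
  rw [← key]
  simp_rw [hmel _ (hre _)]
  rw [Complex.real_smul]
  push_cast
  rw [one_div (2 * _), mul_inv_cancel_left₀ hpi]
  simp_rw [smul_eq_mul, mul_comm]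

/-- Shifting from `Re s = 1/2` crosses only the pole of `Γ` at `0`, with residue `1`. The lattice
statement is used with spacing `1`; all its points other than `0` are regular. -/
theorem integral_Gamma_left {x : ℝ} (hx : 0 < x) :
    ∫ v : ℝ, Complex.Gamma ((-(1 / 2) : ℝ) + v * Complex.I) *
      (x : ℂ) ^ (-((-(1 / 2) : ℝ) + v * Complex.I) : ℂ) = 2 * Real.pi * (Real.exp (-x) - 1) := by
  have hd := differentiable_ofReal_cpow_neg hx
  have h := (integral_Gamma_mul_sub_eq_tsum_residue (B := fun s => (x : ℂ) ^ (-s)) one_pos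
    (fun k => (hd.analyticAt _).meromorphicAt) (fun s _ _ => hd s)
    (fun s hs _ => norm_ofReal_cpow_neg_le hx hs)).2
  rw [tsum_eq_single 0] at h
  · have hr : residue (fun s => Complex.Gamma s * (x : ℂ) ^ (-s)) (latticePoint 1 0) = 1 := by
      have h0 : latticePoint 1 0 = 0 := by simp [latticePoint]
      rw [h0]
      refine residue_of_tendsto ((Meromorphic.Gamma _).mul (hd.analyticAt _).meromorphicAt) ?_
      have h2 : Tendsto (fun s : ℂ => (x : ℂ) ^ (-s)) (𝓝[≠] 0) (𝓝 1) := by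
        have := (hd 0).continuousAt.tendsto.mono_left (nhdsWithin_le_nhds (s := {0}ᶜ))
        simpa using this
      have := Complex.tendsto_self_mul_Gamma_nhds_zero.mul h2
      rw [mul_one] at this
      refine this.congr fun s => ?_
      ring
    rw [hr, integral_Gamma_right hx] at h
    linear_combination -h
  · intro k hk
    refine residue_eq_zero_of_analyticAt ?_
    refine AnalyticAt.mul ?_ (hd.analyticAt _)
    have him : (latticePoint 1 k).im ≠ 0 := by simpa using hk
    refine (DifferentiableOn.analyticAt (s := {s : ℂ | s.im ≠ 0}) (fun s hs =>
      (Gamma_differentiableAt_of_im_ne_zero hs).differentiableWithinAt) ?_)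
    exact (isOpen_ne.preimage Complex.continuous_im).mem_nhds him

/-! ### The continued zeta function -/

/-- The imaginary period `-2π / log q` of `q^s`. -/
noncomputable def logPeriod (q : ℝ) : ℝ := -(2 * Real.pi) / Real.log q

theorem logPeriod_pos {q : ℝ} (hq0 : 0 < q) (hq1 : q < 1) : 0 < logPeriod q :=
  div_pos_of_neg_of_neg (by linarith [Real.pi_pos]) (Real.log_neg hq0 hq1)

theorem latticePole_eq (q : ℝ) (k : ℤ) : latticePole q k = latticePoint (logPeriod q) k := by
  simp only [latticePole, latticePoint, logPeriod]
  push_cast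
  ring

theorem ofReal_cpow_eq_exp {x : ℝ} (hx : 0 < x) (s : ℂ) :
    (x : ℂ) ^ s = Complex.exp (Real.log x * s) := by
  rw [Complex.cpow_def_of_ne_zero (by exact_mod_cast hx.ne'), Complex.ofReal_log hx.le]

theorem norm_ofReal_cpow {x : ℝ} (hx : 0 < x) (s : ℂ) : ‖(x : ℂ) ^ s‖ = x ^ s.re :=
  Complex.norm_cpow_eq_rpow_re_of_pos hx s

theorem cpow_latticePole {q : ℝ} (hq0 : 0 < q) (hq1 : q < 1) (k : ℤ) :
    (q : ℂ) ^ latticePole q k = 1 := by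
  have hl : (Real.log q : ℂ) ≠ 0 := by exact_mod_cast (Real.log_neg hq0 hq1).ne
  rw [ofReal_cpow_eq_exp hq0, Complex.exp_eq_one_iff]
  refine ⟨-k, ?_⟩
  rw [latticePole, mul_div_cancel₀ _ hl]
  push_cast
  ring

theorem cpow_eq_one_iff {q : ℝ} (hq0 : 0 < q) (hq1 : q < 1) {s : ℂ} :
    (q : ℂ) ^ s = 1 ↔ ∃ k, s = latticePole q k := by
  have hl : (Real.log q : ℂ) ≠ 0 := by exact_mod_cast (Real.log_neg hq0 hq1).ne
  constructor
  · rw [ofReal_cpow_eq_exp hq0, Complex.exp_eq_one_iff]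
    rintro ⟨n, hn⟩
    refine ⟨-n, ?_⟩
    rw [latticePole, eq_div_iff hl, mul_comm, hn]
    push_cast
    ring
  · rintro ⟨k, rfl⟩
    exact cpow_latticePole hq0 hq1 k

theorem cpow_sub_latticePole {q : ℝ} (hq0 : 0 < q) (hq1 : q < 1) (s : ℂ) (k : ℤ) :
    (q : ℂ) ^ (s - latticePole q k) = (q : ℂ) ^ s := by
  rw [Complex.cpow_sub _ _ (by exact_mod_cast hq0.ne'), cpow_latticePole hq0 hq1, div_one]

theorem expZeta_sub_latticePole {q : ℝ} (hq0 : 0 < q) (hq1 : q < 1) (p : ℝ[X]) (s : ℂ) (k : ℤ) :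
    expZeta q p (s - latticePole q k) = expZeta q p s := by
  simp only [expZeta, cpow_sub_latticePole hq0 hq1]

theorem differentiable_const_cpow {q : ℝ} (hq0 : 0 < q) : Differentiable ℂ fun s : ℂ => (q : ℂ) ^ s :=
  fun _ => differentiableAt_id.const_cpow (.inl (by exact_mod_cast hq0.ne'))

theorem differentiable_numeratorEval (p : ℝ[X]) : Differentiable ℂ (numeratorEval p) :=
  Polynomial.differentiable_aeval _

theorem differentiableAt_expZeta {q : ℝ} (hq0 : 0 < q) (p : ℝ[X]) {s : ℂ} (hs : (q : ℂ) ^ s ≠ 1) :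
    DifferentiableAt ℂ (expZeta q p) s := by
  have h1 := differentiable_const_cpow hq0
  refine ((differentiable_numeratorEval p).comp h1 s).div (((h1 s).const_sub 1).pow _) ?_
  exact pow_ne_zero _ (sub_ne_zero.2 hs.symm)

theorem meromorphic_expZeta {q : ℝ} (hq0 : 0 < q) (p : ℝ[X]) : Meromorphic (expZeta q p) := by
  have h1 := differentiable_const_cpow hq0
  intro s
  refine MeromorphicAt.div ?_ (MeromorphicAt.pow ?_ _)
  · exact (((differentiable_numeratorEval p).comp h1).analyticAt s).meromorphicAt
  · exact ((h1.const_sub 1).analyticAt s).meromorphicAt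

/-- The function has period `iω`, so a bound on one cell minus a disc, which is compact, holds on
the whole strip. Rounding `s.im / ω` selects the translation. -/
theorem exists_norm_expZeta_le {q : ℝ} (hq0 : 0 < q) (hq1 : q < 1) (p : ℝ[X]) :
    ∃ M : ℝ, 0 ≤ M ∧ ∀ s : ℂ, |s.re| ≤ 1 / 2 →
      (∀ k, cellRadius (logPeriod q) ≤ ‖s - latticePole q k‖) → ‖expZeta q p s‖ ≤ M := by
  set ω := logPeriod q with hω
  have hωpos : 0 < ω := logPeriod_pos hq0 hq1
  have hr := cellRadius_pos hωpos
  have hK : IsCompact ((Icc (-(1 / 2)) (1 / 2) ×ℂ Icc (-(ω / 2)) (ω / 2)) \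
      Metric.ball (0 : ℂ) (cellRadius ω)) :=
    (isCompact_Icc.reProdIm isCompact_Icc).diff Metric.isOpen_ball
  obtain ⟨M, hM⟩ := hK.exists_bound_of_continuousOn (f := expZeta q p) fun s hs => by
    refine (differentiableAt_expZeta hq0 p fun h => ?_).continuousAt.continuousWithinAt
    obtain ⟨k, rfl⟩ := (cpow_eq_one_iff hq0 hq1).1 h
    rw [latticePole_eq, ← hω] at hs
    have h1 := hs.1.2
    rw [mem_preimage, latticePoint_im, mem_Icc, ← abs_le, abs_mul, abs_of_pos hωpos] at h1
    by_cases hk : k = 0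
    · subst hk
      apply hs.2
      simpa [latticePoint] using hr
    · have : (1 : ℝ) ≤ |(k : ℝ)| := by exact_mod_cast Int.one_le_abs hk
      nlinarith
  refine ⟨max M 0, le_max_right _ _, fun s hs hk => le_trans ?_ (le_max_left _ _)⟩
  have h1 := abs_sub_round (s.im / ω)
  set k := round (s.im / ω)
  rw [← expZeta_sub_latticePole hq0 hq1 p s k]
  refine hM _ ⟨⟨?_, ?_⟩, ?_⟩
  · rw [mem_preimage, latticePole_eq]
    simpa using abs_le.1 hs
  · rw [mem_preimage, latticePole_eq, ← hω]
    rw [mem_Icc, ← abs_le]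
    have h2 : (s - latticePoint ω k).im = ω * (s.im / ω - k) := by
      simp
      field_simp
    rw [h2, abs_mul, abs_of_pos hωpos]
    nlinarith
  · simpa using hk k

/-! ### The Mellin integral on the two sides of the imaginary axis -/

theorem expZ_mul_cpow (q : ℝ) (p : ℝ[X]) (t : ℝ) :
    (fun s => expZ q p s * (t : ℂ) ^ (-s)) =
      fun s => Complex.Gamma s * (expZeta q p s * (t : ℂ) ^ (-s)) := by
  ext s
  rw [expZ, mul_assoc]

theorem expZ_residue_formula {q : ℝ} (hq0 : 0 < q) (hq1 : q < 1) (p : ℝ[X]) {t : ℝ} (ht : 0 < t) :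
    (Summable fun k => ‖residueTerm (expZ q p) t (latticePole q k)‖) ∧
    (∫ v : ℝ, Complex.Gamma ((1 / 2 : ℝ) + v * Complex.I) *
        (expZeta q p ((1 / 2 : ℝ) + v * Complex.I) *
          (t : ℂ) ^ (-((1 / 2 : ℝ) + v * Complex.I) : ℂ))) -
      ∫ v : ℝ, Complex.Gamma ((-(1 / 2) : ℝ) + v * Complex.I) *
        (expZeta q p ((-(1 / 2) : ℝ) + v * Complex.I) *
          (t : ℂ) ^ (-((-(1 / 2) : ℝ) + v * Complex.I) : ℂ)) =
      2 * Real.pi * ∑' k, residueTerm (expZ q p) t (latticePole q k) := by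
  simp only [residueTerm, expZ_mul_cpow, latticePole_eq]
  obtain ⟨M, hM0, hM⟩ := exists_norm_expZeta_le hq0 hq1 p
  have hd := differentiable_ofReal_cpow_neg ht
  simp only [latticePole_eq] at hM
  refine integral_Gamma_mul_sub_eq_tsum_residue (B := fun s => expZeta q p s * (t : ℂ) ^ (-s))
    (M := M * (t ^ (1 / 2 : ℝ) + t ^ (-(1 / 2) : ℝ)))
    (logPeriod_pos hq0 hq1) (fun k => ?_) (fun s _ hk => ?_) fun s hs hk => ?_
  · exact (meromorphic_expZeta hq0 p _).mul (hd.analyticAt _).meromorphicAt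
  · refine (differentiableAt_expZeta hq0 p fun h => ?_).mul (hd s)
    obtain ⟨k, rfl⟩ := (cpow_eq_one_iff hq0 hq1).1 h
    exact hk k (latticePole_eq q k)
  · rw [norm_mul]
    gcongr
    · exact hM s hs hk
    · exact norm_ofReal_cpow_neg_le ht hs

/-- On a vertical line `|b^(-s)|` is constant. Absolute convergence at a single point therefore
makes the sum of the integrals of the norms finite, and sum and integral may be exchanged. -/
theorem hasSum_integral_Gamma {a : ℕ → ℂ} {b : ℕ → ℝ} (hb : ∀ n, 0 < b n) {σ : ℝ}
    (hσ : ∀ m : ℕ, σ ≠ -m) {A : ℂ → ℂ}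
    (hA : ∀ v : ℝ, HasSum (fun n => a n * (b n : ℂ) ^ (-(σ + v * Complex.I)))
      (A (σ + v * Complex.I))) :
    HasSum (fun n => a n * ∫ v : ℝ, Complex.Gamma (σ + v * Complex.I) *
      (b n : ℂ) ^ (-(σ + v * Complex.I)))
      (∫ v : ℝ, Complex.Gamma (σ + v * Complex.I) * A (σ + v * Complex.I)) := by
  have hn (n : ℕ) (v : ℝ) : ‖(b n : ℂ) ^ (-(σ + v * Complex.I))‖ = b n ^ (-σ) := by
    rw [norm_ofReal_cpow (hb n)]
    simp
  have hint (n : ℕ) : Integrable fun v : ℝ => Complex.Gamma (σ + v * Complex.I) *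
      (b n : ℂ) ^ (-(σ + v * Complex.I)) :=
    integrable_Gamma_mul_vertical (B := fun s => (b n : ℂ) ^ (-s)) hσ
      (fun v => differentiable_ofReal_cpow_neg (hb n) _) fun v => (hn n v).le
  have hs : Summable fun n => ‖a n‖ * b n ^ (-σ) := by
    refine (hA 0).summable.norm.congr fun n => ?_
    rw [norm_mul, hn]
  have h := hasSum_integral_of_summable_integral_norm (fun n => (hint n).const_mul (a n)) (by
    have e (n : ℕ) : ∫ v : ℝ, ‖a n * (Complex.Gamma (σ + v * Complex.I) *
        (b n : ℂ) ^ (-(σ + v * Complex.I)))‖ =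
        ‖a n‖ * b n ^ (-σ) * ∫ v : ℝ, ‖Complex.Gamma (σ + v * Complex.I)‖ := by
      rw [← integral_const_mul]
      congr 1 with v
      rw [norm_mul, norm_mul, hn]
      ring
    simp_rw [e]
    exact hs.mul_right _)
  simp_rw [integral_const_mul] at h
  have e (v : ℝ) : ∑' n, a n * (Complex.Gamma (σ + v * Complex.I) *
      (b n : ℂ) ^ (-(σ + v * Complex.I))) =
      Complex.Gamma (σ + v * Complex.I) * A (σ + v * Complex.I) := by
    rw [← (hA v).tsum_eq, ← tsum_mul_left]
    congr 1 with n
    ring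
  simp_rw [e] at h
  exact h

theorem ofReal_mul_zpow_cpow_neg {t q : ℝ} (ht : 0 < t) (hq : 0 < q) (e : ℤ) (s : ℂ) :
    ((t * q ^ e : ℝ) : ℂ) ^ (-s) = (t : ℂ) ^ (-s) * ((q : ℂ) ^ s) ^ (-e) := by
  rw [ofReal_cpow_eq_exp (by positivity), ofReal_cpow_eq_exp ht, ofReal_cpow_eq_exp hq,
    ← Complex.exp_int_mul, ← Complex.exp_add, Real.log_mul ht.ne' (by positivity), Real.log_zpow]
  congr 1
  push_cast
  ring

theorem half_ne_neg_nat (m : ℕ) : (1 / 2 : ℝ) ≠ -m := by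
  have : (0 : ℝ) ≤ m := m.cast_nonneg
  intro h; linarith

theorem neg_half_ne_neg_nat (m : ℕ) : (-(1 / 2) : ℝ) ≠ -m := by
  intro h
  have h2 : ((2 * m : ℕ) : ℝ) = (1 : ℕ) := by push_cast; linarith
  have := Nat.cast_injective h2
  omega

/-- Here `|q^s| < 1`, and `q^(ns) t^(-s) = (t q^(-n))^(-s)` reduces each term to Mellin inversion of
`exp(-x)`. -/
theorem hasSum_right {q : ℝ} (hq0 : 0 < q) (hq1 : q < 1) (p : ℝ[X]) {t : ℝ} (ht : 0 < t) :
    HasSum (fun n : ℕ => ((p.eval (n : ℝ) : ℝ) : ℂ) *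
      (2 * Real.pi * Real.exp (-(t * q ^ (-(n : ℤ))))))
      (∫ v : ℝ, Complex.Gamma ((1 / 2 : ℝ) + v * Complex.I) *
        (expZeta q p ((1 / 2 : ℝ) + v * Complex.I) *
          (t : ℂ) ^ (-((1 / 2 : ℝ) + v * Complex.I) : ℂ))) := by
  have h := hasSum_integral_Gamma (a := fun n : ℕ => ((p.eval (n : ℝ) : ℝ) : ℂ))
    (b := fun n : ℕ => t * q ^ (-(n : ℤ))) (fun n => by positivity) (σ := 1 / 2) half_ne_neg_nat
    (A := fun s => expZeta q p s * (t : ℂ) ^ (-s)) (fun v => by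
      simp_rw [ofReal_mul_zpow_cpow_neg ht hq0]
      have hz : ‖(q : ℂ) ^ (((1 / 2 : ℝ) : ℂ) + v * Complex.I)‖ < 1 := by
        rw [norm_ofReal_cpow hq0]
        exact Real.rpow_lt_one hq0.le hq1 (by simp)
      refine ((numeratorEval_div (p := p) hz).mul_right _).congr_fun fun n => ?_
      simp
      ring)
  refine h.congr_fun fun n => ?_
  rw [integral_Gamma_right (by positivity)]

/-- Here `|q^s| > 1`, so the expansion of the zeta function at infinity is used, and each term is an
integral of `Γ` to the left of `0`. -/
theorem hasSum_left {q : ℝ} (hq0 : 0 < q) (hq1 : q < 1) (p : ℝ[X]) {t : ℝ} (ht : 0 < t) :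
    HasSum (fun n : ℕ => -((p.eval (-(n : ℝ) - 1) : ℝ) : ℂ) *
      (2 * Real.pi * (Real.exp (-(t * q ^ (n + 1))) - 1)))
      (∫ v : ℝ, Complex.Gamma ((-(1 / 2) : ℝ) + v * Complex.I) *
        (expZeta q p ((-(1 / 2) : ℝ) + v * Complex.I) *
          (t : ℂ) ^ (-((-(1 / 2) : ℝ) + v * Complex.I) : ℂ))) := by
  have h := hasSum_integral_Gamma (a := fun n : ℕ => -((p.eval (-(n : ℝ) - 1) : ℝ) : ℂ))
    (b := fun n : ℕ => t * q ^ ((n + 1 : ℕ) : ℤ)) (fun n => by positivity) (σ := -(1 / 2))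
    neg_half_ne_neg_nat (A := fun s => expZeta q p s * (t : ℂ) ^ (-s)) (fun v => by
      simp_rw [ofReal_mul_zpow_cpow_neg ht hq0]
      have hz : 1 < ‖(q : ℂ) ^ (((-(1 / 2) : ℝ) : ℂ) + v * Complex.I)‖ := by
        rw [norm_ofReal_cpow hq0]
        exact Real.one_lt_rpow_of_pos_of_lt_one_of_neg hq0 hq1 (by simp)
      refine ((numeratorEval_div_of_one_lt (p := p) hz).mul_right _).congr_fun fun n => ?_
      rw [zpow_neg, zpow_natCast, inv_pow]
      ring)
  refine h.congr_fun fun n => ?_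
  rw [integral_Gamma_left (by positivity), zpow_natCast]

theorem summable_norm_eval_neg {q : ℝ} (hq0 : 0 < q) (hq1 : q < 1) (p : ℝ[X]) :
    Summable fun k : ℕ => ‖((p.eval (-(k : ℝ) - 1) : ℝ) : ℂ)‖ * q ^ (k + 1) := by
  have h := ((summable_eval_neg_mul_pow p (z := (q : ℂ))
    (by rw [Complex.norm_real, Real.norm_of_nonneg hq0.le]; exact hq1)).norm.mul_right q)
  refine h.congr fun k => ?_
  rw [norm_mul, norm_pow, Complex.norm_real, Complex.norm_real, Real.norm_of_nonneg hq0.le]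
  ring

theorem one_lt_norm_inv_pow {q : ℝ} (hq0 : 0 < q) (hq1 : q < 1) (n : ℕ) :
    1 < ‖(q : ℂ)⁻¹ ^ (n + 1)‖ := by
  rw [norm_pow, norm_inv, Complex.norm_real, Real.norm_of_nonneg hq0.le]
  exact one_lt_pow₀ ((one_lt_inv₀ hq0).2 hq1) (by omega)

/-- A bound for the values `ζ(-n)`, `n ≥ 1`. -/
noncomputable def zetaBound (q : ℝ) (p : ℝ[X]) : ℝ :=
  ∑' k : ℕ, ‖((p.eval (-(k : ℝ) - 1) : ℝ) : ℂ)‖ * q ^ (k + 1)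

/-- The bound for the zeta value is uniform in `n`, as `q^((n+1)(k+1)) ≤ q^(k+1)`; the factorial
remains to give convergence for every `t`. -/
theorem norm_expTerm_succ_le {q : ℝ} (hq0 : 0 < q) (hq1 : q < 1) (p : ℝ[X]) (n : ℕ) {t : ℝ}
    (ht : 0 < t) :
    ‖expTerm q p (n + 1) t‖ ≤ zetaBound q p * (t ^ (n + 1) / (n + 1).factorial) := by
  rw [expTerm, norm_mul]
  have h1 : ‖(-(t : ℂ)) ^ (n + 1) / ((n + 1).factorial : ℂ)‖ = t ^ (n + 1) / (n + 1).factorial := by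
    rw [norm_div, norm_pow, norm_neg, Complex.norm_real, Real.norm_of_nonneg ht.le,
      Complex.norm_natCast]
  rw [h1]
  gcongr
  rw [← (numeratorEval_div_of_one_lt (p := p) (one_lt_norm_inv_pow hq0 hq1 n)).tsum_eq]
  refine tsum_of_norm_bounded (summable_norm_eval_neg hq0 hq1 p).hasSum fun k => ?_
  rw [norm_mul, norm_neg]
  gcongr
  rw [norm_pow, norm_inv, norm_pow, norm_inv, Complex.norm_real, Real.norm_of_nonneg hq0.le]
  gcongr
  rw [inv_pow, inv_inv, pow_succ]
  exact mul_le_of_le_one_left hq0.le (pow_le_one₀ hq0.le hq1.le)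

/-- A double series summed in two orders: over the power of `t` it yields `exp(-t q^(k+1)) - 1`,
over `k` the expansion at infinity evaluated at `q^(-(n+1))`. -/
theorem hasSum_expTerm_succ {q : ℝ} (hq0 : 0 < q) (hq1 : q < 1) (p : ℝ[X]) {t : ℝ} (ht : 0 < t) :
    HasSum (fun n : ℕ => expTerm q p (n + 1) t)
      (∑' n : ℕ, -((p.eval (-(n : ℝ) - 1) : ℝ) : ℂ) * (Real.exp (-(t * q ^ (n + 1))) - 1)) := by
  set u : ℕ × ℕ → ℂ := fun x => -((p.eval (-(x.1 : ℝ) - 1) : ℝ) : ℂ) *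
    (((q : ℂ) ^ (x.1 + 1)) ^ (x.2 + 1) * ((-(t : ℂ)) ^ (x.2 + 1) / ((x.2 + 1).factorial : ℂ))) with hu
  have hexp : Summable fun n : ℕ => t ^ (n + 1) / (n + 1).factorial :=
    (summable_nat_add_iff 1).2 (Real.summable_pow_div_factorial t)
  have hsum : Summable u := by
    refine Summable.of_norm_bounded ((summable_norm_eval_neg hq0 hq1 p).mul_of_nonneg hexp
      (fun _ => by positivity) fun _ => by positivity) fun x => ?_
    simp only [hu]
    rw [norm_mul, norm_mul, norm_neg, norm_div, norm_pow (-(t : ℂ)), norm_neg,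
      Complex.norm_natCast, Complex.norm_real t, Real.norm_of_nonneg ht.le, ← mul_assoc]
    gcongr
    rw [norm_pow, norm_pow, Complex.norm_real, Real.norm_of_nonneg hq0.le]
    exact pow_le_of_le_one (by positivity) (pow_le_one₀ hq0.le hq1.le) (by omega)
  have h1 : ∀ k : ℕ, HasSum (fun n => u (k, n))
      (-((p.eval (-(k : ℝ) - 1) : ℝ) : ℂ) * (Real.exp (-(t * q ^ (k + 1))) - 1)) := by
    intro k
    refine HasSum.mul_left _ ?_
    have h := (hasSum_nat_add_iff' 1).2 (NormedSpace.expSeries_div_hasSum_exp (𝔸 := ℂ)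
      (-((t : ℂ) * (q : ℂ) ^ (k + 1))))
    rw [← Complex.exp_eq_exp_ℂ] at h
    simp only [Finset.range_one, Finset.sum_singleton, pow_zero, Nat.factorial_zero, Nat.cast_one,
      div_one] at h
    push_cast
    refine h.congr_fun fun n => ?_
    rw [← mul_div_assoc, ← mul_pow]
    congr 2
    ring
  have h2 : ∀ n : ℕ, HasSum (fun k => u (k, n)) (expTerm q p (n + 1) t) := by
    intro n
    have h := (numeratorEval_div_of_one_lt (p := p) (one_lt_norm_inv_pow hq0 hq1 n)).mul_right
      ((-(t : ℂ)) ^ (n + 1) / ((n + 1).factorial : ℂ))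
    refine h.congr_fun fun k => ?_
    simp only [hu]
    rw [inv_pow (q : ℂ), inv_inv, ← pow_mul, ← pow_mul, mul_comm (n + 1), mul_assoc]
  rw [(hsum.hasSum.prod_fiberwise h1).tsum_eq]
  exact ((Equiv.prodComm ℕ ℕ).hasSum_iff.2 hsum.hasSum).prod_fiberwise h2

/-- The heat trace, as a sum over the residues at the lattice points and the explicit terms. -/
theorem hasSum_heat {q : ℝ} (hq0 : 0 < q) (hq1 : q < 1) (p : ℝ[X]) {t : ℝ} (ht : 0 < t) :
    HasSum (fun n : ℕ => ((p.eval (n : ℝ) : ℝ) : ℂ) * Complex.exp (-t / (q : ℂ) ^ n))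
      (∑' k, residueTerm (expZ q p) t (latticePole q k) + ∑' n, expTerm q p (n + 1) t) := by
  have hpi : (2 * Real.pi : ℂ) ≠ 0 := by simp [Real.pi_ne_zero]
  have hR := hasSum_right hq0 hq1 p ht
  have hL := hasSum_left hq0 hq1 p ht
  have hE := hasSum_expTerm_succ hq0 hq1 p ht
  have h1 := (expZ_residue_formula hq0 hq1 p ht).2
  -- The left integral already equals the complete power series, so no further shift to the left is
  -- needed.
  have h2 : (∫ v : ℝ, Complex.Gamma ((-(1 / 2) : ℝ) + v * Complex.I) *
      (expZeta q p ((-(1 / 2) : ℝ) + v * Complex.I) *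
        (t : ℂ) ^ (-((-(1 / 2) : ℝ) + v * Complex.I) : ℂ))) =
      2 * Real.pi * ∑' n, expTerm q p (n + 1) t := by
    rw [hE.tsum_eq, ← hL.tsum_eq, ← tsum_mul_left]
    congr 1 with n
    ring
  rw [h2, sub_eq_iff_eq_add, ← mul_add] at h1
  have h3 := hR.div_const (2 * Real.pi : ℂ)
  rw [h1, mul_div_cancel_left₀ _ hpi] at h3
  refine h3.congr_fun fun n => ?_
  rw [mul_left_comm, mul_div_cancel_left₀ _ hpi, zpow_neg, zpow_natCast]
  push_cast
  rw [neg_div, div_eq_mul_inv]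

/-! ### The residues of `Z(s) t^(-s)` -/

theorem tendsto_add_mul_Gamma (n : ℕ) :
    Tendsto (fun s : ℂ => (s + n) * Complex.Gamma s) (𝓝[≠] (-n : ℂ))
      (𝓝 ((-1) ^ n / (n.factorial : ℂ))) := by
  induction n with
  | zero => simpa using Complex.tendsto_self_mul_Gamma_nhds_zero
  | succ n ih =>
    have hne : (-(n + 1 : ℕ) : ℂ) ≠ 0 := neg_ne_zero.2 (Nat.cast_ne_zero.2 n.succ_ne_zero)
    have hshift : Tendsto (fun s : ℂ => s + 1) (𝓝[≠] (-(n + 1 : ℕ) : ℂ)) (𝓝[≠] (-n : ℂ)) := by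
      refine tendsto_nhdsWithin_iff.2 ⟨?_, ?_⟩
      · have : Continuous fun s : ℂ => s + 1 := by fun_prop
        have := (this.tendsto (-(n + 1 : ℕ) : ℂ)).mono_left (nhdsWithin_le_nhds (s := {(-(n + 1 : ℕ) : ℂ)}ᶜ))
        simpa using this
      · filter_upwards [self_mem_nhdsWithin] with s hs h
        apply hs
        rw [mem_singleton_iff] at h ⊢
        push_cast
        linear_combination h
    have hs : Tendsto (fun s : ℂ => s) (𝓝[≠] (-(n + 1 : ℕ) : ℂ)) (𝓝 (-(n + 1 : ℕ) : ℂ)) :=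
      tendsto_id.mono_left nhdsWithin_le_nhds
    have h := (ih.comp hshift).div hs hne
    have e : (-1) ^ n / (n.factorial : ℂ) / (-(n + 1 : ℕ) : ℂ) =
        (-1) ^ (n + 1) / ((n + 1).factorial : ℂ) := by
      rw [Nat.factorial_succ, Nat.cast_mul, div_div, mul_neg, div_neg, mul_comm ((n + 1 : ℕ) : ℂ),
        pow_succ]
      ring
    rw [e] at h
    refine h.congr' ?_
    have h0 : ∀ᶠ s : ℂ in 𝓝[≠] (-(n + 1 : ℕ) : ℂ), s ≠ 0 :=
      nhdsWithin_le_nhds (isOpen_ne.mem_nhds hne)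
    filter_upwards [h0] with s hs
    simp only [Function.comp_apply, Pi.div_apply]
    rw [Complex.Gamma_add_one s hs]
    field_simp
    push_cast
    ring

theorem cpow_neg_nat {x : ℂ} (n : ℕ) : x ^ (-(n : ℂ)) = x⁻¹ ^ n := by
  rw [Complex.cpow_neg, Complex.cpow_natCast, inv_pow]

theorem cpow_neg_succ_ne_one {q : ℝ} (hq0 : 0 < q) (hq1 : q < 1) (n : ℕ) :
    (q : ℂ) ^ (-((n + 1 : ℕ) : ℂ)) ≠ 1 := by
  rw [cpow_neg_nat]
  intro h
  have := one_lt_norm_inv_pow hq0 hq1 n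
  rw [h] at this
  simp at this

theorem meromorphic_expZ {q : ℝ} (hq0 : 0 < q) (p : ℝ[X]) : Meromorphic (expZ q p) := fun s =>
  (Meromorphic.Gamma s).mul (meromorphic_expZeta hq0 p s)

theorem residueTerm_neg_nat {q : ℝ} (hq0 : 0 < q) (hq1 : q < 1) (p : ℝ[X]) (n : ℕ) {t : ℝ}
    (ht : 0 < t) : residueTerm (expZ q p) t (-((n + 1 : ℕ) : ℂ)) = expTerm q p (n + 1) t := by
  have hd := differentiable_ofReal_cpow_neg ht
  refine residue_of_tendsto ((meromorphic_expZ hq0 p _).mul (hd.analyticAt _).meromorphicAt) ?_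
  have h1 := tendsto_add_mul_Gamma (n + 1)
  have h2 : Tendsto (fun s => expZeta q p s * (t : ℂ) ^ (-s)) (𝓝[≠] (-((n + 1 : ℕ) : ℂ)))
      (𝓝 (expZeta q p (-((n + 1 : ℕ) : ℂ)) * (t : ℂ) ^ (-(-((n + 1 : ℕ) : ℂ))))) :=
    (((differentiableAt_expZeta hq0 p (cpow_neg_succ_ne_one hq0 hq1 n)).mul
      (hd _)).continuousAt.tendsto).mono_left nhdsWithin_le_nhds
  have h3 := h1.mul h2
  have e : (-1) ^ (n + 1) / ((n + 1).factorial : ℂ) * (expZeta q p (-((n + 1 : ℕ) : ℂ)) *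
      (t : ℂ) ^ (-(-((n + 1 : ℕ) : ℂ)))) = expTerm q p (n + 1) t := by
    rw [expTerm, expZeta, cpow_neg_nat, neg_neg, Complex.cpow_natCast, neg_pow (t : ℂ)]
    ring
  rw [e] at h3
  refine h3.congr fun s => ?_
  rw [expZ]
  ring

/-- The Taylor series of the exponential is inserted; powers `(s - c)^j f` with `j ≥ M` have no
polar part. -/
theorem residue_mul_exp {f : ℂ → ℂ} {c L : ℂ} {M : ℕ} (hf : MeromorphicAt f c)
    (h : Tendsto (fun s => (s - c) ^ M * f s) (𝓝[≠] c) (𝓝 L)) (a : ℂ) :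
    residue (fun s => f s * Complex.exp (a * (s - c))) c =
      ∑ j ∈ Finset.range M, a ^ j / (j.factorial : ℂ) * residue (fun s => (s - c) ^ j * f s) c := by
  have hm (j : ℕ) : MeromorphicAt (fun s => (s - c) ^ j * f s) c := by fun_prop
  have hm' (j : ℕ) :
      MeromorphicAt (fun s => a ^ j / (j.factorial : ℂ) * ((s - c) ^ j * f s)) c := by fun_prop
  -- The expansion includes the power `M`, so that the remainder is of order `M + 1` and its product
  -- with `f` tends to `0`. The extra term `j = M` has zero residue and is dropped at the end.
  set R : ℂ → ℂ := fun s => f s * (Complex.exp (a * (s - c)) -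
    ∑ j ∈ Finset.range (M + 1), (a * (s - c)) ^ j / (j.factorial : ℂ)) with hR
  have he : MeromorphicAt (fun s => Complex.exp (a * (s - c))) c := by
    refine AnalyticAt.meromorphicAt ?_
    fun_prop
  have hRm : MeromorphicAt R c := by
    refine hf.mul (he.sub (MeromorphicAt.fun_sum fun j _ => ?_))
    fun_prop
  have hlim : Tendsto R (𝓝[≠] c) (𝓝 0) := by
    have hz : Tendsto (fun s : ℂ => a * (s - c)) (𝓝[≠] c) (𝓝 0) := by
      have : Continuous fun s : ℂ => a * (s - c) := by fun_prop
      simpa using (this.tendsto c).mono_left (nhdsWithin_le_nhds (s := {c}ᶜ))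
    have hb : ∀ᶠ s in 𝓝[≠] c, ‖a * (s - c)‖ ≤ 1 := by
      exact (hz.norm.eventually_lt_const (u := 1) (by simp)).mono fun s hs => hs.le
    have hu : Tendsto (fun s => ‖(s - c) ^ M * f s‖ * (‖s - c‖ * (‖a‖ ^ (M + 1) *
        (((M + 1).succ : ℝ) * (((M + 1).factorial : ℝ) * ((M + 1 : ℕ) : ℝ))⁻¹)))) (𝓝[≠] c)
        (𝓝 0) := by
      have hs : Tendsto (fun s : ℂ => ‖s - c‖) (𝓝[≠] c) (𝓝 0) := by
        have : Continuous fun s : ℂ => ‖s - c‖ := by fun_prop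
        simpa using (this.tendsto c).mono_left (nhdsWithin_le_nhds (s := {c}ᶜ))
      simpa using h.norm.mul (hs.mul_const (‖a‖ ^ (M + 1) *
        (((M + 1).succ : ℝ) * (((M + 1).factorial : ℝ) * ((M + 1 : ℕ) : ℝ))⁻¹)))
    refine squeeze_zero_norm' ?_ hu
    filter_upwards [hb] with s hs
    have hexp := Complex.exp_bound (n := M + 1) hs (Nat.succ_pos M)
    simp only [hR]
    rw [norm_mul]
    refine (mul_le_mul_of_nonneg_left hexp (norm_nonneg _)).trans_eq ?_
    simp only [norm_mul, norm_pow, mul_pow]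
    ring
  have hRz : residue R c = 0 := residue_eq_zero_of_order_nonneg hRm
    ((tendsto_nhds_iff_meromorphicOrderAt_nonneg hRm).1 ⟨0, hlim⟩)
  have hMz : residue (fun s => (s - c) ^ M * f s) c = 0 := residue_eq_zero_of_order_nonneg (hm M)
    ((tendsto_nhds_iff_meromorphicOrderAt_nonneg (hm M)).1 ⟨L, h⟩)
  have hdec : (fun s => f s * Complex.exp (a * (s - c))) = fun s => R s +
      ∑ j ∈ Finset.range (M + 1), a ^ j / (j.factorial : ℂ) * ((s - c) ^ j * f s) := by
    ext s
    simp only [hR]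
    have : ∑ j ∈ Finset.range (M + 1), a ^ j / (j.factorial : ℂ) * ((s - c) ^ j * f s) =
        f s * ∑ j ∈ Finset.range (M + 1), (a * (s - c)) ^ j / (j.factorial : ℂ) := by
      rw [Finset.mul_sum]
      refine Finset.sum_congr rfl fun j _ => ?_
      rw [mul_pow]
      ring
    rw [this, ← mul_add, sub_add_cancel]
  rw [hdec, residue_add hRm (MeromorphicAt.fun_sum fun j _ => hm' j), hRz, zero_add,
    residue_sum _ hm', Finset.sum_range_succ]
  simp_rw [residue_const_mul (hm _)]
  rw [hMz, mul_zero, add_zero]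

theorem tendsto_pow_mul_expZeta {q : ℝ} (hq0 : 0 < q) (hq1 : q < 1) (p : ℝ[X]) (k : ℤ) :
    Tendsto (fun s => (s - latticePole q k) ^ (p.natDegree + 1) * expZeta q p s)
      (𝓝[≠] (latticePole q k))
      (𝓝 (numeratorEval p 1 / (-(Real.log q : ℂ)) ^ (p.natDegree + 1))) := by
  have hl : (-(Real.log q : ℂ)) ≠ 0 := neg_ne_zero.2 (by exact_mod_cast (Real.log_neg hq0 hq1).ne)
  set c := latticePole q k
  have hqc : (q : ℂ) ^ c = 1 := cpow_latticePole hq0 hq1 k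
  have hder : HasDerivAt (fun s : ℂ => 1 - (q : ℂ) ^ s) (-(Real.log q : ℂ)) c := by
    have := ((hasDerivAt_id c).const_cpow (c := (q : ℂ)) (.inl (by exact_mod_cast hq0.ne'))).const_sub 1
    simpa [hqc, Complex.ofReal_log hq0.le] using this
  have h1 := (hasDerivAt_iff_tendsto_slope.1 hder).inv₀ hl
  have h2 : Tendsto (fun s => numeratorEval p ((q : ℂ) ^ s)) (𝓝[≠] c) (𝓝 (numeratorEval p 1)) := by
    have := (((differentiable_numeratorEval p).comp
      (differentiable_const_cpow hq0)).continuous.tendsto c).mono_left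
      (nhdsWithin_le_nhds (s := {c}ᶜ))
    simpa [hqc, Function.comp_def] using this
  have h3 := h2.mul (h1.pow (p.natDegree + 1))
  rw [div_eq_mul_inv, ← inv_pow]
  refine h3.congr fun s => ?_
  rw [expZeta, slope_def_field, hqc, sub_self, sub_zero, inv_div, div_pow]
  ring

theorem latticePole_zero (q : ℝ) : latticePole q 0 = 0 := by simp [latticePole]

theorem latticePole_im_ne_zero {q : ℝ} (hq0 : 0 < q) (hq1 : q < 1) {k : ℤ} (hk : k ≠ 0) :
    (latticePole q k).im ≠ 0 := by
  rw [latticePole_eq, latticePoint_im]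
  exact mul_ne_zero (logPeriod_pos hq0 hq1).ne' (by exact_mod_cast hk)

theorem tendsto_pow_mul_expZ_zero {q : ℝ} (hq0 : 0 < q) (hq1 : q < 1) (p : ℝ[X]) :
    Tendsto (fun s => (s - latticePole q 0) ^ (p.natDegree + 2) * expZ q p s)
      (𝓝[≠] (latticePole q 0))
      (𝓝 (numeratorEval p 1 / (-(Real.log q : ℂ)) ^ (p.natDegree + 1))) := by
  have h := tendsto_pow_mul_expZeta hq0 hq1 p 0
  rw [latticePole_zero] at h ⊢
  have h1 := Complex.tendsto_self_mul_Gamma_nhds_zero.mul h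
  rw [one_mul] at h1
  refine h1.congr fun s => ?_
  rw [expZ]
  ring

theorem tendsto_pow_mul_expZ_of_ne {q : ℝ} (hq0 : 0 < q) (hq1 : q < 1) (p : ℝ[X]) {k : ℤ}
    (hk : k ≠ 0) :
    Tendsto (fun s => (s - latticePole q k) ^ (p.natDegree + 1) * expZ q p s)
      (𝓝[≠] (latticePole q k)) (𝓝 (Complex.Gamma (latticePole q k) *
        (numeratorEval p 1 / (-(Real.log q : ℂ)) ^ (p.natDegree + 1)))) := by
  have h := tendsto_pow_mul_expZeta hq0 hq1 p k
  have h2 := (Gamma_differentiableAt_of_im_ne_zero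
    (latticePole_im_ne_zero hq0 hq1 hk)).continuousAt.tendsto.mono_left
    (nhdsWithin_le_nhds (s := {latticePole q k}ᶜ))
  refine (h2.mul h).congr fun s => ?_
  rw [expZ]
  ring

/-- Only at `k = 0` does the pole of `Γ` raise the order to `m + 2`. This is why the top power of
`log_q t` has a constant coefficient and no oscillating part. -/
theorem oscCoeff_top {q : ℝ} (hq0 : 0 < q) (hq1 : q < 1) (p : ℝ[X]) (k : ℤ) :
    oscCoeff q p (p.natDegree + 1) k =
      if k = 0 then numeratorEval p 1 / ((p.natDegree + 1).factorial : ℂ) else 0 := by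
  have hm := meromorphic_expZ hq0 p (latticePole q k)
  have hm' : MeromorphicAt (fun s => (s - latticePole q k) ^ (p.natDegree + 1) * expZ q p s)
    (latticePole q k) := by fun_prop
  split_ifs with hk
  · subst hk
    have hl : (-(Real.log q : ℂ)) ≠ 0 := neg_ne_zero.2 (by exact_mod_cast (Real.log_neg hq0 hq1).ne)
    have := residue_of_tendsto hm' ((tendsto_pow_mul_expZ_zero hq0 hq1 p).congr fun s => by ring)
    rw [oscCoeff, this]
    field_simp
  · have := residue_eq_zero_of_order_nonneg hm' ((tendsto_nhds_iff_meromorphicOrderAt_nonneg hm').1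
      ⟨_, tendsto_pow_mul_expZ_of_ne hq0 hq1 p hk⟩)
    rw [oscCoeff, this, mul_zero]

/-- Write `t^(-s) = t^(-s_k) exp(-log t (s - s_k))`. With `log t = log q · log_q t` the first factor
is the Fourier mode, and the Taylor coefficients of the second produce the powers of `log_q t`. -/
theorem residueTerm_latticePole {q : ℝ} (hq0 : 0 < q) (hq1 : q < 1) (p : ℝ[X]) (k : ℤ) {t : ℝ}
    (ht : 0 < t) : residueTerm (expZ q p) t (latticePole q k) =
      ∑ j ∈ Finset.range (p.natDegree + 2), oscCoeff q p j k *
        Complex.exp (2 * Real.pi * Complex.I * k * Real.logb q t) * (Real.logb q t : ℂ) ^ j := by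
  have hlr := (Real.log_neg hq0 hq1).ne
  have hl : (Real.log q : ℂ) ≠ 0 := by exact_mod_cast hlr
  set c := latticePole q k with hc
  set x := Real.logb q t with hx
  have hxt : (Real.log t : ℂ) = x * Real.log q := by
    rw [hx, Real.logb, ← Complex.ofReal_mul, div_mul_cancel₀ _ hlr]
  have hm := meromorphic_expZ hq0 p c
  -- The exponent `m + 2` is used for all `k`; for `k ≠ 0` it exceeds the order by one and the limit
  -- is `0`.
  have hL : ∃ L, Tendsto (fun s => (s - c) ^ (p.natDegree + 2) * expZ q p s) (𝓝[≠] c) (𝓝 L) := by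
    by_cases hk : k = 0
    · subst hk
      exact ⟨_, tendsto_pow_mul_expZ_zero hq0 hq1 p⟩
    · have hs : Tendsto (fun s : ℂ => s - c) (𝓝[≠] c) (𝓝 0) := by
        have : Continuous fun s : ℂ => s - c := by fun_prop
        simpa using (this.tendsto c).mono_left (nhdsWithin_le_nhds (s := {c}ᶜ))
      refine ⟨_, (hs.mul (tendsto_pow_mul_expZ_of_ne hq0 hq1 p hk)).congr fun s => ?_⟩
      ring
  obtain ⟨L, hL⟩ := hL
  have hcpow : (fun s => expZ q p s * (t : ℂ) ^ (-s)) = fun s =>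
      (t : ℂ) ^ (-c) * (expZ q p s * Complex.exp (-(Real.log t : ℂ) * (s - c))) := by
    ext s
    rw [ofReal_cpow_eq_exp ht, ofReal_cpow_eq_exp ht, mul_left_comm, ← Complex.exp_add]
    congr 2
    ring
  have he : (t : ℂ) ^ (-c) = Complex.exp (2 * Real.pi * Complex.I * k * x) := by
    rw [ofReal_cpow_eq_exp ht, hxt, hc, latticePole]
    congr 1
    field_simp
  have hmer : MeromorphicAt (fun s => expZ q p s * Complex.exp (-(Real.log t : ℂ) * (s - c))) c := by
    refine hm.mul (AnalyticAt.meromorphicAt ?_)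
    fun_prop
  rw [residueTerm, hcpow, residue_const_mul hmer, residue_mul_exp hm hL, he, Finset.mul_sum]
  refine Finset.sum_congr rfl fun j _ => ?_
  rw [oscCoeff, hxt, ← hc, ← mul_neg, mul_pow]
  ring

/-- The factor `(s - s_k)^j` has modulus at most `1` on the small circle, so the estimate for the
residues applies unchanged. -/
theorem summable_norm_oscCoeff {q : ℝ} (hq0 : 0 < q) (hq1 : q < 1) (p : ℝ[X]) (j : ℕ) :
    Summable fun k : ℤ => ‖oscCoeff q p j k‖ := by
  set ω := logPeriod q with hω
  have hωpos : 0 < ω := logPeriod_pos hq0 hq1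
  obtain ⟨C, hC, hres⟩ := exists_norm_residue_le hωpos
  obtain ⟨M, hM0, hM⟩ := exists_norm_expZeta_le hq0 hq1 p
  simp only [oscCoeff, norm_mul]
  refine Summable.mul_left _ (Summable.of_nonneg_of_le (fun _ => norm_nonneg _) (fun k => ?_)
    ((summable_const_div_one_add_sq C).mul_left M))
  simp only [latticePole_eq, ← hω] at hM ⊢
  refine hres _ M k (fun s hs hne => ?_) (fun s hs => ?_) hM0
  · have hne' := ne_latticePoint_of_norm_sub_le hωpos hs hne
    have hre := abs_le.1 (abs_re_le_of_norm_sub_latticePoint_le hs)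
    refine DifferentiableAt.mul (by fun_prop) (DifferentiableAt.mul ?_ ?_)
    · refine Complex.differentiableAt_Gamma s fun m hm => ?_
      rcases m with _ | m
      · apply hne' 0
        simp [hm, latticePoint]
      · have h1 := hre.1
        have : (0 : ℝ) ≤ m := m.cast_nonneg
        simp [hm] at h1
        linarith
    · refine differentiableAt_expZeta hq0 p fun h => ?_
      obtain ⟨i, hi⟩ := (cpow_eq_one_iff hq0 hq1).1 h
      exact hne' i (hi.trans (latticePole_eq q i))
  · rw [norm_mul, norm_pow, hs, expZ, norm_mul]
    have h1 : cellRadius ω ^ j ≤ 1 := pow_le_one₀ (cellRadius_pos hωpos).le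
      ((cellRadius_le_half ω).trans (by norm_num))
    have h2 := hM s (abs_re_le_of_norm_sub_latticePoint_le hs.le) (cellRadius_le_norm_sub hωpos hs)
    calc _ ≤ 1 * (‖Complex.Gamma s‖ * ‖expZeta q p s‖) := by gcongr
      _ = ‖expZeta q p s‖ * ‖Complex.Gamma s‖ := by ring
      _ ≤ _ := by gcongr

theorem norm_exp_two_pi_mul (k : ℤ) (x : ℝ) :
    ‖Complex.exp (2 * Real.pi * Complex.I * k * x)‖ = 1 := by
  rw [show (2 * Real.pi * Complex.I * k * x : ℂ) = (2 * Real.pi * k * x : ℝ) * Complex.I by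
    push_cast; ring]
  exact Complex.norm_exp_ofReal_mul_I _

theorem norm_residueTerm_latticePole_le {q : ℝ} (hq0 : 0 < q) (hq1 : q < 1) (p : ℝ[X]) (k : ℤ)
    {t : ℝ} (ht : 0 < t) : ‖residueTerm (expZ q p) t (latticePole q k)‖ ≤
      ∑ j ∈ Finset.range (p.natDegree + 2), ‖oscCoeff q p j k‖ * |Real.logb q t| ^ j := by
  rw [residueTerm_latticePole hq0 hq1 p k ht]
  refine (norm_sum_le _ _).trans (Finset.sum_le_sum fun j _ => ?_)
  rw [norm_mul, norm_mul, norm_exp_two_pi_mul, mul_one, norm_pow, Complex.norm_real,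
    Real.norm_eq_abs]

theorem hasSum_fourier {q : ℝ} (hq0 : 0 < q) (hq1 : q < 1) (p : ℝ[X]) (j : ℕ) (x : ℝ) :
    HasSum (fun k : ℤ => oscCoeff q p j k * Complex.exp (2 * Real.pi * Complex.I * k * x))
      (constCoeff q p j + oscSeries q p j x) := by
  have hs : Summable fun k : ℤ =>
      oscCoeff q p j k * Complex.exp (2 * Real.pi * Complex.I * k * x) := by
    refine Summable.of_norm ((summable_norm_oscCoeff hq0 hq1 p j).congr fun k => ?_)
    rw [norm_mul, norm_exp_two_pi_mul, mul_one]
  have h := hs.tsum_eq_add_tsum_ite 0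
  have e : constCoeff q p j + oscSeries q p j x =
      ∑' k : ℤ, oscCoeff q p j k * Complex.exp (2 * Real.pi * Complex.I * k * x) := by
    rw [h]
    simp [constCoeff, oscSeries]
  rw [e]
  exact hs.hasSum

theorem hasSum_residueTerm_latticePole {q : ℝ} (hq0 : 0 < q) (hq1 : q < 1) (p : ℝ[X]) {t : ℝ}
    (ht : 0 < t) : HasSum (fun k => residueTerm (expZ q p) t (latticePole q k))
      (expTerm q p 0 t) := by
  simp only [residueTerm_latticePole hq0 hq1 p _ ht]
  set x := Real.logb q t with hx
  have h := hasSum_sum (s := Finset.range (p.natDegree + 1)) fun j _ =>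
    (hasSum_fourier hq0 hq1 p j x).mul_right ((x : ℂ) ^ j)
  have h2 : HasSum (fun k : ℤ => oscCoeff q p (p.natDegree + 1) k *
      Complex.exp (2 * Real.pi * Complex.I * k * x) * (x : ℂ) ^ (p.natDegree + 1))
      (numeratorEval p 1 / ((p.natDegree + 1).factorial : ℂ) * (x : ℂ) ^ (p.natDegree + 1)) := by
    have := hasSum_single (f := fun k : ℤ => oscCoeff q p (p.natDegree + 1) k *
      Complex.exp (2 * Real.pi * Complex.I * k * x) * (x : ℂ) ^ (p.natDegree + 1)) 0 fun k hk => by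
        rw [oscCoeff_top hq0 hq1, if_neg hk, zero_mul, zero_mul]
    simpa [oscCoeff_top hq0 hq1] using this
  rw [expTerm]
  refine (h2.add h).congr_fun fun k => ?_
  rw [Finset.sum_range_succ, add_comm]

/-! ### The candidate poles -/

/-- The possible poles of `Z`: the lattice points and the negative integers. -/
noncomputable def polePoint (q : ℝ) : ℤ ⊕ ℕ → ℂ
  | .inl k => latticePole q k
  | .inr n => -((n + 1 : ℕ) : ℂ)

/-- The integer `-Re s` at the candidate pole `s`. -/
def poleLevel : ℤ ⊕ ℕ → ℕ
  | .inl _ => 0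
  | .inr n => n + 1

theorem polePoint_re (q : ℝ) (i : ℤ ⊕ ℕ) : (polePoint q i).re = -(poleLevel i : ℝ) := by
  cases i with
  | inl k => simp [polePoint, poleLevel, latticePole_eq]
  | inr n => simp [polePoint, poleLevel]

theorem polePoint_injective {q : ℝ} (hq0 : 0 < q) (hq1 : q < 1) :
    Function.Injective (polePoint q) := by
  intro i j h
  have hre := congrArg Complex.re h
  rw [polePoint_re, polePoint_re, neg_inj, Nat.cast_inj] at hre
  cases i with
  | inl k =>
    cases j with
    | inl l =>
      have him := congrArg Complex.im h
      simp only [polePoint, latticePole_eq, latticePoint_im] at him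
      have := mul_left_cancel₀ (logPeriod_pos hq0 hq1).ne' him
      rw [Int.cast_injective this]
    | inr n => simp [poleLevel] at hre
  | inr m =>
    cases j with
    | inl l => simp [poleLevel] at hre
    | inr n =>
      simp only [poleLevel, Nat.add_right_cancel_iff] at hre
      rw [hre]

theorem differentiableAt_expZ {q : ℝ} (hq0 : 0 < q) (hq1 : q < 1) (p : ℝ[X]) {s : ℂ}
    (hs : s ∉ range (polePoint q)) : DifferentiableAt ℂ (expZ q p) s := by
  refine (Complex.differentiableAt_Gamma s fun m hm => ?_).mul
    (differentiableAt_expZeta hq0 p fun h => ?_)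
  · rcases m with _ | m
    · exact hs ⟨.inl 0, by simp [polePoint, latticePole_zero, hm]⟩
    · exact hs ⟨.inr m, by simp [polePoint, hm]⟩
  · obtain ⟨k, rfl⟩ := (cpow_eq_one_iff hq0 hq1).1 h
    exact hs ⟨.inl k, rfl⟩

theorem finite_polePoint {q : ℝ} (hq0 : 0 < q) (hq1 : q < 1) (a b c : ℝ) :
    {i | c ≤ (polePoint q i).re ∧ (polePoint q i).im ∈ Icc a b}.Finite := by
  have hω := logPeriod_pos hq0 hq1
  rw [← Set.finite_preimage_inl_and_inr]
  constructor
  · refine (Set.finite_Icc ⌊a / logPeriod q⌋ ⌈b / logPeriod q⌉).subset fun k hk => ?_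
    obtain ⟨-, h1, h2⟩ := hk
    simp only [polePoint, latticePole_eq, latticePoint_im] at h1 h2
    constructor
    · have : a / logPeriod q ≤ k := by rw [div_le_iff₀ hω]; linarith
      exact_mod_cast (Int.floor_le _).trans this
    · have : (k : ℝ) ≤ b / logPeriod q := by rw [le_div_iff₀ hω]; linarith
      exact_mod_cast this.trans (Int.le_ceil _)
  · refine (Set.finite_Iic ⌈-c⌉₊).subset fun n hn => ?_
    have h1 := hn.1
    simp only [polePoint_re, poleLevel] at h1
    push_cast at h1
    have h2 : (n : ℝ) ≤ -c := by linarith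
    exact_mod_cast h2.trans (Nat.le_ceil _)

/-- The candidates are locally finite. Closedness makes complex differentiability off the range give
analyticity there. -/
theorem isClosed_range_polePoint {q : ℝ} (hq0 : 0 < q) (hq1 : q < 1) :
    IsClosed (range (polePoint q)) := by
  have hlf : LocallyFinite fun i : ℤ ⊕ ℕ => ({polePoint q i} : Set ℂ) := by
    intro z
    refine ⟨Metric.ball z 1, Metric.ball_mem_nhds z one_pos,
      (finite_polePoint hq0 hq1 (z.im - 1) (z.im + 1) (z.re - 1)).subset ?_⟩
    rintro i ⟨w, hw, hwz⟩
    rw [mem_singleton_iff] at hw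
    subst hw
    rw [Metric.mem_ball, dist_eq_norm] at hwz
    have h1 := abs_le.1 ((Complex.abs_re_le_norm _).trans hwz.le)
    have h2 := abs_le.1 ((Complex.abs_im_le_norm _).trans hwz.le)
    simp only [Complex.sub_re, Complex.sub_im] at h1 h2
    exact ⟨by linarith, by linarith, by linarith⟩
  have := hlf.isClosed_iUnion fun i => isClosed_singleton
  rwa [iUnion_singleton_eq_range] at this

theorem expZ_order_nonneg {q : ℝ} (hq0 : 0 < q) (hq1 : q < 1) (p : ℝ[X]) {s : ℂ}
    (hs : s ∉ range (polePoint q)) : 0 ≤ meromorphicOrderAt (expZ q p) s := by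
  refine AnalyticAt.meromorphicOrderAt_nonneg (DifferentiableOn.analyticAt
    (s := (range (polePoint q))ᶜ) (fun z hz =>
      (differentiableAt_expZ hq0 hq1 p hz).differentiableWithinAt) ?_)
  exact (isClosed_range_polePoint hq0 hq1).isOpen_compl.mem_nhds hs

theorem residueTerm_eq_zero {q : ℝ} (hq0 : 0 < q) (p : ℝ[X]) {t : ℝ} (ht : 0 < t) {s : ℂ}
    (h : 0 ≤ meromorphicOrderAt (expZ q p) s) : residueTerm (expZ q p) t s = 0 := by
  obtain ⟨g, hg, hfg⟩ := (meromorphic_expZ hq0 p s).meromorphicOrderAt_nonneg_iff.1 h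
  have : (fun s' => expZ q p s' * (t : ℂ) ^ (-s')) =ᶠ[𝓝[≠] s] fun s' => g s' * (t : ℂ) ^ (-s') := by
    filter_upwards [hfg] with z hz
    rw [hz]
  rw [residueTerm, residue_congr this]
  exact residue_eq_zero_of_analyticAt (hg.mul ((differentiable_ofReal_cpow_neg ht).analyticAt s))

/-- Some candidates are not poles, for instance where `p̃(q^(-n)) = 0`. Their residue terms vanish,
so the poles may be replaced by all candidates in `D`. -/
theorem finsum_polesIn_eq_tsum {q : ℝ} (hq0 : 0 < q) (hq1 : q < 1) (p : ℝ[X]) {t : ℝ} (ht : 0 < t)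
    {D : Set ℂ} (hD : (polePoint q ⁻¹' D).Finite) :
    ∑ᶠ s ∈ polesIn (expZ q p) D, residueTerm (expZ q p) t s =
      ∑' i, (polePoint q ⁻¹' D).indicator
        (fun i => residueTerm (expZ q p) t (polePoint q i)) i := by
  have h1 : ∑ᶠ s ∈ polesIn (expZ q p) D, residueTerm (expZ q p) t s =
      ∑ᶠ s ∈ polePoint q '' (polePoint q ⁻¹' D), residueTerm (expZ q p) t s := by
    refine finsum_mem_inter_support_eq' _ _ _ fun s hs => ?_
    rw [image_preimage_eq_inter_range]
    constructor
    · rintro ⟨h1, h2⟩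
      refine ⟨h1, ?_⟩
      by_contra h3
      exact absurd (expZ_order_nonneg hq0 hq1 p h3) (not_le.2 h2)
    · rintro ⟨h1, -⟩
      refine ⟨h1, not_le.1 fun h2 => hs (residueTerm_eq_zero hq0 p ht h2)⟩
  rw [h1, finsum_mem_image (polePoint_injective hq0 hq1).injOn, finsum_mem_def, tsum_eq_finsum]
  exact hD.subset Set.support_indicator_subset

/-! ### Summing the residues -/

theorem hasSum_residueTerm {q : ℝ} (hq0 : 0 < q) (hq1 : q < 1) (p : ℝ[X]) {t : ℝ} (ht : 0 < t) :
    HasSum (fun i => residueTerm (expZ q p) t (polePoint q i))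
      (expTerm q p 0 t + ∑' n, expTerm q p (n + 1) t) := by
  refine HasSum.sum (hasSum_residueTerm_latticePole hq0 hq1 p ht) ?_
  refine (hasSum_expTerm_succ hq0 hq1 p ht).summable.hasSum.congr_fun fun n => ?_
  exact residueTerm_neg_nat hq0 hq1 p n ht

/-- One summable majorant, valid for all `t` in a compact interval, gives locally uniform
convergence for every grouping of the residues at once. -/
theorem exists_residueTerm_bound {q : ℝ} (hq0 : 0 < q) (hq1 : q < 1) (p : ℝ[X]) {a b : ℝ}
    (ha : 0 < a) : ∃ M : ℤ ⊕ ℕ → ℝ, Summable M ∧ ∀ t ∈ Icc a b, ∀ i,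
      ‖residueTerm (expZ q p) t (polePoint q i)‖ ≤ M i := by
  have hcont : ContinuousOn (Real.logb q) (Icc a b) := by
    unfold Real.logb
    refine ContinuousOn.div_const (Real.continuousOn_log.mono fun x hx => ?_) _
    exact (ha.trans_le hx.1).ne'
  obtain ⟨X, hX⟩ := isCompact_Icc.exists_bound_of_continuousOn hcont
  refine ⟨Sum.elim
    (fun k => ∑ j ∈ Finset.range (p.natDegree + 2), ‖oscCoeff q p j k‖ * X ^ j)
    (fun n => zetaBound q p * (b ^ (n + 1) / (n + 1).factorial)), ?_, fun t ht i => ?_⟩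
  · refine Summable.sum _ ?_ ?_
    · rw [Sum.elim_comp_inl]
      exact summable_sum fun j _ => (summable_norm_oscCoeff hq0 hq1 p j).mul_right _
    · rw [Sum.elim_comp_inr]
      exact Summable.mul_left (zetaBound q p) ((summable_nat_add_iff (f := fun n : ℕ =>
        b ^ n / (n.factorial : ℝ)) 1).2 (Real.summable_pow_div_factorial b))
  · have ht0 : 0 < t := ha.trans_le ht.1
    have hZ : 0 ≤ zetaBound q p := tsum_nonneg fun k => by positivity
    cases i with
    | inl k =>
      refine (norm_residueTerm_latticePole_le hq0 hq1 p k ht0).trans ?_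
      simp only [Sum.elim_inl]
      gcongr
      exact hX t ht
    | inr n =>
      simp only [polePoint, Sum.elim_inr]
      rw [residueTerm_neg_nat hq0 hq1 p n ht0]
      refine (norm_expTerm_succ_le hq0 hq1 p n ht0).trans ?_
      gcongr
      exact ht.2

/-- The part of the sum of the residues that belongs to the class `n` under `σ`. -/
noncomputable def residueBlock (q : ℝ) (p : ℝ[X]) (σ : ℤ ⊕ ℕ → ℕ) (n : ℕ) (t : ℝ) : ℂ :=
  ∑' i : σ ⁻¹' {n}, residueTerm (expZ q p) t (polePoint q i)

/-- An absolutely convergent family may be summed class by class, whatever the classes. The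
majorants, summed over each class, provide the Weierstrass test. -/
theorem isAbsolutelyExact_residueBlock {q : ℝ} (hq0 : 0 < q) (hq1 : q < 1) (p : ℝ[X])
    (σ : ℤ ⊕ ℕ → ℕ) {h : ℝ → ℂ}
    (hh : ∀ t, 0 < t → h t = expTerm q p 0 t + ∑' n, expTerm q p (n + 1) t) :
    IsAbsolutelyExact h (residueBlock q p σ) := by
  constructor
  · intro t ht
    rw [hh t ht]
    exact (hasSum_residueTerm hq0 hq1 p ht).tsum_fiberwise σ
  · intro v hv t ht
    have ht' : (0 : ℝ) < t := ht
    obtain ⟨M, hM, hb⟩ := exists_residueTerm_bound hq0 hq1 p (a := t / 2) (b := 2 * t) (half_pos ht')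
    refine ⟨Icc (t / 2) (2 * t), mem_nhdsWithin_of_mem_nhds
      (Icc_mem_nhds (by linarith) (by linarith)), ?_⟩
    refine tendstoUniformlyOn_tsum_nat (f := fun n t => ‖residueBlock q p σ n t‖)
      (hM.hasSum.tsum_fiberwise σ).summable (fun n x hx => ?_) v hv
    rw [norm_norm]
    exact tsum_of_norm_bounded (hM.subtype (σ ⁻¹' {n})).hasSum fun i => hb x hx i

theorem isAbsolutelyExact_congr {h : ℝ → ℂ} {φ ψ : ℕ → ℝ → ℂ} (hφ : IsAbsolutelyExact h φ)
    (e : ∀ n t, 0 < t → φ n t = ψ n t) : IsAbsolutelyExact h ψ := by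
  refine ⟨fun t ht => (hφ.1 t ht).congr_fun fun n => (e n t ht).symm, ?_⟩
  have h1 := hφ.2.congr (G := fun (N : ℕ) (t : ℝ) => ∑ n ∈ Finset.range N, ‖ψ n t‖)
    fun N t ht => Finset.sum_congr rfl fun n _ => by rw [e n t ht]
  refine h1.congr_right fun t ht => ?_
  exact tsum_congr fun n => by rw [e n t ht]

theorem isResidueScale_congr {Z : ℂ → ℂ} {R : ℕ → ℝ} {y : ℕ → ℤ → ℝ} {φ ψ : ℕ → ℝ → ℂ}
    (hφ : IsResidueScale Z R y φ) (e : ∀ n t, 0 < t → φ n t = ψ n t) : IsResidueScale Z R y ψ := by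
  intro n t ht
  rw [← e n t ht]
  exact hφ n t ht

/-- `σ` assigns to every candidate pole the strip that contains it. -/
def IsStripIndex (q : ℝ) (R : ℕ → ℝ) (σ : ℤ ⊕ ℕ → ℕ) : Prop :=
  ∀ i n, σ i = n ↔ -R (n + 1) ≤ (polePoint q i).re ∧ (polePoint q i).re < -R n

/-- A candidate that is not a pole may lie on a dividing line. Half-open strips assign it
unambiguously, to the first strip whose left edge it does not pass. -/
theorem exists_isStripIndex {q : ℝ} {R : ℕ → ℝ} (hR : StrictMono R) (hRt : Tendsto R atTop atTop)
    (hR0 : 0 < -R 0) : ∃ σ, IsStripIndex q R σ := by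
  have hex : ∀ i, ∃ n, -R (n + 1) ≤ (polePoint q i).re := fun i => by
    obtain ⟨n, hn⟩ := ((hRt.comp (tendsto_add_atTop_nat 1)).eventually_ge_atTop
      (-(polePoint q i).re)).exists
    exact ⟨n, neg_le.1 hn⟩
  classical
  refine ⟨fun i => Nat.find (hex i), fun i n => ?_⟩
  rw [Nat.find_eq_iff]
  refine and_congr_right fun h1 => ⟨fun h2 => ?_, fun h2 m hm h3 => ?_⟩
  · cases n with
    | zero =>
      rw [polePoint_re]
      have : (0 : ℝ) ≤ poleLevel i := Nat.cast_nonneg _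
      linarith
    | succ n => exact not_le.1 (h2 n n.lt_succ_self)
  · have : R (m + 1) ≤ R n := hR.monotone hm
    linarith

theorem sum_tsum_indicator_diff {ι : Type*} {u : ι → ℂ} (hu : Summable u) {A : ℕ → Set ι}
    (hA : Monotone A) (hA0 : A 0 = ∅) (N : ℕ) :
    ∑ k ∈ Finset.range N, ∑' i, (A (k + 1) \ A k).indicator u i = ∑' i, (A N).indicator u i := by
  induction N with
  | zero => simp [hA0]
  | succ N ih =>
    rw [Finset.sum_range_succ, ih, ← (hu.indicator _).tsum_add (hu.indicator _)]
    refine tsum_congr fun i => ?_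
    have := congrFun (Set.indicator_union_of_disjoint
      (disjoint_sdiff_right (s := A N) (t := A (N + 1))) u) i
    rw [Set.union_sdiff_cancel (hA N.le_succ)] at this
    exact this.symm

/-- Each candidate of the strip eventually enters the growing rectangles, and the residue family is
absolutely summable, so dominated convergence identifies the limit. -/
theorem isResidueScale_residueBlock {q : ℝ} (hq0 : 0 < q) (hq1 : q < 1) (p : ℝ[X])
    {R : ℕ → ℝ} {y : ℕ → ℤ → ℝ} (hcut : IsAdmissibleCut (expZ q p) 0 R y) {σ : ℤ ⊕ ℕ → ℕ}
    (hσ : IsStripIndex q R σ) : IsResidueScale (expZ q p) R y (residueBlock q p σ) := by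
  intro n t ht
  set u : ℤ ⊕ ℕ → ℂ := fun i => residueTerm (expZ q p) t (polePoint q i) with hu
  have hus : Summable u := (hasSum_residueTerm hq0 hq1 p ht).summable
  set A : ℕ → Set (ℤ ⊕ ℕ) := fun N => polePoint q ⁻¹' cutRectangle R y n N with hA
  have hmono : Monotone A := by
    refine monotone_nat_of_le_succ fun N i hi => ?_
    cases N with
    | zero => exact absurd hi (by simp [hA, cutRectangle])
    | succ N =>
      obtain ⟨h1, h2, h3⟩ := hi
      refine ⟨h1, ?_, ?_⟩
      · refine le_trans ((hcut.strictMono_y n).monotone ?_) h2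
        push_cast
        omega
      · refine le_trans h3 ((hcut.strictMono_y n).monotone ?_)
        push_cast
        omega
  have hA0 : A 0 = ∅ := by simp [hA, cutRectangle]
  have hfin : ∀ N, (A N).Finite := by
    intro N
    cases N with
    | zero => rw [hA0]; exact Set.finite_empty
    | succ N =>
      exact (finite_polePoint hq0 hq1 _ _ _).subset fun i hi => ⟨hi.1.1, hi.2⟩
  have hsum : ∀ N, (∑ k ∈ Finset.range N,
      ∑ᶠ s ∈ polesIn (expZ q p) (cutRectangle R y n (k + 1) \ cutRectangle R y n k),
        residueTerm (expZ q p) t s) = ∑' i, (A N).indicator u i := by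
    intro N
    rw [← sum_tsum_indicator_diff hus hmono hA0]
    refine Finset.sum_congr rfl fun k _ => ?_
    exact finsum_polesIn_eq_tsum hq0 hq1 p ht ((hfin (k + 1)).subset fun i hi => hi.1)
  simp_rw [hsum]
  rw [residueBlock, tsum_subtype (σ ⁻¹' {n}) u]
  refine tendsto_tsum_of_dominated_convergence hus.norm (fun i => ?_)
    (.of_forall fun N i => norm_indicator_le_norm_self _ _)
  by_cases hi : σ i = n
  · rw [Set.indicator_of_mem (by exact hi)]
    refine tendsto_const_nhds.congr' ?_
    obtain ⟨h1, h2⟩ := (hσ i n).1 hi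
    have t1 : Tendsto (fun N : ℕ => y n ((N : ℤ) + 1)) atTop atTop :=
      (hcut.tendsto_y_top n).comp (tendsto_atTop_add_const_right _ _ tendsto_natCast_atTop_atTop)
    have t2 : Tendsto (fun N : ℕ => y n (-((N : ℤ) + 1))) atTop atBot :=
      (hcut.tendsto_y_bot n).comp (tendsto_neg_atTop_atBot.comp
        (tendsto_atTop_add_const_right _ _ tendsto_natCast_atTop_atTop))
    have ev : ∀ᶠ N : ℕ in atTop, i ∈ A (N + 1) := by
      filter_upwards [t1.eventually_ge_atTop (polePoint q i).im,
        t2.eventually_le_atBot (polePoint q i).im] with N h3 h4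
      exact ⟨⟨h1, h2.le⟩, h4, h3⟩
    obtain ⟨N₀, hN₀⟩ := eventually_atTop.1 ev
    filter_upwards [eventually_ge_atTop (N₀ + 1)] with N hN
    rw [Set.indicator_of_mem (hmono hN (hN₀ N₀ le_rfl))]
  · rw [Set.indicator_of_notMem (by exact hi)]
    refine tendsto_const_nhds.congr fun N => ?_
    by_cases hiA : i ∈ A N
    · rw [Set.indicator_of_mem hiA]
      cases N with
      | zero => rw [hA0] at hiA; exact hiA.elim
      | succ N =>
        obtain ⟨⟨h1, h2⟩, -⟩ := hiA
        -- Rectangles are closed but strips half-open: a candidate of the rectangle outside the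
        -- class lies on the right edge, where `Z` is regular.
        have h3 : (polePoint q i).re = -R n := by
          by_contra h4
          exact hi ((hσ i n).2 ⟨h1, lt_of_le_of_ne h2 h4⟩)
        exact (residueTerm_eq_zero hq0 p ht (hcut.regular n _ h3)).symm
    · rw [Set.indicator_of_notMem hiA]

/-! ### Admissible cuts -/

/-- Ordinates of horizontal lines that avoid the lattice poles. -/
noncomputable def halfOrdinate (ω : ℝ) (k : ℤ) : ℝ :=
  ω * (k + if k = 0 then 0 else if 0 < k then 1 / 2 else -(1 / 2))

theorem halfOrdinate_strictMono {ω : ℝ} (hω : 0 < ω) : StrictMono (halfOrdinate ω) := by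
  intro k l hkl
  refine mul_lt_mul_of_pos_left ?_ hω
  have h1 : (k : ℝ) + 1 ≤ l := by exact_mod_cast hkl
  split_ifs <;> linarith

theorem le_halfOrdinate {ω : ℝ} (hω : 0 < ω) (k : ℤ) : ω * (k - 1 / 2) ≤ halfOrdinate ω k := by
  refine mul_le_mul_of_nonneg_left ?_ hω.le
  split_ifs <;> linarith

theorem halfOrdinate_le {ω : ℝ} (hω : 0 < ω) (k : ℤ) : halfOrdinate ω k ≤ ω * (k + 1 / 2) := by
  refine mul_le_mul_of_nonneg_left ?_ hω.le
  split_ifs <;> linarith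

theorem exists_halfOrdinate_eq (ω : ℝ) {k : ℤ} (hk : k ≠ 0) :
    ∃ j : ℤ, halfOrdinate ω k = ω * (j + 1 / 2) := by
  unfold halfOrdinate
  rw [if_neg hk]
  split_ifs
  · exact ⟨k, rfl⟩
  · exact ⟨k - 1, by push_cast; ring⟩

theorem tendsto_halfOrdinate_atTop {ω : ℝ} (hω : 0 < ω) : Tendsto (halfOrdinate ω) atTop atTop := by
  refine tendsto_atTop_mono (le_halfOrdinate hω) (Tendsto.const_mul_atTop hω ?_)
  exact tendsto_atTop_add_const_right _ _ tendsto_intCast_atTop_atTop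

theorem tendsto_halfOrdinate_atBot {ω : ℝ} (hω : 0 < ω) : Tendsto (halfOrdinate ω) atBot atBot := by
  refine tendsto_atBot_mono (halfOrdinate_le hω) (Tendsto.const_mul_atBot hω ?_)
  refine tendsto_atBot_add_const_right _ _ ?_
  exact tendsto_intCast_atBot_iff.2 tendsto_id

theorem exists_norm_numeratorEval_le (p : ℝ[X]) (r : ℝ) :
    ∃ M : ℝ, 0 ≤ M ∧ ∀ z : ℂ, ‖z‖ ≤ r → ‖numeratorEval p z‖ ≤ M := by
  obtain ⟨M, hM⟩ := (isCompact_closedBall (0 : ℂ) r).exists_bound_of_continuousOn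
    (differentiable_numeratorEval p).continuous.continuousOn
  exact ⟨max M 0, le_max_right _ _, fun z hz => (hM z (by simpa using hz)).trans (le_max_left _ _)⟩

/-- Midway between lattice heights `q^s` is a negative real number. Hence `|1 - q^s| = 1 + q^x ≥ 1`,
which bounds the zeta function on these lines uniformly in the height. -/
theorem cpow_half_ordinate {q : ℝ} (hq0 : 0 < q) (hq1 : q < 1) (x : ℝ) (j : ℤ) :
    (q : ℂ) ^ ((x : ℂ) + (logPeriod q * (j + 1 / 2) : ℝ) * Complex.I) = -((q ^ x : ℝ) : ℂ) := by
  have hl := (Real.log_neg hq0 hq1).ne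
  have h1 : Real.log q * (logPeriod q * (j + 1 / 2)) = -(2 * Real.pi) * (j + 1 / 2) := by
    rw [logPeriod]
    field_simp
  have h2 : (Real.log q : ℂ) * ((x : ℂ) + (logPeriod q * (j + 1 / 2) : ℝ) * Complex.I) =
      ((Real.log q * x : ℝ) : ℂ) + (-Real.pi * Complex.I) + ((-j : ℤ) : ℂ) * (2 * Real.pi * Complex.I) := by
    rw [mul_add, ← mul_assoc, ← Complex.ofReal_mul, ← Complex.ofReal_mul, h1]
    push_cast
    ring
  rw [ofReal_cpow_eq_exp hq0, h2, Complex.exp_add, Complex.exp_int_mul_two_pi_mul_I, mul_one,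
    Complex.exp_add, neg_mul, Complex.exp_neg, Complex.exp_pi_mul_I, ← Complex.ofReal_exp,
    ← Real.rpow_def_of_pos hq0]
  norm_num

theorem exists_norm_expZeta_horizontal_le {q : ℝ} (hq0 : 0 < q) (hq1 : q < 1) (p : ℝ[X]) (a : ℝ) :
    ∃ M : ℝ, 0 ≤ M ∧ ∀ (j : ℤ) (x : ℝ), a ≤ x →
      ‖expZeta q p ((x : ℂ) + (logPeriod q * (j + 1 / 2) : ℝ) * Complex.I)‖ ≤ M := by
  obtain ⟨M, hM0, hM⟩ := exists_norm_numeratorEval_le p (q ^ a)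
  refine ⟨M, hM0, fun j x hx => ?_⟩
  have hqx : 0 < q ^ x := Real.rpow_pos_of_pos hq0 x
  rw [expZeta, cpow_half_ordinate hq0 hq1, norm_div, norm_pow, sub_neg_eq_add]
  have h1 : ‖(1 : ℂ) + ((q ^ x : ℝ) : ℂ)‖ = 1 + q ^ x := by
    rw [← Complex.ofReal_one, ← Complex.ofReal_add, Complex.norm_real,
      Real.norm_of_nonneg (by positivity)]
  rw [h1]
  refine (div_le_self (norm_nonneg _) (one_le_pow₀ (by linarith))).trans (hM _ ?_)
  rw [norm_neg, Complex.norm_real, Real.norm_of_nonneg hqx.le]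
  exact Real.rpow_le_rpow_of_exponent_ge hq0 hq1.le hx

/-- On a vertical line `|q^s|` is the constant `q^σ`, so `|1 - q^s| ≥ |1 - q^σ|`. -/
theorem exists_norm_expZeta_vertical_le {q : ℝ} (hq0 : 0 < q) (p : ℝ[X]) {σ : ℝ}
    (hσ : q ^ σ ≠ 1) : ∃ M : ℝ, ∀ v : ℝ, ‖expZeta q p ((σ : ℂ) + v * Complex.I)‖ ≤ M := by
  obtain ⟨M, hM0, hM⟩ := exists_norm_numeratorEval_le p (q ^ σ)
  have hpos : 0 < |1 - q ^ σ| := abs_pos.2 (sub_ne_zero.2 hσ.symm)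
  refine ⟨M / |1 - q ^ σ| ^ (p.natDegree + 1), fun v => ?_⟩
  have hn : ‖(q : ℂ) ^ ((σ : ℂ) + v * Complex.I)‖ = q ^ σ := by
    rw [norm_ofReal_cpow hq0]; simp
  rw [expZeta, norm_div, norm_pow]
  gcongr
  · exact hM _ hn.le
  · have := abs_norm_sub_norm_le (1 : ℂ) ((q : ℂ) ^ ((σ : ℂ) + v * Complex.I))
    rwa [hn, norm_one] at this

theorem horizontalSup_le {Z : ℂ → ℂ} {a b v C : ℝ}
    (h : ∀ x ∈ Icc a b, ‖Z (x + v * Complex.I)‖ ≤ C) : horizontalSup Z a b v ≤ ENNReal.ofReal C := by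
  refine iSup₂_le fun x hx => ?_
  rw [← ofReal_norm]
  exact ENNReal.ofReal_le_ofReal (h x hx)

theorem tendsto_horizontalSup {q : ℝ} (hq0 : 0 < q) (hq1 : q < 1) (p : ℝ[X]) (a b : ℝ)
    {l : Filter ℤ} (hl : ∀ᶠ k in l, k ≠ 0)
    (hl' : Tendsto (fun k => |halfOrdinate (logPeriod q) k|) l atTop) :
    Tendsto (fun k => horizontalSup (expZ q p) a b (halfOrdinate (logPeriod q) k)) l (𝓝 0) := by
  obtain ⟨M, hM0, hM⟩ := exists_norm_expZeta_horizontal_le hq0 hq1 p a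
  obtain ⟨C, hC, hΓ⟩ := exists_norm_Gamma_le a b
  have h1 : Tendsto (fun k => C * M / |halfOrdinate (logPeriod q) k| ^ 2) l (𝓝 0) :=
    ((tendsto_pow_atTop (by norm_num)).comp hl').const_div_atTop _
  have h2 := ENNReal.tendsto_ofReal h1
  rw [ENNReal.ofReal_zero] at h2
  refine tendsto_of_tendsto_of_tendsto_of_le_of_le' tendsto_const_nhds h2
    (.of_forall fun _ => zero_le) ?_
  filter_upwards [hl, hl'.eventually_ge_atTop 1] with k hk hk1
  refine horizontalSup_le fun x hx => ?_
  rw [expZ, norm_mul, mul_div_right_comm]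
  gcongr
  · have := hΓ (x + halfOrdinate (logPeriod q) k * Complex.I) (by simpa using hx.1)
      (by simpa using hx.2) (by simpa using hk1)
    simpa using this
  · obtain ⟨j, hj⟩ := exists_halfOrdinate_eq (logPeriod q) hk
    rw [hj]
    exact hM j x hx.1

theorem horizontalSup_lt_top {q : ℝ} (hq0 : 0 < q) (hq1 : q < 1) (p : ℝ[X]) (a b : ℝ) {k : ℤ}
    (hk : k ≠ 0) : horizontalSup (expZ q p) a b (halfOrdinate (logPeriod q) k) < ⊤ := by
  obtain ⟨M, hM0, hM⟩ := exists_norm_expZeta_horizontal_le hq0 hq1 p a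
  obtain ⟨j, hj⟩ := exists_halfOrdinate_eq (logPeriod q) hk
  have hne : halfOrdinate (logPeriod q) k ≠ 0 := by
    rw [hj]
    refine mul_ne_zero (logPeriod_pos hq0 hq1).ne' fun h => ?_
    have h2 : ((2 * j + 1 : ℤ) : ℝ) = (0 : ℤ) := by push_cast; linarith
    have := Int.cast_injective h2
    omega
  have hc : Continuous fun x : ℝ =>
      Complex.Gamma (x + halfOrdinate (logPeriod q) k * Complex.I) := by
    refine continuous_iff_continuousAt.2 fun x => ?_
    exact ContinuousAt.comp (f := fun x : ℝ => (x : ℂ) + halfOrdinate (logPeriod q) k * Complex.I)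
      (g := Complex.Gamma)
      (Gamma_differentiableAt_of_im_ne_zero (by simpa using hne)).continuousAt (by fun_prop)
  obtain ⟨B, hB⟩ := (isCompact_Icc (a := a) (b := b)).exists_bound_of_continuousOn hc.continuousOn
  refine lt_of_le_of_lt (horizontalSup_le (C := B * M) fun x hx => ?_) ENNReal.ofReal_lt_top
  rw [expZ, norm_mul]
  have h1 := hB x hx
  have h2 := hM j x hx.1
  rw [← hj] at h2
  gcongr
  exact (norm_nonneg _).trans h1

theorem nat_sub_half_ne (m n : ℕ) : -((n : ℝ) - 1 / 2) ≠ -(m : ℝ) := by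
  intro h
  have h2 : ((2 * n : ℕ) : ℝ) = (2 * m + 1 : ℕ) := by push_cast; linarith
  have := Nat.cast_injective h2
  omega

/-- The identity sequence gives strips of unit width; a sequence with gaps gives the wider strips
that absorb vanishing terms. -/
theorem isAdmissibleCut_expZ {q : ℝ} (hq0 : 0 < q) (hq1 : q < 1) (p : ℝ[X]) {N : ℕ → ℕ}
    (hN : StrictMono N) (hN0 : N 0 = 0) :
    IsAdmissibleCut (expZ q p) 0 (fun j => (N j : ℝ) - 1 / 2)
      (fun _ => halfOrdinate (logPeriod q)) := by
  have hω := logPeriod_pos hq0 hq1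
  refine
    { strictMono_R := fun i j hij => by
        have : (N i : ℝ) < N j := by exact_mod_cast hN hij
        simpa using this
      tendsto_R := tendsto_atTop_add_const_right _ _
        (tendsto_natCast_atTop_atTop.comp hN.tendsto_atTop)
      lt_neg_R_zero := by simp [hN0]
      neg_R_lt := fun n hn => ?_
      regular := fun n s hs => expZ_order_nonneg hq0 hq1 p ?_
      integrable := fun n => ?_
      strictMono_y := fun _ => halfOrdinate_strictMono hω
      y_zero := fun _ => by simp [halfOrdinate]
      tendsto_y_top := fun _ => tendsto_halfOrdinate_atTop hω
      tendsto_y_bot := fun _ => tendsto_halfOrdinate_atBot hω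
      sup_lt_top := fun n k hk => horizontalSup_lt_top hq0 hq1 p _ _ hk
      sup_tendsto_top := fun n => tendsto_horizontalSup hq0 hq1 p _ _ (eventually_ne_atTop 0)
        (tendsto_abs_atTop_atTop.comp (tendsto_halfOrdinate_atTop hω))
      sup_tendsto_bot := fun n => tendsto_horizontalSup hq0 hq1 p _ _ (eventually_ne_atBot 0)
        (tendsto_abs_atBot_atTop.comp (tendsto_halfOrdinate_atBot hω)) }
  · have h1 : 1 ≤ N n := hn.trans hN.le_apply
    have : (1 : ℝ) ≤ N n := by exact_mod_cast h1
    linarith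
  · rintro ⟨i, rfl⟩
    rw [polePoint_re] at hs
    exact nat_sub_half_ne _ _ hs.symm
  · have hσ1 : q ^ (-((N n : ℝ) - 1 / 2)) ≠ 1 := by
      have := nat_sub_half_ne 0 (N n)
      rw [Nat.cast_zero, neg_zero] at this
      exact fun h => this ((Real.rpow_right_inj hq0 hq1.ne).1 (h.trans (Real.rpow_zero q).symm))
    obtain ⟨M, hM⟩ := exists_norm_expZeta_vertical_le hq0 p hσ1
    refine integrable_Gamma_mul_vertical (B := expZeta q p) (fun m => nat_sub_half_ne m _)
      (fun v => differentiableAt_expZeta hq0 p fun h => hσ1 ?_) hM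
    have h1 := congrArg norm h
    rw [norm_ofReal_cpow hq0, norm_one] at h1
    simpa using h1

/-! ### Residue sums of the strips as explicit terms -/

theorem tsum_poleLevel_fiber {q : ℝ} (hq0 : 0 < q) (hq1 : q < 1) (p : ℝ[X]) (n : ℕ) {t : ℝ}
    (ht : 0 < t) : residueBlock q p poleLevel n t = expTerm q p n t := by
  rw [residueBlock, tsum_subtype (poleLevel ⁻¹' {n})
    (fun i => residueTerm (expZ q p) t (polePoint q i))]
  set w := (poleLevel ⁻¹' {n}).indicator
    (fun i => residueTerm (expZ q p) t (polePoint q i)) with hw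
  refine HasSum.tsum_eq ?_
  cases n with
  | zero =>
    rw [← add_zero (expTerm q p 0 t)]
    refine HasSum.sum ((hasSum_residueTerm_latticePole hq0 hq1 p ht).congr_fun fun k => ?_)
      ((hasSum_zero (α := ℂ)).congr_fun fun m => ?_)
    · show w (.inl k) = _
      exact Set.indicator_of_mem (s := poleLevel ⁻¹' {0}) (show poleLevel (.inl k) = 0 from rfl) _
    · show w (.inr m) = 0
      exact Set.indicator_of_notMem (s := poleLevel ⁻¹' {0})
        (show ¬ poleLevel (.inr m) = 0 from Nat.succ_ne_zero m) _
  | succ n =>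
    have h := hasSum_single (f := w) (.inr n) fun i hi => Set.indicator_of_notMem (fun h => hi ?_) _
    · have e : w (.inr n) = expTerm q p (n + 1) t := by
        rw [hw, Set.indicator_of_mem (s := poleLevel ⁻¹' {n + 1})
          (show poleLevel (.inr n) = n + 1 from rfl)]
        exact residueTerm_neg_nat hq0 hq1 p n ht
      rwa [e] at h
    · cases i with
      | inl k => exact absurd (show 0 = n + 1 from h) (Nat.succ_ne_zero n).symm
      | inr m => rw [Nat.succ_injective (show m + 1 = n + 1 from h)]

/-- A wide strip contains the level `N j` and the skipped levels up to `N (j + 1)`, and the terms of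
the latter vanish. -/
theorem residueBlock_eq_expTerm {q : ℝ} (hq0 : 0 < q) (hq1 : q < 1) (p : ℝ[X]) {N : ℕ → ℕ}
    (hN : StrictMono N) {σ : ℤ ⊕ ℕ → ℕ}
    (hσ : IsStripIndex q (fun j => (N j : ℝ) - 1 / 2) σ)
    (hzero : ∀ n, n ∉ range N → ∀ t, 0 < t → expTerm q p n t = 0) (hN0 : N 0 = 0)
    (j : ℕ) {t : ℝ} (ht : 0 < t) : residueBlock q p σ j t = expTerm q p (N j) t := by
  have hσ' : ∀ i j, σ i = j ↔ N j ≤ poleLevel i ∧ poleLevel i < N (j + 1) := by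
    intro i j
    rw [hσ i j, polePoint_re]
    constructor
    · rintro ⟨h1, h2⟩
      -- The inequalities are doubled to clear the half and pass to natural numbers.
      have h3 : ((2 * N j : ℕ) : ℝ) < (2 * poleLevel i + 1 : ℕ) := by push_cast; linarith
      have h4 : ((2 * poleLevel i : ℕ) : ℝ) + 1 ≤ (2 * N (j + 1) : ℕ) := by push_cast; linarith
      have h3' := Nat.cast_lt.1 h3
      have h4' : 2 * poleLevel i + 1 ≤ 2 * N (j + 1) := by exact_mod_cast h4
      omega
    · rintro ⟨h1, h2⟩
      have h3 : (N j : ℝ) ≤ poleLevel i := by exact_mod_cast h1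
      have h4 : (poleLevel i : ℝ) + 1 ≤ N (j + 1) := by exact_mod_cast h2
      constructor <;> linarith
  rw [← tsum_poleLevel_fiber hq0 hq1 p _ ht, residueBlock, residueBlock,
    tsum_subtype (σ ⁻¹' {j}) (fun i => residueTerm (expZ q p) t (polePoint q i)),
    tsum_subtype (poleLevel ⁻¹' {N j}) (fun i => residueTerm (expZ q p) t (polePoint q i))]
  refine tsum_congr fun i => ?_
  by_cases h1 : poleLevel i = N j
  · rw [Set.indicator_of_mem (s := poleLevel ⁻¹' _) (by exact h1),
      Set.indicator_of_mem (s := σ ⁻¹' _)]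
    exact (hσ' i j).2 ⟨h1.ge, h1 ▸ hN j.lt_succ_self⟩
  · rw [Set.indicator_of_notMem (s := poleLevel ⁻¹' _) (by exact h1)]
    by_cases h2 : σ i = j
    · rw [Set.indicator_of_mem (by exact h2)]
      obtain ⟨h3, h4⟩ := (hσ' i j).1 h2
      have h5 : poleLevel i ∉ range N := by
        rintro ⟨l, hl⟩
        rw [← hl, hN.lt_iff_lt] at h4
        rw [← hl, hN.le_iff_le] at h3
        have : l = j := by omega
        exact h1 (by rw [← hl, this])
      cases i with
      | inl k => exact absurd ⟨0, hN0⟩ h5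
      | inr n =>
        simp only [polePoint]
        rw [residueTerm_neg_nat hq0 hq1 p n ht]
        exact hzero _ h5 t ht
    · rw [Set.indicator_of_notMem (by exact h2)]

theorem isResidueScale_expTerm {q : ℝ} (hq0 : 0 < q) (hq1 : q < 1) (p : ℝ[X]) {N : ℕ → ℕ}
    (hN : StrictMono N) (hN0 : N 0 = 0)
    (hzero : ∀ n, n ∉ range N → ∀ t, 0 < t → expTerm q p n t = 0) {h : ℝ → ℂ}
    (hh : ∀ t, 0 < t → h t = expTerm q p 0 t + ∑' n, expTerm q p (n + 1) t) :
    IsResidueScale (expZ q p) (fun j => (N j : ℝ) - 1 / 2) (fun _ => halfOrdinate (logPeriod q))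
      (fun j => expTerm q p (N j)) ∧ IsAbsolutelyExact h fun j => expTerm q p (N j) := by
  have hcut := isAdmissibleCut_expZ hq0 hq1 p hN hN0
  obtain ⟨σ, hσ⟩ := exists_isStripIndex (q := q) hcut.strictMono_R hcut.tendsto_R hcut.lt_neg_R_zero
  have e := fun j t (ht : 0 < t) => residueBlock_eq_expTerm hq0 hq1 p hN hσ hzero hN0 j ht
  exact ⟨isResidueScale_congr (isResidueScale_residueBlock hq0 hq1 p hcut hσ) e,
    isAbsolutelyExact_congr (isAbsolutelyExact_residueBlock hq0 hq1 p σ hh) e⟩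

/-! ### The asymptotic expansion -/

theorem norm_oscSeries_le {q : ℝ} (hq0 : 0 < q) (hq1 : q < 1) (p : ℝ[X]) (j : ℕ) (x : ℝ) :
    ‖oscSeries q p j x‖ ≤ ∑' k : ℤ, ‖oscCoeff q p j k‖ := by
  refine tsum_of_norm_bounded (summable_norm_oscCoeff hq0 hq1 p j).hasSum fun k => ?_
  split_ifs with h
  · simp
  · rw [norm_mul, show 2 * Real.pi * Complex.I * k * x = ((2 * Real.pi * k * x : ℝ) : ℂ) * Complex.I by
      push_cast; ring, Complex.norm_exp_ofReal_mul_I, mul_one]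

theorem tendsto_logb_nhdsGT_zero {q : ℝ} (hq0 : 0 < q) (hq1 : q < 1) :
    Tendsto (Real.logb q) (𝓝[>] 0) atTop :=
  Real.tendsto_log_nhdsGT_zero.atBot_mul_const_of_neg (inv_lt_zero.2 (Real.log_neg hq0 hq1))

/-- The Fourier series are bounded, so lower powers of `log_q t → ∞` are negligible against the
leading one, whose coefficient is nonzero because `p̃(1) ≠ 0`. -/
theorem isEquivalent_expTerm_zero {q : ℝ} (hq0 : 0 < q) (hq1 : q < 1) {p : ℝ[X]} (hp : p ≠ 0) :
    Asymptotics.IsEquivalent (𝓝[>] 0) (expTerm q p 0) fun t =>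
      numeratorEval p 1 / ((p.natDegree + 1).factorial : ℂ) *
        (Real.logb q t : ℂ) ^ (p.natDegree + 1) := by
  have hx : Tendsto (fun t => ‖(Real.logb q t : ℂ)‖) (𝓝[>] 0) atTop := by
    simp only [Complex.norm_real]
    exact tendsto_norm_atTop_atTop.comp (tendsto_logb_nhdsGT_zero hq0 hq1)
  have hA : numeratorEval p 1 / ((p.natDegree + 1).factorial : ℂ) ≠ 0 :=
    div_ne_zero (numeratorEval_one_ne_zero hp) (by exact_mod_cast Nat.factorial_ne_zero _)
  refine Asymptotics.IsLittleO.trans_isBigO (g := fun t => (Real.logb q t : ℂ) ^ (p.natDegree + 1))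
    ?_ (Asymptotics.isBigO_self_const_mul hA _ _)
  have e : (expTerm q p 0 - fun t => numeratorEval p 1 / ((p.natDegree + 1).factorial : ℂ) *
        (Real.logb q t : ℂ) ^ (p.natDegree + 1)) = fun t =>
      ∑ j ∈ Finset.range (p.natDegree + 1),
        (constCoeff q p j + oscSeries q p j (Real.logb q t)) * (Real.logb q t : ℂ) ^ j := by
    funext t
    simp [expTerm]
  rw [e]
  refine Asymptotics.IsLittleO.fun_sum fun j hj => ?_
  have h1 : (fun t => constCoeff q p j + oscSeries q p j (Real.logb q t)) =O[𝓝[>] 0]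
      fun _ => (1 : ℂ) := by
    refine Asymptotics.isBigO_of_le' (c := ‖constCoeff q p j‖ + ∑' k : ℤ, ‖oscCoeff q p j k‖) _
      fun t => ?_
    rw [norm_one, mul_one]
    exact (norm_add_le _ _).trans (by gcongr; exact norm_oscSeries_le hq0 hq1 p j _)
  have h2 : (fun t => (Real.logb q t : ℂ) ^ j) =o[𝓝[>] 0]
      fun t => (Real.logb q t : ℂ) ^ (p.natDegree + 1) := by
    refine (Asymptotics.isLittleO_pow_pow_cobounded_of_lt (R := ℂ) (Finset.mem_range.1 hj)).comp_tendsto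
      (tendsto_norm_atTop_iff_cobounded.1 hx)
  simpa using h1.mul_isLittleO h2

theorem isBigO_one_expTerm_zero {q : ℝ} (hq0 : 0 < q) (hq1 : q < 1) {p : ℝ[X]} (hp : p ≠ 0) :
    (fun _ => (1 : ℂ)) =O[𝓝[>] 0] expTerm q p 0 := by
  have hA : numeratorEval p 1 / ((p.natDegree + 1).factorial : ℂ) ≠ 0 :=
    div_ne_zero (numeratorEval_one_ne_zero hp) (by exact_mod_cast Nat.factorial_ne_zero _)
  refine Asymptotics.IsBigO.trans ?_ (isEquivalent_expTerm_zero hq0 hq1 hp).isBigO_symm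
  refine Asymptotics.IsBigO.trans ?_ (Asymptotics.isBigO_self_const_mul hA _ _)
  refine Asymptotics.IsBigO.of_bound 1 ?_
  filter_upwards [(tendsto_logb_nhdsGT_zero hq0 hq1).eventually_ge_atTop 1] with t ht
  rw [norm_one, one_mul, norm_pow, Complex.norm_real]
  exact one_le_pow₀ (ht.trans (le_abs_self _))

theorem isBigO_expTerm_succ {q : ℝ} (hq0 : 0 < q) (hq1 : q < 1) (p : ℝ[X]) (n : ℕ) :
    expTerm q p (n + 1) =O[𝓝[>] 0] fun t => (t : ℂ) ^ (n + 1) := by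
  refine Asymptotics.IsBigO.of_bound (zetaBound q p / (n + 1).factorial) ?_
  filter_upwards [self_mem_nhdsWithin] with t ht
  refine (norm_expTerm_succ_le hq0 hq1 p n ht).trans (le_of_eq ?_)
  rw [norm_pow, Complex.norm_real, Real.norm_of_nonneg (le_of_lt ht)]
  ring

theorem isBigO_pow_expTerm_succ {q : ℝ} (hq0 : 0 < q) (hq1 : q < 1) {p : ℝ[X]} {n : ℕ}
    (hn : numeratorEval p ((q : ℂ)⁻¹ ^ (n + 1)) ≠ 0) :
    (fun t : ℝ => (t : ℂ) ^ (n + 1)) =O[𝓝[>] 0] expTerm q p (n + 1) := by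
  have h1 : 1 - (q : ℂ)⁻¹ ^ (n + 1) ≠ 0 := fun h => by
    have := one_lt_norm_inv_pow hq0 hq1 n
    rw [← sub_eq_zero.1 h, norm_one] at this
    exact lt_irrefl _ this
  have h2 : ((n + 1).factorial : ℂ) ≠ 0 := by exact_mod_cast Nat.factorial_ne_zero _
  have e : expTerm q p (n + 1) = fun t : ℝ => (numeratorEval p ((q : ℂ)⁻¹ ^ (n + 1)) /
      (1 - (q : ℂ)⁻¹ ^ (n + 1)) ^ (p.natDegree + 1) * ((-1) ^ (n + 1) / ((n + 1).factorial : ℂ))) *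
        (t : ℂ) ^ (n + 1) := by
    funext t
    rw [expTerm, neg_pow]
    ring
  rw [e]
  exact Asymptotics.isBigO_self_const_mul (mul_ne_zero (div_ne_zero hn (pow_ne_zero _ h1))
    (div_ne_zero (pow_ne_zero _ (by norm_num)) h2)) _ _

/-- For `t ≤ 1` every term of the tail is at most a constant times `t^(N (J + 1)) / (N i)!`, and the
reciprocal factorials are summable. -/
theorem tail_isBigO {q : ℝ} (hq0 : 0 < q) (hq1 : q < 1) (p : ℝ[X]) {N : ℕ → ℕ} (hN : StrictMono N)
    {h : ℝ → ℂ} (hsum : ∀ t, 0 < t → HasSum (fun j => expTerm q p (N j) t) (h t)) (J : ℕ) :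
    (fun t => h t - ∑ j ∈ Finset.range (J + 1), expTerm q p (N j) t) =O[𝓝[>] 0]
      fun t => (t : ℂ) ^ N (J + 1) := by
  have hs : Summable fun i => zetaBound q p * (1 / ((N (i + (J + 1))).factorial : ℝ)) := by
    refine Summable.mul_left _ ?_
    have h1 : Summable fun n : ℕ => 1 / (n.factorial : ℝ) := by
      simpa using Real.summable_pow_div_factorial 1
    exact h1.comp_injective (hN.injective.comp (add_left_injective (J + 1)))
  refine Asymptotics.IsBigO.of_bound (∑' i, zetaBound q p * (1 / ((N (i + (J + 1))).factorial : ℝ))) ?_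
  filter_upwards [Ioc_mem_nhdsGT (zero_lt_one (α := ℝ))] with t ht
  have h1 := (hasSum_nat_add_iff' (J + 1)).2 (hsum t ht.1)
  rw [← h1.tsum_eq]
  have hb : 0 ≤ zetaBound q p := by
    have := (norm_nonneg _).trans (norm_expTerm_succ_le hq0 hq1 p 0 (zero_lt_one (α := ℝ)))
    simpa using this
  refine tsum_of_norm_bounded (hs.hasSum.mul_right _) fun i => ?_
  have hle : N (J + 1) ≤ N (i + (J + 1)) := hN.monotone (by omega)
  obtain ⟨n, hn⟩ : ∃ n, N (i + (J + 1)) = n + 1 :=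
    Nat.exists_eq_succ_of_ne_zero
      ((Nat.zero_le _).trans_lt (hN (show i + J < i + (J + 1) by omega))).ne'
  rw [hn] at hle ⊢
  refine (norm_expTerm_succ_le hq0 hq1 p n ht.1).trans ?_
  rw [norm_pow, Complex.norm_real, Real.norm_of_nonneg ht.1.le, mul_assoc, one_div_mul_eq_div]
  refine mul_le_mul_of_nonneg_left (div_le_div_of_nonneg_right ?_ (by positivity)) hb
  exact pow_le_pow_of_le_one ht.1.le ht.2 hle

theorem isLittleO_ofReal_pow {a b : ℕ} (hab : a < b) :
    (fun t : ℝ => (t : ℂ) ^ b) =o[𝓝[>] 0] fun t : ℝ => (t : ℂ) ^ a := by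
  have h := Asymptotics.isLittleO_pow_pow (𝕜 := ℂ) hab
  refine h.comp_tendsto ?_
  exact (Complex.continuous_ofReal.tendsto' 0 0 Complex.ofReal_zero).mono_left nhdsWithin_le_nhds

/-- Each term dominates `t^(N j)`, and each after the first is also dominated by it. Comparison of
powers of `t` then yields the scale, and the tail bound the expansion. -/
theorem isAsymptoticExpansionAtZero_expTerm {q : ℝ} (hq0 : 0 < q) (hq1 : q < 1) {p : ℝ[X]}
    (hp : p ≠ 0) {N : ℕ → ℕ} (hN : StrictMono N) (hN0 : N 0 = 0)
    (hne : ∀ j, N j ≠ 0 → numeratorEval p ((q : ℂ)⁻¹ ^ N j) ≠ 0) {h : ℝ → ℂ}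
    (hsum : ∀ t, 0 < t → HasSum (fun j => expTerm q p (N j) t) (h t)) :
    IsAsymptoticExpansionAtZero h fun j => expTerm q p (N j) := by
  have hsucc : ∀ j, ∃ n, N (j + 1) = n + 1 := fun j =>
    Nat.exists_eq_succ_of_ne_zero ((Nat.zero_le _).trans_lt (hN j.lt_succ_self)).ne'
  have hup : ∀ j, expTerm q p (N (j + 1)) =O[𝓝[>] 0] fun t => (t : ℂ) ^ N (j + 1) := fun j => by
    obtain ⟨n, hn⟩ := hsucc j
    rw [hn]
    exact isBigO_expTerm_succ hq0 hq1 p n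
  have hlow : ∀ j, (fun t : ℝ => (t : ℂ) ^ N j) =O[𝓝[>] 0] expTerm q p (N j) := fun j => by
    cases j with
    | zero => simpa [hN0] using isBigO_one_expTerm_zero hq0 hq1 hp
    | succ j =>
      obtain ⟨n, hn⟩ := hsucc j
      have := hne (j + 1)
      rw [hn] at this ⊢
      exact isBigO_pow_expTerm_succ hq0 hq1 (this n.succ_ne_zero)
  refine ⟨fun j => ?_, fun J => (tail_isBigO hq0 hq1 p hN hsum J).trans (hlow (J + 1))⟩
  exact ((hup j).trans_isLittleO (isLittleO_ofReal_pow (hN j.lt_succ_self))).trans_isBigO (hlow j)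

/-- The nonzero polynomial `p̃` has finitely many roots and the points `q^(-n)` are distinct, so
infinitely many indices survive; `N` enumerates them. -/
theorem exists_strictMono_numeratorEval_ne_zero {q : ℝ} (hq0 : 0 < q) (hq1 : q < 1) {p : ℝ[X]}
    (hp : p ≠ 0) : ∃ N : ℕ → ℕ, StrictMono N ∧ N 0 = 0 ∧
      (∀ j, N j ≠ 0 → numeratorEval p ((q : ℂ)⁻¹ ^ N j) ≠ 0) ∧
      ∀ n, n ∉ range N → numeratorEval p ((q : ℂ)⁻¹ ^ n) = 0 := by
  classical
  have hP : numeratorPoly p ≠ 0 := fun h =>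
    numeratorPoly_eval_one_ne_zero hp (by rw [h, Polynomial.eval_zero])
  set S : ℕ → Prop := fun n => n = 0 ∨ numeratorEval p ((q : ℂ)⁻¹ ^ n) ≠ 0 with hS
  have hfin : {n : ℕ | numeratorEval p ((q : ℂ)⁻¹ ^ n) = 0}.Finite := by
    have hr : ((numeratorPoly p).rootSet ℂ).Finite := Polynomial.rootSet_finite _ _
    refine Set.Finite.of_finite_image (f := fun n : ℕ => (q : ℂ)⁻¹ ^ n)
      (hr.subset ?_) ?_
    · rintro _ ⟨n, hn, rfl⟩
      exact (Polynomial.mem_rootSet_of_ne hP).2 hn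
    · intro a _ b _ hab
      have h1 : (q⁻¹ : ℝ) ^ a = q⁻¹ ^ b := by
        have : (q : ℂ)⁻¹ ^ a = (q : ℂ)⁻¹ ^ b := hab
        exact_mod_cast this
      exact (pow_right_strictMono₀ ((one_lt_inv₀ hq0).2 hq1)).injective h1
  have hinf : (Set.ofPred S).Infinite := by
    refine (hfin.infinite_compl).mono fun n hn => Or.inr hn
  refine ⟨Nat.nth S, Nat.nth_strictMono hinf, Nat.nth_zero_of_zero (Or.inl rfl), fun j hj => ?_,
    fun n hn => ?_⟩
  · exact (Nat.nth_mem_of_infinite hinf j).resolve_left hj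
  · rw [Nat.range_nth_of_infinite hinf] at hn
    by_contra h
    exact hn (Or.inr h)

/-! ### Functional calculus on eigenvectors and traces -/

section Trace

variable {H : Type*} [NormedAddCommGroup H] [InnerProductSpace ℂ H]

/-- The double family `c k |⟪e k, b i⟫|²` is absolutely summable. By Parseval its sum over `i` is `c
k`; its sum over `k` is the diagonal entry of `T` at `b i`. -/
theorem hasSum_inner_apply {ι κ : Type*} (e : HilbertBasis κ ℂ H) {c : κ → ℂ}
    (hc : Summable fun k => ‖c k‖) {T : H →L[ℂ] H} (hT : ∀ k, T (e k) = c k • e k)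
    (b : HilbertBasis ι ℂ H) : HasSum (fun i => ⟪b i, T (b i)⟫_ℂ) (∑' k, c k) := by
  have hrow : ∀ k, HasSum (fun i => c k * (⟪e k, b i⟫_ℂ * ⟪b i, e k⟫_ℂ)) (c k) := fun k => by
    have := (b.hasSum_inner_mul_inner (e k) (e k)).mul_left (c k)
    rwa [inner_self_eq_norm_sq_to_K, e.orthonormal.1 k, RCLike.ofReal_one, one_pow, mul_one] at this
  have hn : ∀ x y : H, ‖⟪x, y⟫_ℂ * ⟪y, x⟫_ℂ‖ = (⟪x, y⟫_ℂ * ⟪y, x⟫_ℂ).re := fun x y =>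
    (inner_mul_symm_re_eq_norm (𝕜 := ℂ) x y).symm
  have hrow' : ∀ k, HasSum (fun i => ‖c k * (⟪e k, b i⟫_ℂ * ⟪b i, e k⟫_ℂ)‖) ‖c k‖ := fun k => by
    have := (Complex.hasSum_re (b.hasSum_inner_mul_inner (e k) (e k))).mul_left ‖c k‖
    rw [inner_self_eq_norm_sq_to_K, e.orthonormal.1 k, RCLike.ofReal_one, one_pow, Complex.one_re,
      mul_one] at this
    refine this.congr_fun fun i => ?_
    rw [norm_mul, hn]
  have hcol : ∀ i, HasSum (fun k => c k * (⟪e k, b i⟫_ℂ * ⟪b i, e k⟫_ℂ)) ⟪b i, T (b i)⟫_ℂ := fun i => by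
    have h1 := (((e.hasSum_repr (b i)).mapL T).mapL (innerSL ℂ (b i)))
    refine h1.congr_fun fun k => ?_
    simp only [map_smul, hT, innerSL_apply_apply, e.repr_apply_apply, smul_eq_mul]
    ring
  have hs : Summable fun x : κ × ι => c x.1 * (⟪e x.1, b x.2⟫_ℂ * ⟪b x.2, e x.1⟫_ℂ) := by
    refine Summable.of_norm ((summable_prod_of_nonneg fun _ => norm_nonneg _).2
      ⟨fun k => (hrow' k).summable, ?_⟩)
    exact hc.congr fun k => (hrow' k).tsum_eq.symm
  have h2 : HasSum (fun x : κ × ι => c x.1 * (⟪e x.1, b x.2⟫_ℂ * ⟪b x.2, e x.1⟫_ℂ)) (∑' k, c k) := by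
    have h3 := hs.hasSum.prod_fiberwise hrow
    rw [h3.tsum_eq]
    exact hs.hasSum
  exact ((Equiv.prodComm ι κ).hasSum_iff.2 h2).prod_fiberwise hcol

variable [CompleteSpace H]

theorem mem_spectrum_of_eigenvector {K : H →L[ℂ] H} {μ : ℂ} {v : H} (hv : K v = μ • v)
    (hv0 : v ≠ 0) : μ ∈ spectrum ℂ K := by
  rw [ContinuousLinearMap.spectrum_eq]
  exact (Module.End.hasEigenvalue_of_hasEigenvector
    (Module.End.hasEigenvector_iff.2 ⟨Module.End.mem_eigenspace_iff.2 hv, hv0⟩)).mem_spectrum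

/-- By Stone–Weierstrass it suffices to treat constants, the identity and its conjugate, sums,
products and limits. The conjugate is harmless because the eigenvalue is real. -/
theorem cfcHom_apply_eigenvector {K : H →L[ℂ] H} (hK : IsSelfAdjoint K) {μ : ℂ} {v : H}
    (hv : K v = μ • v) (hv0 : v ≠ 0) (f : C(spectrum ℂ K, ℂ)) :
    cfcHom (p := IsStarNormal) hK.isStarNormal f v =
      f ⟨μ, mem_spectrum_of_eigenvector hv hv0⟩ • v := by
  have hμ : (starRingEnd ℂ) μ = μ :=
    (ContinuousLinearMap.isSelfAdjoint_iff_isSymmetric.1 hK).conj_eigenvalue_eq_self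
      (Module.End.hasEigenvalue_of_hasEigenvector
        (Module.End.hasEigenvector_iff.2 ⟨Module.End.mem_eigenspace_iff.2 hv, hv0⟩))
  induction f using ContinuousMap.induction_on_of_compact with
  | const r =>
    have : ContinuousMap.const (spectrum ℂ K) r = algebraMap ℂ _ r := rfl
    rw [this, AlgHomClass.commutes]
    simp [Algebra.algebraMap_eq_smul_one]
  | id =>
    rw [cfcHom_id, hv]
    rfl
  | star_id =>
    rw [map_star, cfcHom_id, hK.star_eq, hv]
    show μ • v = (starRingEnd ℂ) μ • v
    rw [hμ]
  | add f g hf hg =>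
    rw [map_add, add_apply, hf, hg, ContinuousMap.add_apply, add_smul]
  | mul f g hf hg =>
    rw [map_mul, mul_apply_eq_comp, hg, map_smul, hf, ContinuousMap.mul_apply,
      smul_smul, mul_comm]
  | frequently f h =>
    have hc : IsClosed {g : C(spectrum ℂ K, ℂ) | cfcHom (p := IsStarNormal) hK.isStarNormal g v =
        g ⟨μ, mem_spectrum_of_eigenvector hv hv0⟩ • v} := by
      refine isClosed_eq ?_ ?_
      · exact (ContinuousLinearMap.apply ℂ H v).continuous.comp (cfcHom_continuous _)
      · exact (continuous_eval_const _).smul continuous_const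
    exact hc.closure_subset (mem_closure_iff_frequently.2 h)

theorem cfc_apply_eigenvector {K : H →L[ℂ] H} (hK : IsSelfAdjoint K) {f : ℂ → ℂ}
    (hf : ContinuousOn f (spectrum ℂ K)) {μ : ℂ} {v : H} (hv : K v = μ • v) :
    cfc f K v = f μ • v := by
  rcases eq_or_ne v 0 with rfl | hv0
  · simp
  rw [cfc_apply f K hK.isStarNormal hf, cfcHom_apply_eigenvector hK hv hv0]
  rfl

/-- Since `|f(K)| = |f|(K)`, trace-class membership also reduces to the eigenbasis. -/
theorem abs_cfc_apply_eigenvector {K : H →L[ℂ] H} (hK : IsSelfAdjoint K) {f : ℂ → ℂ}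
    (hf : ContinuousOn f (spectrum ℂ K)) {μ : ℂ} {v : H} (hv : K v = μ • v) :
    CFC.abs (cfc f K) v = (‖f μ‖ : ℂ) • v := by
  have hN : IsStarNormal (cfc f K) := cfc_predicate f K
  have hKN := hK.isStarNormal
  rw [CFC.abs_eq_cfcₙ_coe_norm ℂ (cfc f K) hN, cfcₙ_eq_cfc (by fun_prop) (by simp)]
  show cfc (fun z : ℂ => ((‖z‖ : ℝ) : ℂ)) (cfc f K) v = _
  rw [← cfc_comp' (fun z : ℂ => ((‖z‖ : ℝ) : ℂ)) f K (by fun_prop) hf hKN]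
  exact cfc_apply_eigenvector hK (Continuous.comp_continuousOn
    (by fun_prop : Continuous fun z : ℂ => ((‖z‖ : ℝ) : ℂ)) hf) hv

theorem hasTrace_cfc {κ : Type*} {K : H →L[ℂ] H} (hK : IsSelfAdjoint K) (e : HilbertBasis κ ℂ H)
    {μ : κ → ℂ} (he : ∀ k, K (e k) = μ k • e k) {f : ℂ → ℂ} (hf : ContinuousOn f (spectrum ℂ K))
    (hs : Summable fun k => ‖f (μ k)‖) : HasTrace (cfc f K) (∑' k, f (μ k)) := by
  refine ⟨fun ι b => ?_, fun ι b =>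
    hasSum_inner_apply e hs (fun k => cfc_apply_eigenvector hK hf (he k)) b⟩
  refine (Complex.hasSum_re (hasSum_inner_apply e (c := fun k => (‖f (μ k)‖ : ℂ)) ?_
    (fun k => abs_cfc_apply_eigenvector hK hf (he k)) b)).summable
  simpa using hs

end Trace

/-! ### Positive operators with compact inverse -/

namespace IsPositiveWithCompactInverse

section Algebra

variable {H : Type*} [NormedAddCommGroup H] [InnerProductSpace ℂ H] {P : H →ₗ.[ℂ] H} {K : H →L[ℂ] H}

theorem apply_mem_domain (hP : IsPositiveWithCompactInverse P K) (y : H) : K y ∈ P.domain :=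
  (hP.right_inv y).1

theorem apply_apply (hP : IsPositiveWithCompactInverse P K) (y : H) :
    P ⟨K y, hP.apply_mem_domain y⟩ = y :=
  (hP.right_inv y).2

theorem isPositive (hP : IsPositiveWithCompactInverse P K) : K.IsPositive := by
  rw [← ContinuousLinearMap.isPositive_toLinearMap_iff, LinearMap.isPositive_iff_complex]
  intro x
  have h := hP.nonneg ⟨K x, hP.apply_mem_domain x⟩
  rw [hP.apply_apply] at h
  obtain ⟨h1, h2⟩ := Complex.le_def.1 h
  refine ⟨Complex.ext rfl ?_, h1⟩
  exact h2

theorem injective (hP : IsPositiveWithCompactInverse P K) : Function.Injective K := by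
  intro x y hxy
  rw [← hP.apply_apply x, ← hP.apply_apply y]
  congr 1
  exact Subtype.ext hxy

theorem operatorEigenspace_eq (hP : IsPositiveWithCompactInverse P K) {z : ℂ} (hz : z ≠ 0) :
    operatorEigenspace P z = Module.End.eigenspace (K : H →ₗ[ℂ] H) z⁻¹ := by
  ext v
  rw [operatorEigenspace, Submodule.mem_map, Module.End.mem_eigenspace_iff]
  constructor
  · rintro ⟨x, hx, rfl⟩
    have h1 : P x = z • (x : H) := sub_eq_zero.1 hx
    have h2 := hP.left_inv x
    rw [h1, map_smul] at h2
    show K (x : H) = z⁻¹ • (x : H)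
    rw [eq_inv_smul_iff₀ hz, h2]
  · intro hv
    have hv' : K v = z⁻¹ • v := hv
    have hmem : v ∈ P.domain := by
      have := P.domain.smul_mem z (hP.apply_mem_domain v)
      rwa [hv', smul_inv_smul₀ hz] at this
    refine ⟨⟨v, hmem⟩, ?_, rfl⟩
    show P ⟨v, hmem⟩ - z • v = 0
    refine sub_eq_zero.2 (hP.injective ?_)
    rw [hP.left_inv, map_smul, hv', smul_inv_smul₀ hz]

theorem inv_mem_operatorSpectrum (hP : IsPositiveWithCompactInverse P K) {μ : ℂ} {v : H}
    (hv : K v = μ • v) (hv0 : v ≠ 0) : μ ≠ 0 ∧ μ⁻¹ ∈ operatorSpectrum P := by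
  have hμ : μ ≠ 0 := by
    rintro rfl
    rw [zero_smul] at hv
    exact hv0 (hP.injective (hv.trans (map_zero K).symm))
  refine ⟨hμ, fun hb => hv0 ?_⟩
  have hmem : v ∈ operatorEigenspace P μ⁻¹ := by
    rw [hP.operatorEigenspace_eq (inv_ne_zero hμ), inv_inv]
    exact Module.End.mem_eigenspace_iff.2 hv
  obtain ⟨x, hx, rfl⟩ := hmem
  have h0 : (fun x : P.domain => P x - μ⁻¹ • (x : H)) x =
      (fun x : P.domain => P x - μ⁻¹ • (x : H)) 0 := by
    have h1 : P x - μ⁻¹ • (x : H) = 0 := hx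
    have h2 : P (0 : P.domain) = 0 := P.toFun.map_zero
    simp only [h1, h2]
    simp
  rw [hb.injective h0]
  rfl

variable {q : ℝ} {p : ℝ[X]}

theorem eigenvalue_eq (hP : IsPositiveWithCompactInverse P K)
    (hspec : operatorSpectrum P = range fun n : ℕ => (q : ℂ)⁻¹ ^ n) {μ : ℂ} {v : H}
    (hv : K v = μ • v) (hv0 : v ≠ 0) : ∃ n : ℕ, μ = (q : ℂ) ^ n := by
  obtain ⟨hμ, h⟩ := hP.inv_mem_operatorSpectrum hv hv0
  rw [hspec] at h
  obtain ⟨n, hn⟩ := h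
  exact ⟨n, by rw [← inv_inj, ← inv_pow]; exact hn.symm⟩

theorem finrank_eigenspace (hP : IsPositiveWithCompactInverse P K) (hq0 : 0 < q)
    (hmult : ∀ n : ℕ,
      (Module.finrank ℂ (operatorEigenspace P ((q : ℂ)⁻¹ ^ n)) : ℝ) = p.eval (n : ℝ)) (n : ℕ) :
    (Module.finrank ℂ (Module.End.eigenspace (K : H →ₗ[ℂ] H) ((q : ℂ) ^ n)) : ℝ) = p.eval (n : ℝ) := by
  have hq : (q : ℂ) ≠ 0 := Complex.ofReal_ne_zero.2 hq0.ne'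
  rw [← hmult, hP.operatorEigenspace_eq (pow_ne_zero n (inv_ne_zero hq)), inv_pow, inv_inv]

end Algebra

variable {H : Type*} [NormedAddCommGroup H] [InnerProductSpace ℂ H] [CompleteSpace H]
  {P : H →ₗ.[ℂ] H} {K : H →L[ℂ] H} {q : ℝ} {p : ℝ[X]}

/-- By the spectral theorem for compact self-adjoint operators the eigenspaces of `K` span a dense
subspace. All eigenvalues are powers `q^n`, so orthonormal bases of these finite-dimensional,
mutually orthogonal spaces fit together. -/
theorem exists_hilbertBasis (hP : IsPositiveWithCompactInverse P K) (hq0 : 0 < q) (hq1 : q < 1)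
    (hspec : operatorSpectrum P = range fun n : ℕ => (q : ℂ)⁻¹ ^ n) :
    ∃ e : HilbertBasis
        (Σ n : ℕ, Fin (Module.finrank ℂ (Module.End.eigenspace (K : H →ₗ[ℂ] H) ((q : ℂ) ^ n)))) ℂ H,
      ∀ k, K (e k) = (q : ℂ) ^ k.1 • e k := by
  have hq : (q : ℂ) ≠ 0 := Complex.ofReal_ne_zero.2 hq0.ne'
  have hsymm : (K : H →ₗ[ℂ] H).IsSymmetric := hP.isPositive.isSymmetric
  have hfd : ∀ n : ℕ, FiniteDimensional ℂ (Module.End.eigenspace (K : H →ₗ[ℂ] H) ((q : ℂ) ^ n)) :=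
    fun n => ContinuousLinearMap.finite_dimensional_eigenspace hP.compact _ (pow_ne_zero n hq)
  have hinj : Function.Injective fun n : ℕ => (q : ℂ) ^ n := fun a b hab => by
    have h0 : (q : ℂ) ^ a = (q : ℂ) ^ b := hab
    have h1 : q ^ a = q ^ b := by exact_mod_cast h0
    exact (pow_right_strictAnti₀ hq0 hq1).injective h1
  have hof := hsymm.orthogonalFamily_eigenspaces.comp hinj
  let v : (Σ n : ℕ, Fin (Module.finrank ℂ
      (Module.End.eigenspace (K : H →ₗ[ℂ] H) ((q : ℂ) ^ n)))) → H := fun k =>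
    (stdOrthonormalBasis ℂ (Module.End.eigenspace (K : H →ₗ[ℂ] H) ((q : ℂ) ^ k.1)) k.2 :
      Module.End.eigenspace (K : H →ₗ[ℂ] H) ((q : ℂ) ^ k.1))
  have hon : Orthonormal ℂ v := hof.orthonormal_sigma_orthonormal
    (fun n => (stdOrthonormalBasis ℂ
      (Module.End.eigenspace (K : H →ₗ[ℂ] H) ((q : ℂ) ^ n))).orthonormal)
  have hspan : (Submodule.span ℂ (range v))ᗮ = ⊥ := by
    rw [eq_bot_iff, ← ContinuousLinearMap.orthogonalComplement_iSup_eigenspaces_eq_bot hP.compact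
      hP.isPositive.isSymmetric]
    refine Submodule.orthogonal_le (iSup_le fun μ w hw => ?_)
    rcases eq_or_ne w 0 with rfl | hw0
    · exact Submodule.zero_mem _
    obtain ⟨n, rfl⟩ := hP.eigenvalue_eq hspec (Module.End.mem_eigenspace_iff.1 hw) hw0
    have h1 := (stdOrthonormalBasis ℂ
      (Module.End.eigenspace (K : H →ₗ[ℂ] H) ((q : ℂ) ^ n))).sum_repr ⟨w, hw⟩
    have h2 := congrArg Subtype.val h1
    rw [show w = _ from h2.symm]
    push_cast
    refine Submodule.sum_mem _ fun i _ => Submodule.smul_mem _ _ (Submodule.subset_span ⟨⟨n, i⟩, rfl⟩)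
  refine ⟨HilbertBasis.mkOfOrthogonalEqBot hon hspan, fun k => ?_⟩
  rw [HilbertBasis.coe_mkOfOrthogonalEqBot]
  exact Module.End.mem_eigenspace_iff.1 (Subtype.prop _)

/-- If `p = 0`, the eigenbasis is empty and `H = 0`. Then every map on it is bijective and the
spectrum is empty, contrary to `1` lying in it. -/
theorem polynomial_ne_zero (hP : IsPositiveWithCompactInverse P K) (hq0 : 0 < q) (hq1 : q < 1)
    (hspec : operatorSpectrum P = range fun n : ℕ => (q : ℂ)⁻¹ ^ n)
    (hmult : ∀ n : ℕ,
      (Module.finrank ℂ (operatorEigenspace P ((q : ℂ)⁻¹ ^ n)) : ℝ) = p.eval (n : ℝ)) : p ≠ 0 := by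
  rintro rfl
  obtain ⟨e, -⟩ := hP.exists_hilbertBasis hq0 hq1 hspec
  have hempty : IsEmpty (Σ n : ℕ, Fin (Module.finrank ℂ
      (Module.End.eigenspace (K : H →ₗ[ℂ] H) ((q : ℂ) ^ n)))) := by
    refine ⟨fun k => ?_⟩
    have h1 := hP.finrank_eigenspace hq0 hmult k.1
    rw [Polynomial.eval_zero, Nat.cast_eq_zero] at h1
    exact (Fin.cast h1 k.2).elim0
  have hH : Subsingleton H := by
    refine ⟨fun x y => ?_⟩
    have hz : ∀ x : H, x = 0 := fun x => (e.hasSum_repr x).unique (hasSum_empty)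
    rw [hz x, hz y]
  have h1 : (1 : ℂ) ∈ operatorSpectrum P := by
    rw [hspec]
    exact ⟨0, pow_zero _⟩
  exact h1 ⟨fun x y _ => Subsingleton.elim _ _, fun y => ⟨0, Subsingleton.elim _ _⟩⟩

theorem hasTrace_cfc (hP : IsPositiveWithCompactInverse P K) (hq0 : 0 < q) (hq1 : q < 1)
    (hspec : operatorSpectrum P = range fun n : ℕ => (q : ℂ)⁻¹ ^ n)
    (hmult : ∀ n : ℕ,
      (Module.finrank ℂ (operatorEigenspace P ((q : ℂ)⁻¹ ^ n)) : ℝ) = p.eval (n : ℝ))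
    {f : ℂ → ℂ} (hf : ∀ x : ℝ, 0 ≤ x → ContinuousWithinAt f {z : ℂ | 0 ≤ z} x) {a : ℂ}
    (ha : HasSum (fun n : ℕ => ((p.eval (n : ℝ) : ℝ) : ℂ) * f ((q : ℂ) ^ n)) a) :
    HasTrace (cfc f K) a := by
  obtain ⟨e, he⟩ := hP.exists_hilbertBasis hq0 hq1 hspec
  have hcont : ContinuousOn f (spectrum ℂ K) := by
    have hsub : spectrum ℂ K ⊆ {z : ℂ | 0 ≤ z} := fun z hz =>
      spectrum_nonneg_of_nonneg ((ContinuousLinearMap.nonneg_iff_isPositive K).2 hP.isPositive) hz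
    intro z hz
    have hz0 : (0 : ℂ) ≤ z := hsub hz
    obtain ⟨h1, h2⟩ := Complex.le_def.1 hz0
    have e : z = (z.re : ℂ) := Complex.ext rfl (by simpa using h2.symm)
    have := hf z.re (by simpa using h1)
    rw [← e] at this
    exact this.mono hsub
  have hrank := hP.finrank_eigenspace hq0 hmult
  have hnorm : Summable fun k : Σ n : ℕ, Fin (Module.finrank ℂ
      (Module.End.eigenspace (K : H →ₗ[ℂ] H) ((q : ℂ) ^ n))) => ‖f ((q : ℂ) ^ k.1)‖ := by
    -- Each fibre is finite and contributes `p(n) ‖f(q^n)‖`; `p(n)` is nonnegative because it is a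
    -- dimension.
    refine (summable_sigma_of_nonneg fun _ => norm_nonneg _).2 ⟨fun n => .of_finite, ?_⟩
    refine ha.summable.norm.congr fun n => ?_
    rw [tsum_fintype]
    dsimp only
    rw [Finset.sum_const, Finset.card_univ, Fintype.card_fin, nsmul_eq_mul, hrank,
      norm_mul, ← hrank, Complex.norm_real, Real.norm_natCast]
  have ht := _root_.hasTrace_cfc hP.isPositive.isSelfAdjoint e he hcont hnorm
  have h2 := (hnorm.of_norm.hasSum).sigma fun n => hasSum_fintype _
  have h3 : HasSum (fun n : ℕ => ((p.eval (n : ℝ) : ℝ) : ℂ) * f ((q : ℂ) ^ n))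
      (∑' k : Σ n : ℕ, Fin (Module.finrank ℂ
        (Module.End.eigenspace (K : H →ₗ[ℂ] H) ((q : ℂ) ^ n))), f ((q : ℂ) ^ k.1)) := by
    refine h2.congr_fun fun n => ?_
    dsimp only
    rw [Finset.sum_const, Finset.card_univ, Fintype.card_fin, nsmul_eq_mul, ← hrank]
    norm_cast
  rwa [h3.unique ha] at ht

end IsPositiveWithCompactInverse

/-! ### Traces of the heat operator and of the complex powers -/

theorem continuousWithinAt_heat {t : ℝ} (ht : 0 < t) {x : ℝ} (hx : 0 ≤ x) :
    ContinuousWithinAt (fun z : ℂ => if z = 0 then 0 else Complex.exp (-t / z)) {z : ℂ | 0 ≤ z} x := by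
  rcases hx.eq_or_lt with rfl | hx
  · rw [ContinuousWithinAt, Complex.ofReal_zero, if_pos rfl]
    -- For real `y > 0`, `exp(t/y) ≥ t/y` gives `exp(-t/y) ≤ y/t`. Approach through nonnegative
    -- reals is essential, as `exp(-t/z)` has an essential singularity at `0`.
    refine squeeze_zero_norm' (a := fun z : ℂ => ‖z‖ / t) ?_ ?_
    · filter_upwards [self_mem_nhdsWithin] with z hz
      split_ifs with h
      · rw [norm_zero]; positivity
      · obtain ⟨h1, h2⟩ := Complex.le_def.1 (show (0 : ℂ) ≤ z from hz)
        obtain ⟨y, rfl⟩ : ∃ y : ℝ, z = y := ⟨z.re, Complex.ext rfl (by simpa using h2.symm)⟩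
        have hy : 0 < y := lt_of_le_of_ne (by simpa using h1) (by
          rintro rfl; exact h Complex.ofReal_zero)
        rw [← Complex.ofReal_neg, ← Complex.ofReal_div, ← Complex.ofReal_exp, Complex.norm_real,
          Complex.norm_real, Real.norm_of_nonneg hy.le, Real.norm_of_nonneg (Real.exp_pos _).le,
          neg_div, Real.exp_neg, inv_le_comm₀ (Real.exp_pos _) (by positivity), inv_div]
        exact (le_add_of_nonneg_right zero_le_one).trans (Real.add_one_le_exp _)
    · have : Continuous fun z : ℂ => ‖z‖ / t := by fun_prop
      exact (this.tendsto' 0 0 (by simp)).mono_left nhdsWithin_le_nhds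
  · have hx0 : (x : ℂ) ≠ 0 := Complex.ofReal_ne_zero.2 hx.ne'
    refine ContinuousAt.continuousWithinAt ?_
    have h1 : ContinuousAt (fun z : ℂ => Complex.exp (-t / z)) x :=
      (continuousAt_const.div continuousAt_id hx0).cexp
    refine h1.congr ?_
    filter_upwards [isOpen_ne.mem_nhds hx0] with z hz
    rw [if_neg hz]

theorem hasTrace_complexPowerOperator {q : ℝ} (hq0 : 0 < q) (hq1 : q < 1) {p : ℝ[X]}
    {H : Type*} [NormedAddCommGroup H] [InnerProductSpace ℂ H] [CompleteSpace H]
    {P : H →ₗ.[ℂ] H} {K : H →L[ℂ] H} (hP : IsPositiveWithCompactInverse P K)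
    (hspec : operatorSpectrum P = range fun n : ℕ => (q : ℂ)⁻¹ ^ n)
    (hmult : ∀ n : ℕ,
      (Module.finrank ℂ (operatorEigenspace P ((q : ℂ)⁻¹ ^ n)) : ℝ) = p.eval (n : ℝ))
    {s : ℂ} (hs : 0 < s.re) : HasTrace (complexPowerOperator K s) (expZeta q p s) := by
  refine hP.hasTrace_cfc hq0 hq1 hspec hmult (fun x hx => ?_) ?_
  · exact (Complex.continuousAt_cpow_const_of_re_pos (Or.inl (by simpa using hx))
      hs).continuousWithinAt
  · have hz : ‖(q : ℂ) ^ s‖ < 1 := by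
      rw [norm_ofReal_cpow hq0]
      exact Real.rpow_lt_one hq0.le hq1 hs
    refine (numeratorEval_div hz).congr_fun fun n => ?_
    rw [← Complex.ofReal_pow, ofReal_cpow_eq_exp (pow_pos hq0 n), ofReal_cpow_eq_exp hq0,
      ← Complex.exp_nat_mul, Real.log_pow]
    push_cast
    ring_nf

theorem hasTrace_heatOperator {q : ℝ} (hq0 : 0 < q) (hq1 : q < 1) {p : ℝ[X]}
    {H : Type*} [NormedAddCommGroup H] [InnerProductSpace ℂ H] [CompleteSpace H]
    {P : H →ₗ.[ℂ] H} {K : H →L[ℂ] H} (hP : IsPositiveWithCompactInverse P K)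
    (hspec : operatorSpectrum P = range fun n : ℕ => (q : ℂ)⁻¹ ^ n)
    (hmult : ∀ n : ℕ,
      (Module.finrank ℂ (operatorEigenspace P ((q : ℂ)⁻¹ ^ n)) : ℝ) = p.eval (n : ℝ))
    {t : ℝ} (ht : 0 < t) :
    HasTrace (heatOperator K t) (expTerm q p 0 t + ∑' n, expTerm q p (n + 1) t) := by
  refine hP.hasTrace_cfc hq0 hq1 hspec hmult (fun x hx => continuousWithinAt_heat ht hx) ?_
  have h := hasSum_heat hq0 hq1 p ht
  rw [(hasSum_residueTerm_latticePole hq0 hq1 p ht).tsum_eq] at h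
  refine h.congr_fun fun n => ?_
  rw [if_neg (pow_ne_zero n (Complex.ofReal_ne_zero.2 hq0.ne'))]

theorem mainTheorem10
    (q : ℝ) (hq0 : 0 < q) (hq1 : q < 1) (p : ℝ[X])
    {H : Type*} [NormedAddCommGroup H] [InnerProductSpace ℂ H] [CompleteSpace H]
    (P : H →ₗ.[ℂ] H) (K : H →L[ℂ] H) (hP : IsPositiveWithCompactInverse P K)
    (hspec : operatorSpectrum P = Set.range fun n : ℕ => (q : ℂ)⁻¹ ^ n)
    (hmult : ∀ n : ℕ,
      (Module.finrank ℂ (operatorEigenspace P ((q : ℂ)⁻¹ ^ n)) : ℝ) = p.eval (n : ℝ)) :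
    -- the numerator polynomial
    (numeratorPoly p).natDegree ≤ p.natDegree ∧
    ((numeratorPoly p).natDegree = p.natDegree ↔ p.eval (-1) ≠ 0) ∧
    (numeratorPoly p).eval 1 = p.natDegree.factorial * p.leadingCoeff ∧
    (numeratorPoly p).eval 1 ≠ 0 ∧
    -- the zeta function and its meromorphic continuation
    IsZetaAbscissa K 0 ∧
    (∀ s : ℂ, 0 < s.re → HasTrace (complexPowerOperator K s) (expZeta q p s)) ∧
    Meromorphic (expZeta q p) ∧
    -- the Fourier series converge absolutely
    (∀ j ≤ p.natDegree, Summable fun k : ℤ => ‖oscCoeff q p j k‖) ∧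
    ∃ h : ℝ → ℂ,
      -- the heat trace is well defined and equals `h`
      (∀ t : ℝ, 0 < t → HasTrace (heatOperator K t) (h t)) ∧
      -- the residue expansion is absolutely exact, for every admissible choice of strips
      (∀ (R : ℕ → ℝ) (y : ℕ → ℤ → ℝ), IsAdmissibleCut (expZ q p) 0 R y →
        ∃ φ : ℕ → ℝ → ℂ, IsResidueScale (expZ q p) R y φ ∧ IsAbsolutelyExact h φ) ∧
      -- for a suitable choice of strips it is an asymptotic expansion with respect to a scale
      (∃ (R : ℕ → ℝ) (y : ℕ → ℤ → ℝ) (φ : ℕ → ℝ → ℂ), IsAdmissibleCut (expZ q p) 0 R y ∧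
        IsResidueScale (expZ q p) R y φ ∧ IsAsymptoticExpansionAtZero h φ ∧
        IsAbsolutelyExact h φ) ∧
      -- for strips of unit width its terms are the explicit ones
      (∃ y : ℕ → ℤ → ℝ,
        IsAdmissibleCut (expZ q p) 0 (fun n => (n : ℝ) - 1 / 2) y ∧
        IsResidueScale (expZ q p) (fun n => (n : ℝ) - 1 / 2) y (expTerm q p)) ∧
      IsAbsolutelyExact h (expTerm q p) ∧
      -- the explicit formula, for all `t > 0`
      ∀ t : ℝ, 0 < t →
        Summable (fun n : ℕ => ‖numeratorEval p ((q : ℂ)⁻¹ ^ (n + 1)) /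
          (1 - (q : ℂ)⁻¹ ^ (n + 1)) ^ (p.natDegree + 1) *
            ((-(t : ℂ)) ^ (n + 1) / ((n + 1).factorial : ℂ))‖) ∧
        h t =
          numeratorEval p 1 / ((p.natDegree + 1).factorial : ℂ) *
              (Real.logb q t : ℂ) ^ (p.natDegree + 1) +
            (∑ j ∈ Finset.range (p.natDegree + 1),
              (constCoeff q p j + oscSeries q p j (Real.logb q t)) * (Real.logb q t : ℂ) ^ j) +
            ∑' n : ℕ, numeratorEval p ((q : ℂ)⁻¹ ^ (n + 1)) /
              (1 - (q : ℂ)⁻¹ ^ (n + 1)) ^ (p.natDegree + 1) *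
                ((-(t : ℂ)) ^ (n + 1) / ((n + 1).factorial : ℂ)) := by
  have hp : p ≠ 0 := hP.polynomial_ne_zero hq0 hq1 hspec hmult
  have hzeta : ∀ s : ℂ, 0 < s.re → HasTrace (complexPowerOperator K s) (expZeta q p s) :=
    fun s hs => hasTrace_complexPowerOperator hq0 hq1 hP hspec hmult hs
  -- The divergence clause of the abscissa concerns `0 < σ < 0` and is empty.
  refine ⟨(numeratorPoly_spec p).1, numeratorPoly_natDegree_eq_iff hp, (numeratorPoly_spec p).2.2.1,
    numeratorPoly_eval_one_ne_zero hp, ⟨le_rfl, fun σ hσ => ⟨fun _ => (hzeta σ (by simpa using hσ)).1,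
      fun h => absurd h hσ.not_gt⟩⟩, hzeta, meromorphic_expZeta hq0 p,
    fun j _ => summable_norm_oscCoeff hq0 hq1 p j,
    fun t => expTerm q p 0 t + ∑' n, expTerm q p (n + 1) t,
    fun t ht => hasTrace_heatOperator hq0 hq1 hP hspec hmult ht, ?_, ?_, ?_, ?_, ?_⟩
  · intro R y hcut
    obtain ⟨σ, hσ⟩ := exists_isStripIndex (q := q) hcut.strictMono_R hcut.tendsto_R
      hcut.lt_neg_R_zero
    exact ⟨_, isResidueScale_residueBlock hq0 hq1 p hcut hσ,
      isAbsolutelyExact_residueBlock hq0 hq1 p σ fun _ _ => rfl⟩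
  · obtain ⟨N, hN, hN0, hne, hzero⟩ := exists_strictMono_numeratorEval_ne_zero hq0 hq1 hp
    have hz : ∀ n, n ∉ range N → ∀ t, 0 < t → expTerm q p n t = 0 := fun n hn t _ => by
      cases n with
      | zero => exact absurd ⟨0, hN0⟩ hn
      | succ n => rw [expTerm, hzero _ hn, zero_div, zero_mul]
    obtain ⟨h1, h2⟩ := isResidueScale_expTerm hq0 hq1 p hN hN0 hz fun _ _ => rfl
    exact ⟨_, _, _, isAdmissibleCut_expZ hq0 hq1 p hN hN0, h1,
      isAsymptoticExpansionAtZero_expTerm hq0 hq1 hp hN hN0 hne h2.1, h2⟩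
  · exact ⟨_, isAdmissibleCut_expZ hq0 hq1 p strictMono_id rfl,
      (isResidueScale_expTerm hq0 hq1 p strictMono_id rfl (fun n hn => absurd ⟨n, rfl⟩ hn)
        fun _ _ => rfl).1⟩
  · exact (isResidueScale_expTerm hq0 hq1 p strictMono_id rfl (fun n hn => absurd ⟨n, rfl⟩ hn)
      fun _ _ => rfl).2
  · exact fun t ht => ⟨(hasSum_expTerm_succ hq0 hq1 p ht).summable.norm, rfl⟩
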